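/- Let $\Gamma$ be a coalgebra over a field $k$. A right $\Gamma$-comodule $I$ is quasifinite if $\operatorname{Hom}_{-\Gamma}(F,I)$ is finite-dimensional for every finite-dimensional right comodule $F$. Put $I^{*}=h_{-\Gamma}(I,\Gamma)=\varinjlim_{\Lambda}\mathrm{D}\operatorname{Hom}_{-\Gamma}(\Lambda,I)$, the direct limit over the finite-dimensional subcoalgebras $\Lambda\subseteq\Gamma$, where $\mathrm{D}=\operatorname{Hom}_k(-,k)$; it is a left $\Gamma$-comodule, contravariant in $I$. For a copresentation $0\to M\to I_0\to I_1$ of $M$ by quasifinite injective right $\Gamma$-comodules, the transpose is the left comodule $\operatorname{Tr}M=\ker(I_1^{*}\to I_0^{*})$. For a finite-dimensional subcoalgebra $\Lambda$ of $\Gamma$ containing the coefficient space $\operatorname{cf}(M)$, $\operatorname{Tr}_\Lambda M$ is the transpose over $\Lambda$ (in the same sense, with $\Lambda$ in place of $\Gamma$) computed from the sequence $0\to M\to I_0\square\Lambda\to I_1\square\Lambda$. Let $M$ be a finite-dimensional right $\Gamma$-comodule that is indecomposable and not injective, and let $0\to M\to I_0\to I_1$ be any quasifinite injective copresentation of $M$.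 Then: (1) For every finite-dimensional subcoalgebra $\Lambda\supseteq\operatorname{cf}(M)$, the sequence $0\to M\to I_0\square\Lambda\to I_1\square\Lambda$ is a quasifinite injective copresentation of $M$ over $\Lambda$, and $\operatorname{Tr}_\Lambda M$ is finite-dimensional. If the given copresentation is minimal, then every such $\Lambda$ is contained in a finite-dimensional subcoalgebra $\Lambda'$ for which the copresentation over $\Lambda'$ is minimal too. (2) For every such $\Lambda$ there is an isomorphism of left $\Lambda$-comodules $\operatorname{Tr}_\Lambda M\cong\Lambda\square\operatorname{Tr}M$, whose composite with the canonical map $\Lambda\square\operatorname{Tr}M\to\operatorname{Tr}M$, $\sum l\otimes x\mapsto\sum\varepsilon(l)x$, is the restriction of the canonical map $h_{-\Lambda}(I_1\square\Lambda,\Lambda)\to h_{-\Gamma}(I_1,\Gamma)$. (3) With these maps to $\operatorname{Tr}M$, and the unique transition maps $\operatorname{Tr}_\Lambda M\to\operatorname{Tr}_{\Lambda'}M$ $(\Lambda\subseteq\Lambda')$ compatible with them, $$\varinjlim_{\Lambda}\operatorname{Tr}_\Lambda M=\operatorname{Tr}M$$ in the category of left $\Gamma$-comodules, where $\Lambda$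 runs over the directed set of finite-dimensional subcoalgebras of $\Gamma$ containing $\operatorname{cf}(M)$. -/

import Mathlib

open scoped TensorProduct

universe u

/-- A right comodule structure `ρ : M → M ⊗ C` over the coalgebra `C`. -/
structure RightCoaction (k C M : Type u) [Field k] [AddCommGroup C] [Module k C] [Coalgebra k C]
    [AddCommGroup M] [Module k M] where
  toLin : M →ₗ[k] M ⊗[k] C
  coassoc : (TensorProduct.assoc k M C C).toLinearMap ∘ₗ toLin.rTensor C ∘ₗ toLin =
    (Coalgebra.comul (R := k) (A := C)).lTensor M ∘ₗ toLin
  counit : (TensorProduct.rid k M).toLinearMap ∘ₗ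
    (Coalgebra.counit (R := k) (A := C)).lTensor M ∘ₗ toLin = LinearMap.id

/-- A left comodule structure `lam : M → C ⊗ M` over the coalgebra `C`. -/
structure LeftCoaction (k C M : Type u) [Field k] [AddCommGroup C] [Module k C] [Coalgebra k C]
    [AddCommGroup M] [Module k M] where
  toLin : M →ₗ[k] C ⊗[k] M
  coassoc : (TensorProduct.assoc k C C M).toLinearMap ∘ₗ
    (Coalgebra.comul (R := k) (A := C)).rTensor M ∘ₗ toLin = toLin.lTensor C ∘ₗ toLin
  counit : (TensorProduct.lid k M).toLinearMap ∘ₗ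
    (Coalgebra.counit (R := k) (A := C)).rTensor M ∘ₗ toLin = LinearMap.id

/-- A linear map with image in the range of an injective map `j`, viewed as a map into the source
of `j`. -/
noncomputable def liftInj {k : Type u} [Field k] {V A B : Type u} [AddCommGroup V] [Module k V]
    [AddCommGroup A] [Module k A] [AddCommGroup B] [Module k B] (j : A →ₗ[k] B)
    (hj : Function.Injective j) (f : V →ₗ[k] B) (hf : ∀ v, f v ∈ LinearMap.range j) :
    V →ₗ[k] A :=
  (LinearEquiv.ofInjective j hj).symm.toLinearMap ∘ₗ f.codRestrict (LinearMap.range j) hf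

theorem liftInj_spec {k : Type u} [Field k] {V A B : Type u} [AddCommGroup V] [Module k V]
    [AddCommGroup A] [Module k A] [AddCommGroup B] [Module k B] (j : A →ₗ[k] B)
    (hj : Function.Injective j) (f : V →ₗ[k] B) (hf : ∀ v, f v ∈ LinearMap.range j) :
    j ∘ₗ liftInj j hj f hf = f := by
  ext v
  have := LinearEquiv.ofInjective_apply j
    ((LinearEquiv.ofInjective j hj).symm (f.codRestrict (LinearMap.range j) hf v)) (h := hj)
  simp only [LinearEquiv.apply_symm_apply] at this
  exact this.symm

theorem FDSubcoalgebra.map_inj {k C : Type u} [Field k] [AddCommGroup C] [Module k C]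
    (N : Submodule k C) : Function.Injective (TensorProduct.map N.subtype N.subtype) :=
  TensorProduct.map_injective_of_flat_flat _ _ N.injective_subtype N.injective_subtype

section Subspaces

variable {k C M : Type u} [Field k] [AddCommGroup C] [Module k C] [Coalgebra k C]
  [AddCommGroup M] [Module k M]

theorem rTensor_inj (N : Submodule k M) (D : Type u) [AddCommGroup D] [Module k D] :
    Function.Injective (N.subtype.rTensor D) :=
  Module.Flat.rTensor_preserves_injective_linearMap _ N.injective_subtype

theorem lTensor_inj (N : Submodule k M) (D : Type u) [AddCommGroup D] [Module k D] :
    Function.Injective (N.subtype.lTensor D) :=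
  Module.Flat.lTensor_preserves_injective_linearMap _ N.injective_subtype

/-- `N` is a subcomodule of `M`: the coaction maps `N` into `N ⊗ C`. -/
def RightCoaction.IsSub (ρ : RightCoaction k C M) (N : Submodule k M) : Prop :=
  ∀ x ∈ N, ρ.toLin x ∈ LinearMap.range (N.subtype.rTensor C)

/-- `N` is a subcomodule of `M`: the coaction maps `N` into `C ⊗ N`. -/
def LeftCoaction.IsSub (lam : LeftCoaction k C M) (N : Submodule k M) : Prop :=
  ∀ x ∈ N, lam.toLin x ∈ LinearMap.range (N.subtype.lTensor C)

/-- The right comodule structure on a subcomodule. -/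
noncomputable def RightCoaction.sub (ρ : RightCoaction k C M) (N : Submodule k M)
    (h : ρ.IsSub N) : RightCoaction k C N where
  toLin := liftInj (N.subtype.rTensor C) (rTensor_inj N C) (ρ.toLin ∘ₗ N.subtype)
    (fun v => h v v.2)
  coassoc := by
    set l := liftInj (N.subtype.rTensor C) (rTensor_inj N C) (ρ.toLin ∘ₗ N.subtype)
      (fun v => h v v.2) with hl
    have hs : N.subtype.rTensor C ∘ₗ l = ρ.toLin ∘ₗ N.subtype := liftInj_spec _ _ _ _
    have hinj := rTensor_inj N (C ⊗[k] C)
    apply LinearMap.ext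
    intro x
    apply hinj
    have e1 : (N.subtype.rTensor (C ⊗[k] C)) ∘ₗ (TensorProduct.assoc k N C C).toLinearMap =
        (TensorProduct.assoc k M C C).toLinearMap ∘ₗ (N.subtype.rTensor C).rTensor C := by
      ext; rfl
    have e2 : (N.subtype.rTensor (C ⊗[k] C)) ∘ₗ (Coalgebra.comul (R := k) (A := C)).lTensor N =
        (Coalgebra.comul (R := k) (A := C)).lTensor M ∘ₗ (N.subtype.rTensor C) := by
      ext; rfl
    have e3 : (N.subtype.rTensor C).rTensor C ∘ₗ l.rTensor C =
        ρ.toLin.rTensor C ∘ₗ N.subtype.rTensor C := by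
      rw [← LinearMap.rTensor_comp, hs, LinearMap.rTensor_comp]
    have a1 := LinearMap.congr_fun e1 (l.rTensor C (l x))
    have a2 := LinearMap.congr_fun e2 (l x)
    have a3 := LinearMap.congr_fun e3 (l x)
    have a4 := LinearMap.congr_fun hs x
    have a5 := LinearMap.congr_fun ρ.coassoc (x : M)
    simp only [LinearMap.comp_apply, LinearEquiv.coe_coe, Submodule.subtype_apply] at *
    rw [a1, a2, a3, a4, a5]
  counit := by
    set l := liftInj (N.subtype.rTensor C) (rTensor_inj N C) (ρ.toLin ∘ₗ N.subtype)
      (fun v => h v v.2) with hl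
    have hs : N.subtype.rTensor C ∘ₗ l = ρ.toLin ∘ₗ N.subtype := liftInj_spec _ _ _ _
    apply LinearMap.ext
    intro x
    apply N.injective_subtype
    have e2 : N.subtype ∘ₗ (TensorProduct.rid k N).toLinearMap ∘ₗ
        (Coalgebra.counit (R := k) (A := C)).lTensor N =
        (TensorProduct.rid k M).toLinearMap ∘ₗ
        (Coalgebra.counit (R := k) (A := C)).lTensor M ∘ₗ (N.subtype.rTensor C) := by
      ext; simp
    have a2 := LinearMap.congr_fun e2 (l x)
    have a4 := LinearMap.congr_fun hs x
    have a5 := LinearMap.congr_fun ρ.counit (x : M)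
    simp only [LinearMap.comp_apply, LinearEquiv.coe_coe, Submodule.subtype_apply,
      LinearMap.id_apply] at *
    rw [a2, a4, a5]

/-- The left comodule structure on a subcomodule. -/
noncomputable def LeftCoaction.sub (lam : LeftCoaction k C M) (N : Submodule k M)
    (h : lam.IsSub N) : LeftCoaction k C N where
  toLin := liftInj (N.subtype.lTensor C) (lTensor_inj N C) (lam.toLin ∘ₗ N.subtype)
    (fun v => h v v.2)
  coassoc := by
    set l := liftInj (N.subtype.lTensor C) (lTensor_inj N C) (lam.toLin ∘ₗ N.subtype)
      (fun v => h v v.2) with hl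
    have hs : N.subtype.lTensor C ∘ₗ l = lam.toLin ∘ₗ N.subtype := liftInj_spec _ _ _ _
    have hinj : Function.Injective ((N.subtype.lTensor C).lTensor C) :=
      Module.Flat.lTensor_preserves_injective_linearMap _ (lTensor_inj N C)
    apply LinearMap.ext
    intro x
    apply hinj
    have e1 : (N.subtype.lTensor C).lTensor C ∘ₗ (TensorProduct.assoc k C C N).toLinearMap ∘ₗ
          (Coalgebra.comul (R := k) (A := C)).rTensor N =
        (TensorProduct.assoc k C C M).toLinearMap ∘ₗ
          (Coalgebra.comul (R := k) (A := C)).rTensor M ∘ₗ N.subtype.lTensor C := by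
      have : (N.subtype.lTensor C).lTensor C ∘ₗ (TensorProduct.assoc k C C N).toLinearMap =
          (TensorProduct.assoc k C C M).toLinearMap ∘ₗ N.subtype.lTensor (C ⊗[k] C) := by
        ext; rfl
      rw [← LinearMap.comp_assoc, this, LinearMap.comp_assoc, LinearMap.lTensor_comp_rTensor,
        LinearMap.rTensor_comp_lTensor]
    have e3 : (N.subtype.lTensor C).lTensor C ∘ₗ l.lTensor C =
        lam.toLin.lTensor C ∘ₗ N.subtype.lTensor C := by
      rw [← LinearMap.lTensor_comp, hs, LinearMap.lTensor_comp]
    have a1 := LinearMap.congr_fun e1 (l x)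
    have a3 := LinearMap.congr_fun e3 (l x)
    have a4 := LinearMap.congr_fun hs x
    have a5 := LinearMap.congr_fun lam.coassoc (x : M)
    simp only [LinearMap.comp_apply, LinearEquiv.coe_coe, Submodule.subtype_apply] at *
    rw [a1, a3, a4, a5]
  counit := by
    set l := liftInj (N.subtype.lTensor C) (lTensor_inj N C) (lam.toLin ∘ₗ N.subtype)
      (fun v => h v v.2) with hl
    have hs : N.subtype.lTensor C ∘ₗ l = lam.toLin ∘ₗ N.subtype := liftInj_spec _ _ _ _
    apply LinearMap.ext
    intro x
    apply N.injective_subtype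
    have e2 : N.subtype ∘ₗ (TensorProduct.lid k N).toLinearMap ∘ₗ
        (Coalgebra.counit (R := k) (A := C)).rTensor N =
        (TensorProduct.lid k M).toLinearMap ∘ₗ
        (Coalgebra.counit (R := k) (A := C)).rTensor M ∘ₗ (N.subtype.lTensor C) := by
      ext; simp
    have a2 := LinearMap.congr_fun e2 (l x)
    have a4 := LinearMap.congr_fun hs x
    have a5 := LinearMap.congr_fun lam.counit (x : M)
    simp only [LinearMap.comp_apply, LinearEquiv.coe_coe, Submodule.subtype_apply,
      LinearMap.id_apply] at *
    rw [a2, a4, a5]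

end Subspaces

/-- A finite-dimensional subcoalgebra: a finite-dimensional subspace `Λ` with
`Δ(Λ) ⊆ Λ ⊗ Λ`. -/
@[ext]
structure FDSubcoalgebra (k C : Type u) [Field k] [AddCommGroup C] [Module k C]
    [Coalgebra k C] where
  toSubmodule : Submodule k C
  finite : FiniteDimensional k toSubmodule
  comul_mem : ∀ x ∈ toSubmodule, Coalgebra.comul (R := k) x ∈
    LinearMap.range (TensorProduct.map toSubmodule.subtype toSubmodule.subtype)

namespace FDSubcoalgebra

variable {k C : Type u} [Field k] [AddCommGroup C] [Module k C] [Coalgebra k C]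

instance : PartialOrder (FDSubcoalgebra k C) :=
  PartialOrder.lift FDSubcoalgebra.toSubmodule (fun _ _ h => FDSubcoalgebra.ext h)

instance (L : FDSubcoalgebra k C) : FiniteDimensional k L.toSubmodule := L.finite

/-- The comultiplication `Λ → Λ ⊗ Λ` of a subcoalgebra. -/
noncomputable def comulL (L : FDSubcoalgebra k C) :
    L.toSubmodule →ₗ[k] L.toSubmodule ⊗[k] L.toSubmodule :=
  liftInj (TensorProduct.map L.toSubmodule.subtype L.toSubmodule.subtype) (map_inj _)
    (Coalgebra.comul ∘ₗ L.toSubmodule.subtype) (fun v => L.comul_mem v v.2)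

theorem comulL_spec (L : FDSubcoalgebra k C) :
    TensorProduct.map L.toSubmodule.subtype L.toSubmodule.subtype ∘ₗ L.comulL =
      Coalgebra.comul ∘ₗ L.toSubmodule.subtype :=
  liftInj_spec _ _ _ _

noncomputable instance (L : FDSubcoalgebra k C) : Coalgebra k L.toSubmodule where
  comul := L.comulL
  counit := Coalgebra.counit ∘ₗ L.toSubmodule.subtype
  coassoc := by
    set i := L.toSubmodule.subtype with hi
    have hs : TensorProduct.map i i ∘ₗ L.comulL = Coalgebra.comul ∘ₗ i := L.comulL_spec
    have hinj : Function.Injective (TensorProduct.map i (TensorProduct.map i i)) :=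
      TensorProduct.map_injective_of_flat_flat _ _ L.toSubmodule.injective_subtype (map_inj _)
    apply LinearMap.ext
    intro x
    apply hinj
    have e1 : TensorProduct.map i (TensorProduct.map i i) ∘ₗ
          (TensorProduct.assoc k _ _ _).toLinearMap =
        (TensorProduct.assoc k _ _ _).toLinearMap ∘ₗ
          TensorProduct.map (TensorProduct.map i i) i := by
      ext; rfl
    have e2 : TensorProduct.map (TensorProduct.map i i) i ∘ₗ L.comulL.rTensor _ =
        Coalgebra.comul.rTensor _ ∘ₗ TensorProduct.map i i := by
      rw [LinearMap.map_comp_rTensor, hs, LinearMap.rTensor_comp_map]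
    have e3 : TensorProduct.map i (TensorProduct.map i i) ∘ₗ L.comulL.lTensor _ =
        Coalgebra.comul.lTensor _ ∘ₗ TensorProduct.map i i := by
      rw [LinearMap.map_comp_lTensor, hs, LinearMap.lTensor_comp_map]
    have a1 := LinearMap.congr_fun e1 (L.comulL.rTensor _ (L.comulL x))
    have a2 := LinearMap.congr_fun e2 (L.comulL x)
    have a3 := LinearMap.congr_fun e3 (L.comulL x)
    have a4 := LinearMap.congr_fun hs x
    have a5 := Coalgebra.coassoc_apply (R := k) (i x)
    simp only [LinearMap.comp_apply, LinearEquiv.coe_coe] at *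
    rw [a1, a2, a3, a4, a5]
  rTensor_counit_comp_comul := by
    set i := L.toSubmodule.subtype with hi
    have hs : TensorProduct.map i i ∘ₗ L.comulL = Coalgebra.comul ∘ₗ i := L.comulL_spec
    apply LinearMap.ext
    intro x
    apply Module.Flat.lTensor_preserves_injective_linearMap (M := k) i
      L.toSubmodule.injective_subtype
    have e2 : i.lTensor k ∘ₗ (Coalgebra.counit ∘ₗ i).rTensor L.toSubmodule =
        Coalgebra.counit.rTensor _ ∘ₗ TensorProduct.map i i := by
      rw [LinearMap.lTensor_comp_rTensor, LinearMap.rTensor_comp_map]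
    have a2 := LinearMap.congr_fun e2 (L.comulL x)
    have a4 := LinearMap.congr_fun hs x
    have a5 := Coalgebra.rTensor_counit_comul (R := k) (i x)
    simp only [LinearMap.comp_apply] at *
    rw [a2, a4, a5]
    rfl
  lTensor_counit_comp_comul := by
    set i := L.toSubmodule.subtype with hi
    have hs : TensorProduct.map i i ∘ₗ L.comulL = Coalgebra.comul ∘ₗ i := L.comulL_spec
    apply LinearMap.ext
    intro x
    apply Module.Flat.rTensor_preserves_injective_linearMap (M := k) i
      L.toSubmodule.injective_subtype
    have e2 : i.rTensor k ∘ₗ (Coalgebra.counit ∘ₗ i).lTensor L.toSubmodule =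
        Coalgebra.counit.lTensor _ ∘ₗ TensorProduct.map i i := by
      rw [LinearMap.rTensor_comp_lTensor, LinearMap.lTensor_comp_map]
    have a2 := LinearMap.congr_fun e2 (L.comulL x)
    have a4 := LinearMap.congr_fun hs x
    have a5 := Coalgebra.lTensor_counit_comul (R := k) (i x)
    simp only [LinearMap.comp_apply] at *
    rw [a2, a4, a5]
    rfl

end FDSubcoalgebra

section Basic

variable {k C : Type u} [Field k] [AddCommGroup C] [Module k C] [Coalgebra k C]

/-- The space of right comodule maps. -/
def RightCoaction.Hom {M N : Type u} [AddCommGroup M] [Module k M] [AddCommGroup N] [Module k N]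
    (ρ : RightCoaction k C M) (σ : RightCoaction k C N) : Submodule k (M →ₗ[k] N) where
  carrier := {f | f.rTensor C ∘ₗ ρ.toLin = σ.toLin ∘ₗ f}
  add_mem' := by
    intro f g hf hg
    simp only [Set.mem_ofPred_eq] at *
    rw [LinearMap.rTensor_add, LinearMap.add_comp, hf, hg, LinearMap.comp_add]
  zero_mem' := by simp
  smul_mem' := by
    intro c f hf
    simp only [Set.mem_ofPred_eq] at *
    rw [LinearMap.rTensor_smul, LinearMap.smul_comp, hf, LinearMap.comp_smul]

/-- `f` is a map of left comodules. -/
def LeftCoaction.IsHom {M N : Type u} [AddCommGroup M] [Module k M] [AddCommGroup N] [Module k N]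
    (lam : LeftCoaction k C M) (mu : LeftCoaction k C N) (f : M →ₗ[k] N) : Prop :=
  f.lTensor C ∘ₗ lam.toLin = mu.toLin ∘ₗ f

/-- `C` as a right comodule over itself. -/
def RightCoaction.regular (k C : Type u) [Field k] [AddCommGroup C] [Module k C]
    [Coalgebra k C] : RightCoaction k C C where
  toLin := Coalgebra.comul
  coassoc := Coalgebra.coassoc
  counit := by ext x; simp

/-- `C` as a left comodule over itself. -/
def LeftCoaction.regular (k C : Type u) [Field k] [AddCommGroup C] [Module k C]
    [Coalgebra k C] : LeftCoaction k C C where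
  toLin := Coalgebra.comul
  coassoc := Coalgebra.coassoc
  counit := by ext x; simp

theorem FDSubcoalgebra.incl_comul (L : FDSubcoalgebra k C) :
    TensorProduct.map L.toSubmodule.subtype L.toSubmodule.subtype ∘ₗ
      (Coalgebra.comul (R := k) (A := L.toSubmodule)) =
      Coalgebra.comul ∘ₗ L.toSubmodule.subtype := L.comulL_spec

theorem FDSubcoalgebra.counit_eq (L : FDSubcoalgebra k C) :
    (Coalgebra.counit (R := k) (A := L.toSubmodule)) =
      Coalgebra.counit ∘ₗ L.toSubmodule.subtype := rfl

/-- A right comodule over a subcoalgebra `L` of `C`, viewed as a right `C`-comodule. -/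
noncomputable def RightCoaction.push {M : Type u} [AddCommGroup M] [Module k M]
    {L : FDSubcoalgebra k C} (σ : RightCoaction k L.toSubmodule M) : RightCoaction k C M where
  toLin := L.toSubmodule.subtype.lTensor M ∘ₗ σ.toLin
  coassoc := by
    set i := L.toSubmodule.subtype with hi
    have e1 : (TensorProduct.assoc k M C C).toLinearMap ∘ₗ
        (i.lTensor M ∘ₗ σ.toLin).rTensor C ∘ₗ i.lTensor M =
        (TensorProduct.map i i).lTensor M ∘ₗ (TensorProduct.assoc k M _ _).toLinearMap ∘ₗ
          σ.toLin.rTensor _ := by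
      have : (TensorProduct.assoc k M C C).toLinearMap ∘ₗ TensorProduct.map (i.lTensor M) i =
          (TensorProduct.map i i).lTensor M ∘ₗ (TensorProduct.assoc k M _ _).toLinearMap := by
        ext; rfl
      rw [LinearMap.rTensor_comp_lTensor, ← LinearMap.comp_assoc, ← this, LinearMap.comp_assoc,
        LinearMap.map_comp_rTensor]
    have e2 : (Coalgebra.comul (R := k) (A := C)).lTensor M ∘ₗ i.lTensor M =
        (TensorProduct.map i i).lTensor M ∘ₗ
          (Coalgebra.comul (R := k) (A := L.toSubmodule)).lTensor M := by
      rw [← LinearMap.lTensor_comp, ← LinearMap.lTensor_comp, L.incl_comul]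
    apply LinearMap.ext
    intro x
    have a1 := LinearMap.congr_fun e1 (σ.toLin x)
    have a2 := LinearMap.congr_fun e2 (σ.toLin x)
    have a3 := LinearMap.congr_fun σ.coassoc x
    simp only [LinearMap.comp_apply, LinearEquiv.coe_coe] at *
    rw [a1, a2, a3]
  counit := by
    rw [← σ.counit, L.counit_eq, LinearMap.lTensor_comp]
    rfl

/-- A left comodule over a subcoalgebra `L` of `C`, viewed as a left `C`-comodule. -/
noncomputable def LeftCoaction.push {M : Type u} [AddCommGroup M] [Module k M]
    {L : FDSubcoalgebra k C} (lam : LeftCoaction k L.toSubmodule M) : LeftCoaction k C M where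
  toLin := L.toSubmodule.subtype.rTensor M ∘ₗ lam.toLin
  coassoc := by
    set i := L.toSubmodule.subtype with hi
    have e1 : (i.rTensor M ∘ₗ lam.toLin).lTensor C ∘ₗ i.rTensor M =
        TensorProduct.map i (i.rTensor M) ∘ₗ lam.toLin.lTensor _ := by
      rw [LinearMap.lTensor_comp_rTensor, LinearMap.map_comp_lTensor]
    have e2 : (TensorProduct.assoc k C C M).toLinearMap ∘ₗ
        (Coalgebra.comul (R := k) (A := C)).rTensor M ∘ₗ i.rTensor M =
        TensorProduct.map i (i.rTensor M) ∘ₗ (TensorProduct.assoc k _ _ M).toLinearMap ∘ₗ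
          (Coalgebra.comul (R := k) (A := L.toSubmodule)).rTensor M := by
      have : TensorProduct.map i (i.rTensor M) ∘ₗ (TensorProduct.assoc k _ _ M).toLinearMap =
          (TensorProduct.assoc k C C M).toLinearMap ∘ₗ (TensorProduct.map i i).rTensor M := by
        ext; rfl
      rw [← LinearMap.rTensor_comp, ← L.incl_comul, LinearMap.rTensor_comp,
        ← LinearMap.comp_assoc, ← this, LinearMap.comp_assoc]
    apply LinearMap.ext
    intro x
    have a1 := LinearMap.congr_fun e1 (lam.toLin x)
    have a2 := LinearMap.congr_fun e2 (lam.toLin x)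
    have a3 := LinearMap.congr_fun lam.coassoc x
    simp only [LinearMap.comp_apply, LinearEquiv.coe_coe] at *
    rw [a1, a2, a3]
  counit := by
    rw [← lam.counit, L.counit_eq, LinearMap.rTensor_comp]
    rfl

/-- A subcoalgebra `L` of `C` as a right `C`-comodule. -/
noncomputable def FDSubcoalgebra.rightCoaction (L : FDSubcoalgebra k C) :
    RightCoaction k C L.toSubmodule :=
  (RightCoaction.regular k L.toSubmodule).push

/-- A subcoalgebra `L` of `C` as a left `C`-comodule. -/
noncomputable def FDSubcoalgebra.leftCoaction (L : FDSubcoalgebra k C) :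
    LeftCoaction k C L.toSubmodule :=
  (LeftCoaction.regular k L.toSubmodule).push

/-- The kernel of a map compatible with right coactions is a subcomodule. -/
theorem RightCoaction.ker_isSub {V W : Type u} [AddCommGroup V] [Module k V] [AddCommGroup W]
    [Module k W] (ρ : RightCoaction k C V) (f : V →ₗ[k] W) (s : W →ₗ[k] W ⊗[k] C)
    (h : f.rTensor C ∘ₗ ρ.toLin = s ∘ₗ f) : ρ.IsSub (LinearMap.ker f) := by
  intro x hx
  have hex : Function.Exact (LinearMap.ker f).subtype f := LinearMap.exact_subtype_ker_map f
  have := Module.Flat.rTensor_exact C hex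
  apply (this _).1
  have h1 := LinearMap.congr_fun h x
  simp only [LinearMap.comp_apply, LinearMap.mem_ker.1 hx, map_zero] at h1
  exact h1

/-- The kernel of a map compatible with left coactions is a subcomodule. -/
theorem LeftCoaction.ker_isSub {V W : Type u} [AddCommGroup V] [Module k V] [AddCommGroup W]
    [Module k W] (lam : LeftCoaction k C V) (f : V →ₗ[k] W) (s : W →ₗ[k] C ⊗[k] W)
    (h : f.lTensor C ∘ₗ lam.toLin = s ∘ₗ f) : lam.IsSub (LinearMap.ker f) := by
  intro x hx
  have hex : Function.Exact (LinearMap.ker f).subtype f := LinearMap.exact_subtype_ker_map f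
  have := Module.Flat.lTensor_exact C hex
  apply (this _).1
  have h1 := LinearMap.congr_fun h x
  simp only [LinearMap.comp_apply, LinearMap.mem_ker.1 hx, map_zero] at h1
  exact h1

/-- The right comodule `V ⊗ N` for a vector space `V` and a right comodule `N`. -/
noncomputable def RightCoaction.tensor (V : Type u) [AddCommGroup V] [Module k V] {N : Type u}
    [AddCommGroup N] [Module k N] (σ : RightCoaction k C N) : RightCoaction k C (V ⊗[k] N) where
  toLin := (TensorProduct.assoc k V N C).symm.toLinearMap ∘ₗ σ.toLin.lTensor V
  coassoc := by
    apply TensorProduct.ext'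
    intro v n
    have key : ∀ t : N ⊗[k] C, (TensorProduct.assoc k (V ⊗[k] N) C C)
        (((TensorProduct.assoc k V N C).symm.toLinearMap ∘ₗ σ.toLin.lTensor V).rTensor C
          ((TensorProduct.assoc k V N C).symm (v ⊗ₜ t))) =
        (TensorProduct.assoc k V N (C ⊗[k] C)).symm
          (v ⊗ₜ (TensorProduct.assoc k N C C (σ.toLin.rTensor C t))) := by
      intro t
      induction t using TensorProduct.induction_on with
      | zero => simp
      | add x y hx hy => simp only [TensorProduct.tmul_add, map_add, hx, hy]
      | tmul x y =>
        simp only [TensorProduct.assoc_symm_tmul, LinearMap.rTensor_tmul, LinearMap.comp_apply,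
          LinearMap.lTensor_tmul, LinearEquiv.coe_coe]
        generalize σ.toLin x = s
        induction s using TensorProduct.induction_on with
        | zero => simp
        | add x y hx hy =>
          simp only [TensorProduct.tmul_add, TensorProduct.add_tmul, map_add, hx, hy]
        | tmul x y => simp
    have key2 : ∀ t : N ⊗[k] C, (Coalgebra.comul (R := k) (A := C)).lTensor (V ⊗[k] N)
          ((TensorProduct.assoc k V N C).symm (v ⊗ₜ t)) =
        (TensorProduct.assoc k V N (C ⊗[k] C)).symm
          (v ⊗ₜ ((Coalgebra.comul (R := k) (A := C)).lTensor N t)) := by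
      intro t
      induction t using TensorProduct.induction_on with
      | zero => simp
      | add x y hx hy => simp only [TensorProduct.tmul_add, map_add, hx, hy]
      | tmul x y => simp
    have h := LinearMap.congr_fun σ.coassoc n
    simp only [LinearMap.comp_apply, LinearEquiv.coe_coe, LinearMap.lTensor_tmul] at *
    rw [key2, ← h]
    exact key _
  counit := by
    apply TensorProduct.ext'
    intro v n
    have key : ∀ t : N ⊗[k] C, TensorProduct.rid k (V ⊗[k] N)
        ((Coalgebra.counit (R := k) (A := C)).lTensor (V ⊗[k] N)
          ((TensorProduct.assoc k V N C).symm (v ⊗ₜ t))) =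
        v ⊗ₜ (TensorProduct.rid k N ((Coalgebra.counit (R := k) (A := C)).lTensor N t)) := by
      intro t
      induction t using TensorProduct.induction_on with
      | zero => simp
      | add x y hx hy => simp only [TensorProduct.tmul_add, map_add, hx, hy]
      | tmul x y => simp
    have h := LinearMap.congr_fun σ.counit n
    simp only [LinearMap.comp_apply, LinearEquiv.coe_coe, LinearMap.lTensor_tmul,
      LinearMap.id_apply] at *
    rw [key, h]

/-- The left comodule `N ⊗ V` for a left comodule `N` and a vector space `V`. -/
noncomputable def LeftCoaction.tensor (V : Type u) [AddCommGroup V] [Module k V] {N : Type u}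
    [AddCommGroup N] [Module k N] (lam : LeftCoaction k C N) : LeftCoaction k C (N ⊗[k] V) where
  toLin := (TensorProduct.assoc k C N V).toLinearMap ∘ₗ lam.toLin.rTensor V
  coassoc := by
    apply TensorProduct.ext'
    intro n v
    have key : ∀ t : C ⊗[k] N, ((TensorProduct.assoc k C N V).toLinearMap ∘ₗ
          lam.toLin.rTensor V).lTensor C (TensorProduct.assoc k C N V (t ⊗ₜ v)) =
        (TensorProduct.assoc k C N V).toLinearMap.lTensor C
          (TensorProduct.assoc k C (C ⊗[k] N) V ((lam.toLin.lTensor C t) ⊗ₜ v)) := by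
      intro t
      induction t using TensorProduct.induction_on with
      | zero => simp
      | add x y hx hy => simp only [TensorProduct.add_tmul, map_add, hx, hy]
      | tmul x y => simp
    have key2 : ∀ t : C ⊗[k] N, TensorProduct.assoc k C C (N ⊗[k] V)
        ((Coalgebra.comul (R := k) (A := C)).rTensor (N ⊗[k] V)
          (TensorProduct.assoc k C N V (t ⊗ₜ v))) =
        (TensorProduct.assoc k C N V).toLinearMap.lTensor C
          (TensorProduct.assoc k C (C ⊗[k] N) V
            ((TensorProduct.assoc k C C N ((Coalgebra.comul (R := k) (A := C)).rTensor N t))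
              ⊗ₜ v)) := by
      intro t
      induction t using TensorProduct.induction_on with
      | zero => simp
      | add x y hx hy => simp only [TensorProduct.add_tmul, map_add, hx, hy]
      | tmul x y =>
        simp only [TensorProduct.assoc_tmul, LinearMap.rTensor_tmul]
        generalize (Coalgebra.comul (R := k) x) = s
        induction s using TensorProduct.induction_on with
        | zero => simp
        | add x y hx hy => simp only [TensorProduct.add_tmul, map_add, hx, hy]
        | tmul x y => simp
    have h := LinearMap.congr_fun lam.coassoc n
    simp only [LinearMap.comp_apply, LinearEquiv.coe_coe, LinearMap.rTensor_tmul] at *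
    rw [key2, h]
    exact (key _).symm
  counit := by
    apply TensorProduct.ext'
    intro n v
    have key : ∀ t : C ⊗[k] N, TensorProduct.lid k (N ⊗[k] V)
        ((Coalgebra.counit (R := k) (A := C)).rTensor (N ⊗[k] V)
          (TensorProduct.assoc k C N V (t ⊗ₜ v))) =
        (TensorProduct.lid k N ((Coalgebra.counit (R := k) (A := C)).rTensor N t)) ⊗ₜ v := by
      intro t
      induction t using TensorProduct.induction_on with
      | zero => simp
      | add x y hx hy => simp only [TensorProduct.add_tmul, map_add, hx, hy]
      | tmul x y => simp [TensorProduct.smul_tmul']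
    have h := LinearMap.congr_fun lam.counit n
    simp only [LinearMap.comp_apply, LinearEquiv.coe_coe, LinearMap.rTensor_tmul,
      LinearMap.id_apply] at *
    rw [key, h]

/-- The map `ρ ⊗ 1 - 1 ⊗ lam : M ⊗ N → M ⊗ C ⊗ N`. -/
noncomputable def cotensorMap {M N : Type u} [AddCommGroup M] [Module k M] [AddCommGroup N]
    [Module k N] (ρ : RightCoaction k C M) (lam : LeftCoaction k C N) :
    M ⊗[k] N →ₗ[k] M ⊗[k] (C ⊗[k] N) :=
  (TensorProduct.assoc k M C N).toLinearMap ∘ₗ ρ.toLin.rTensor N - lam.toLin.lTensor M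

/-- The cotensor product `M □ N`, the equalizer of `ρ ⊗ 1` and `1 ⊗ lam` on `M ⊗ N`. -/
noncomputable def cotensor {M N : Type u} [AddCommGroup M] [Module k M] [AddCommGroup N]
    [Module k N] (ρ : RightCoaction k C M) (lam : LeftCoaction k C N) :
    Submodule k (M ⊗[k] N) :=
  LinearMap.ker (cotensorMap ρ lam)

theorem mem_cotensor {M N : Type u} [AddCommGroup M] [Module k M] [AddCommGroup N]
    [Module k N] (ρ : RightCoaction k C M) (lam : LeftCoaction k C N) (t : M ⊗[k] N) :
    t ∈ cotensor ρ lam ↔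
      TensorProduct.assoc k M C N (ρ.toLin.rTensor N t) = lam.toLin.lTensor M t := by
  simp [cotensor, cotensorMap, sub_eq_zero]

variable {D : Type u} [AddCommGroup D] [Module k D] [Coalgebra k D]

/-- If `N` is a bicomodule, the right coaction on `M ⊗ N` restricts to `M □ N`. -/
theorem cotensor_isSub_right {M N : Type u} [AddCommGroup M] [Module k M] [AddCommGroup N]
    [Module k N] (ρ : RightCoaction k C M) (lam : LeftCoaction k C N) (σ : RightCoaction k D N)
    (h : (TensorProduct.assoc k C N D).toLinearMap ∘ₗ lam.toLin.rTensor D ∘ₗ σ.toLin =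
      σ.toLin.lTensor C ∘ₗ lam.toLin) :
    (σ.tensor M).IsSub (cotensor ρ lam) := by
  have h' : lam.toLin.rTensor D ∘ₗ σ.toLin =
      (TensorProduct.assoc k C N D).symm.toLinearMap ∘ₗ σ.toLin.lTensor C ∘ₗ lam.toLin := by
    rw [← h]; ext; simp
  refine RightCoaction.ker_isSub _ _ ((TensorProduct.assoc k M (C ⊗[k] N) D).symm.toLinearMap ∘ₗ
    ((TensorProduct.assoc k C N D).symm.toLinearMap ∘ₗ σ.toLin.lTensor C).lTensor M) ?_
  apply TensorProduct.ext'
  intro m n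
  have k1 : ∀ t : N ⊗[k] D, (lam.toLin.lTensor M).rTensor D
      ((TensorProduct.assoc k M N D).symm (m ⊗ₜ t)) =
      (TensorProduct.assoc k M (C ⊗[k] N) D).symm (m ⊗ₜ (lam.toLin.rTensor D t)) := by
    intro t
    induction t using TensorProduct.induction_on with
    | zero => simp
    | add x y hx hy => simp only [TensorProduct.tmul_add, map_add, hx, hy]
    | tmul x y => simp
  have k2 : ∀ t : N ⊗[k] D, ((TensorProduct.assoc k M C N).toLinearMap ∘ₗ
        ρ.toLin.rTensor N).rTensor D ((TensorProduct.assoc k M N D).symm (m ⊗ₜ t)) =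
      ((TensorProduct.assoc k M (C ⊗[k] N) D).symm
        ((TensorProduct.assoc k C N D).symm.toLinearMap.lTensor M
          (TensorProduct.assoc k M C (N ⊗[k] D) (ρ.toLin m ⊗ₜ t)))) := by
    intro t
    induction t using TensorProduct.induction_on with
    | zero => simp
    | add x y hx hy => simp only [TensorProduct.tmul_add, map_add, hx, hy]
    | tmul x y =>
      simp only [TensorProduct.assoc_symm_tmul, LinearMap.rTensor_tmul, LinearMap.comp_apply]
      generalize ρ.toLin m = s
      induction s using TensorProduct.induction_on with
      | zero => simp
      | add x y hx hy => simp only [TensorProduct.add_tmul, map_add, hx, hy]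
      | tmul x y => simp
  have k3 : ∀ s : M ⊗[k] C, (((TensorProduct.assoc k C N D).symm.toLinearMap ∘ₗ
      σ.toLin.lTensor C).lTensor M) (TensorProduct.assoc k M C N (s ⊗ₜ n)) =
      (TensorProduct.assoc k C N D).symm.toLinearMap.lTensor M
          (TensorProduct.assoc k M C (N ⊗[k] D) (s ⊗ₜ σ.toLin n)) := by
    intro s
    induction s using TensorProduct.induction_on with
    | zero => simp
    | add x y hx hy => simp only [TensorProduct.add_tmul, map_add, hx, hy]
    | tmul x y => simp
  have hn := LinearMap.congr_fun h' n
  simp only [cotensorMap, RightCoaction.tensor, LinearMap.rTensor_sub, LinearMap.sub_comp,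
    LinearMap.comp_sub, LinearMap.sub_apply, LinearMap.comp_apply, LinearMap.lTensor_tmul,
    LinearEquiv.coe_coe, LinearMap.rTensor_tmul] at *
  rw [k1, hn]
  congr 1
  exact (k2 _).trans (congrArg _ (k3 _).symm)

/-- If `M` is a bicomodule, the left coaction on `M ⊗ N` restricts to `M □ N`. -/
theorem cotensor_isSub_left {M N : Type u} [AddCommGroup M] [Module k M] [AddCommGroup N]
    [Module k N] (ρ : RightCoaction k C M) (lam : LeftCoaction k C N) (mu : LeftCoaction k D M)
    (h : (TensorProduct.assoc k D M C).toLinearMap ∘ₗ mu.toLin.rTensor C ∘ₗ ρ.toLin =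
      ρ.toLin.lTensor D ∘ₗ mu.toLin) :
    (mu.tensor N).IsSub (cotensor ρ lam) := by
  refine LeftCoaction.ker_isSub _ _ ((TensorProduct.assoc k D M (C ⊗[k] N)).toLinearMap ∘ₗ
    mu.toLin.rTensor (C ⊗[k] N)) ?_
  apply TensorProduct.ext'
  intro m n
  have k1 : ∀ t : D ⊗[k] M, (lam.toLin.lTensor M).lTensor D
      (TensorProduct.assoc k D M N (t ⊗ₜ n)) =
      TensorProduct.assoc k D M (C ⊗[k] N) (t ⊗ₜ lam.toLin n) := by
    intro t
    induction t using TensorProduct.induction_on with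
    | zero => simp
    | add x y hx hy => simp only [TensorProduct.add_tmul, map_add, hx, hy]
    | tmul x y => simp
  have k2 : ∀ t : D ⊗[k] M, ((TensorProduct.assoc k M C N).toLinearMap ∘ₗ
      ρ.toLin.rTensor N).lTensor D (TensorProduct.assoc k D M N (t ⊗ₜ n)) =
      (TensorProduct.assoc k M C N).toLinearMap.lTensor D
        (TensorProduct.assoc k D (M ⊗[k] C) N ((ρ.toLin.lTensor D t) ⊗ₜ n)) := by
    intro t
    induction t using TensorProduct.induction_on with
    | zero => simp
    | add x y hx hy => simp only [TensorProduct.add_tmul, map_add, hx, hy]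
    | tmul x y => simp
  have k3 : ∀ s : M ⊗[k] C, TensorProduct.assoc k D M (C ⊗[k] N)
      (mu.toLin.rTensor (C ⊗[k] N) (TensorProduct.assoc k M C N (s ⊗ₜ n))) =
      (TensorProduct.assoc k M C N).toLinearMap.lTensor D
        (TensorProduct.assoc k D (M ⊗[k] C) N
          ((TensorProduct.assoc k D M C (mu.toLin.rTensor C s)) ⊗ₜ n)) := by
    intro s
    induction s using TensorProduct.induction_on with
    | zero => simp
    | add x y hx hy => simp only [TensorProduct.add_tmul, map_add, hx, hy]
    | tmul x y =>
      simp only [TensorProduct.assoc_tmul, LinearMap.rTensor_tmul]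
      generalize mu.toLin x = r
      induction r using TensorProduct.induction_on with
      | zero => simp
      | add x y hx hy => simp only [TensorProduct.add_tmul, map_add, hx, hy]
      | tmul x y => simp
  have hm := LinearMap.congr_fun h m
  simp only [cotensorMap, LeftCoaction.tensor, LinearMap.lTensor_sub, LinearMap.sub_comp,
    LinearMap.comp_sub, LinearMap.sub_apply, LinearMap.comp_apply, LinearMap.lTensor_tmul,
    LinearEquiv.coe_coe, LinearMap.rTensor_tmul] at *
  rw [k1, k3, hm]
  congr 1
  exact k2 _

theorem FDSubcoalgebra.bicomodule_right (L : FDSubcoalgebra k C) :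
    (TensorProduct.assoc k C L.toSubmodule L.toSubmodule).toLinearMap ∘ₗ
      L.leftCoaction.toLin.rTensor _ ∘ₗ (RightCoaction.regular k L.toSubmodule).toLin =
    (RightCoaction.regular k L.toSubmodule).toLin.lTensor C ∘ₗ L.leftCoaction.toLin := by
  have h := Coalgebra.coassoc (R := k) (A := L.toSubmodule)
  have e1 : (TensorProduct.assoc k C L.toSubmodule L.toSubmodule).toLinearMap ∘ₗ
      (L.toSubmodule.subtype.rTensor L.toSubmodule).rTensor L.toSubmodule =
      L.toSubmodule.subtype.rTensor _ ∘ₗ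
        (TensorProduct.assoc k L.toSubmodule L.toSubmodule L.toSubmodule).toLinearMap := by
    ext; rfl
  simp only [RightCoaction.regular, FDSubcoalgebra.leftCoaction, LeftCoaction.push,
    LeftCoaction.regular, LinearMap.rTensor_comp]
  rw [LinearMap.comp_assoc, ← LinearMap.comp_assoc, e1, LinearMap.comp_assoc, h,
    ← LinearMap.comp_assoc, ← LinearMap.comp_assoc, LinearMap.lTensor_comp_rTensor,
    LinearMap.rTensor_comp_lTensor]

theorem FDSubcoalgebra.bicomodule_left (L : FDSubcoalgebra k C) :
    (TensorProduct.assoc k L.toSubmodule L.toSubmodule C).toLinearMap ∘ₗ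
      (LeftCoaction.regular k L.toSubmodule).toLin.rTensor C ∘ₗ L.rightCoaction.toLin =
    L.rightCoaction.toLin.lTensor L.toSubmodule ∘ₗ
      (LeftCoaction.regular k L.toSubmodule).toLin := by
  have h := Coalgebra.coassoc (R := k) (A := L.toSubmodule)
  have e1 : (TensorProduct.assoc k L.toSubmodule L.toSubmodule C).toLinearMap ∘ₗ
      L.toSubmodule.subtype.lTensor _ =
      (L.toSubmodule.subtype.lTensor L.toSubmodule).lTensor L.toSubmodule ∘ₗ
        (TensorProduct.assoc k L.toSubmodule L.toSubmodule L.toSubmodule).toLinearMap := by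
    ext; rfl
  simp only [LeftCoaction.regular, FDSubcoalgebra.rightCoaction, RightCoaction.push,
    RightCoaction.regular, LinearMap.lTensor_comp]
  rw [LinearMap.comp_assoc, ← h, ← LinearMap.comp_assoc _ _ (LinearMap.lTensor _ _),
    ← e1, ← LinearMap.comp_assoc _ (L.toSubmodule.subtype.lTensor _),
    LinearMap.rTensor_comp_lTensor, ← LinearMap.lTensor_comp_rTensor]
  rfl

end Basic

section Restriction

variable {k C : Type u} [Field k] [AddCommGroup C] [Module k C] [Coalgebra k C]

/-- The underlying space of `I □ L` for a right `C`-comodule `I` and a subcoalgebra `L`. -/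
noncomputable abbrev RightCoaction.box {I : Type u} [AddCommGroup I] [Module k I]
    (ρ : RightCoaction k C I) (L : FDSubcoalgebra k C) : Submodule k (I ⊗[k] L.toSubmodule) :=
  cotensor ρ L.leftCoaction

/-- The right `L`-comodule structure on `I □ L`. -/
noncomputable def RightCoaction.boxCoaction {I : Type u} [AddCommGroup I] [Module k I]
    (ρ : RightCoaction k C I) (L : FDSubcoalgebra k C) :
    RightCoaction k L.toSubmodule (ρ.box L) :=
  ((RightCoaction.regular k L.toSubmodule).tensor I).sub _
    (cotensor_isSub_right ρ L.leftCoaction _ L.bicomodule_right)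

/-- The underlying space of `L □ N` for a left `C`-comodule `N` and a subcoalgebra `L`. -/
noncomputable abbrev LeftCoaction.box {N : Type u} [AddCommGroup N] [Module k N]
    (lam : LeftCoaction k C N) (L : FDSubcoalgebra k C) : Submodule k (L.toSubmodule ⊗[k] N) :=
  cotensor L.rightCoaction lam

/-- The left `L`-comodule structure on `L □ N`. -/
noncomputable def LeftCoaction.boxCoaction {N : Type u} [AddCommGroup N] [Module k N]
    (lam : LeftCoaction k C N) (L : FDSubcoalgebra k C) :
    LeftCoaction k L.toSubmodule (lam.box L) :=
  ((LeftCoaction.regular k L.toSubmodule).tensor N).sub _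
    (cotensor_isSub_left L.rightCoaction lam _ L.bicomodule_left)

/-- The canonical map `L □ N → N`, `∑ l ⊗ n ↦ ∑ ε(l) n`. -/
noncomputable def LeftCoaction.boxIncl {N : Type u} [AddCommGroup N] [Module k N]
    (lam : LeftCoaction k C N) (L : FDSubcoalgebra k C) : lam.box L →ₗ[k] N :=
  (TensorProduct.lid k N).toLinearMap ∘ₗ
    (Coalgebra.counit (R := k) (A := L.toSubmodule)).rTensor N ∘ₗ (lam.box L).subtype

/-- The map `f □ L : I □ L → J □ L` induced by a comodule map `f : I → J`. -/
noncomputable def RightCoaction.boxMap {I J : Type u} [AddCommGroup I] [Module k I]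
    [AddCommGroup J] [Module k J] {ρ : RightCoaction k C I} {σ : RightCoaction k C J}
    (f : ρ.Hom σ) (L : FDSubcoalgebra k C) : ρ.box L →ₗ[k] σ.box L :=
  ((f : I →ₗ[k] J).rTensor L.toSubmodule).restrict (by
    intro t ht
    rw [mem_cotensor] at ht ⊢
    have hf : (f : I →ₗ[k] J).rTensor C ∘ₗ ρ.toLin = σ.toLin ∘ₗ f := f.2
    have e1 : (TensorProduct.assoc k J C L.toSubmodule).toLinearMap ∘ₗ
        ((f : I →ₗ[k] J).rTensor C).rTensor L.toSubmodule =
        (f : I →ₗ[k] J).rTensor _ ∘ₗ (TensorProduct.assoc k I C L.toSubmodule).toLinearMap := by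
      ext; rfl
    have e2 : σ.toLin.rTensor L.toSubmodule ∘ₗ (f : I →ₗ[k] J).rTensor L.toSubmodule =
        ((f : I →ₗ[k] J).rTensor C).rTensor L.toSubmodule ∘ₗ ρ.toLin.rTensor L.toSubmodule := by
      rw [← LinearMap.rTensor_comp, ← LinearMap.rTensor_comp, hf]
    have e3 : L.leftCoaction.toLin.lTensor J ∘ₗ (f : I →ₗ[k] J).rTensor L.toSubmodule =
        (f : I →ₗ[k] J).rTensor _ ∘ₗ L.leftCoaction.toLin.lTensor I := by
      rw [LinearMap.lTensor_comp_rTensor, LinearMap.rTensor_comp_lTensor]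
    have a1 := LinearMap.congr_fun e1 (ρ.toLin.rTensor L.toSubmodule t)
    have a2 := LinearMap.congr_fun e2 t
    have a3 := LinearMap.congr_fun e3 t
    simp only [LinearMap.comp_apply, LinearEquiv.coe_coe] at *
    rw [a2, a1, a3, ht])

theorem RightCoaction.sub_spec {M : Type u} [AddCommGroup M] [Module k M]
    (ρ : RightCoaction k C M) (N : Submodule k M) (h : ρ.IsSub N) :
    N.subtype.rTensor C ∘ₗ (ρ.sub N h).toLin = ρ.toLin ∘ₗ N.subtype := liftInj_spec _ _ _ _

theorem LeftCoaction.sub_spec {M : Type u} [AddCommGroup M] [Module k M]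
    (ρ : LeftCoaction k C M) (N : Submodule k M) (h : ρ.IsSub N) :
    N.subtype.lTensor C ∘ₗ (ρ.sub N h).toLin = ρ.toLin ∘ₗ N.subtype := liftInj_spec _ _ _ _

theorem RightCoaction.boxMap_mem {I J : Type u} [AddCommGroup I] [Module k I]
    [AddCommGroup J] [Module k J] {ρ : RightCoaction k C I} {σ : RightCoaction k C J}
    (f : ρ.Hom σ) (L : FDSubcoalgebra k C) :
    boxMap f L ∈ (ρ.boxCoaction L).Hom (σ.boxCoaction L) := by
  change LinearMap.rTensor _ _ ∘ₗ _ = _ ∘ₗ _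
  apply LinearMap.ext
  intro x
  apply rTensor_inj (σ.box L) L.toSubmodule
  have e0 : (σ.box L).subtype ∘ₗ boxMap f L =
      (f : I →ₗ[k] J).rTensor L.toSubmodule ∘ₗ (ρ.box L).subtype := by
    ext; rfl
  have e1 : (σ.box L).subtype.rTensor L.toSubmodule ∘ₗ (boxMap f L).rTensor L.toSubmodule =
      ((f : I →ₗ[k] J).rTensor L.toSubmodule).rTensor L.toSubmodule ∘ₗ
        (ρ.box L).subtype.rTensor L.toSubmodule := by
    rw [← LinearMap.rTensor_comp, e0, LinearMap.rTensor_comp]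
  have e2 : ((f : I →ₗ[k] J).rTensor L.toSubmodule).rTensor L.toSubmodule ∘ₗ
      ((RightCoaction.regular k L.toSubmodule).tensor I).toLin =
      ((RightCoaction.regular k L.toSubmodule).tensor J).toLin ∘ₗ
        (f : I →ₗ[k] J).rTensor L.toSubmodule := by
    simp only [RightCoaction.tensor]
    have : ((f : I →ₗ[k] J).rTensor L.toSubmodule).rTensor L.toSubmodule ∘ₗ
        (TensorProduct.assoc k I L.toSubmodule L.toSubmodule).symm.toLinearMap =
        (TensorProduct.assoc k J L.toSubmodule L.toSubmodule).symm.toLinearMap ∘ₗ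
          (f : I →ₗ[k] J).rTensor _ := by
      apply TensorProduct.ext
      ext; rfl
    rw [← LinearMap.comp_assoc, this, LinearMap.comp_assoc, LinearMap.comp_assoc,
      LinearMap.lTensor_comp_rTensor, LinearMap.rTensor_comp_lTensor]
  have s1 := RightCoaction.sub_spec ((RightCoaction.regular k L.toSubmodule).tensor I) _
    (cotensor_isSub_right ρ L.leftCoaction _ L.bicomodule_right)
  have s2 := RightCoaction.sub_spec ((RightCoaction.regular k L.toSubmodule).tensor J) _
    (cotensor_isSub_right σ L.leftCoaction _ L.bicomodule_right)
  have a0 := LinearMap.congr_fun e0 x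
  have a1 := LinearMap.congr_fun e1 ((ρ.boxCoaction L).toLin x)
  have a2 := LinearMap.congr_fun e2 ((ρ.box L).subtype x)
  have a3 := LinearMap.congr_fun s1 x
  have a4 := LinearMap.congr_fun s2 (boxMap f L x)
  simp only [LinearMap.comp_apply] at *
  refine a1.trans (((congrArg _ a3).trans a2).trans ?_)
  rw [← a0]
  exact a4.symm

/-- For a right `L`-comodule `Y`, a `C`-comodule map `g : Y → I` gives
`Y → I □ L`, `y ↦ ∑ g(y₀) ⊗ y₁`. -/
noncomputable def RightCoaction.toBox {I Y : Type u} [AddCommGroup I] [Module k I]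
    [AddCommGroup Y] [Module k Y] {ρ : RightCoaction k C I} {L : FDSubcoalgebra k C}
    {σ : RightCoaction k L.toSubmodule Y} (g : σ.push.Hom ρ) : Y →ₗ[k] ρ.box L :=
  ((g : Y →ₗ[k] I).rTensor L.toSubmodule ∘ₗ σ.toLin).codRestrict (ρ.box L) (by
    intro y
    rw [mem_cotensor]
    have hg : (g : Y →ₗ[k] I).rTensor C ∘ₗ (L.toSubmodule.subtype.lTensor Y ∘ₗ σ.toLin) =
      ρ.toLin ∘ₗ g := g.2
    have hc := σ.coassoc
    have e1 : ρ.toLin.rTensor L.toSubmodule ∘ₗ (g : Y →ₗ[k] I).rTensor L.toSubmodule =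
        (TensorProduct.map (g : Y →ₗ[k] I) L.toSubmodule.subtype).rTensor L.toSubmodule ∘ₗ
          σ.toLin.rTensor L.toSubmodule := by
      rw [← LinearMap.rTensor_comp, ← LinearMap.rTensor_comp, ← hg, ← LinearMap.comp_assoc,
        LinearMap.rTensor_comp_lTensor]
    have e2 : (TensorProduct.assoc k I C L.toSubmodule).toLinearMap ∘ₗ
        (TensorProduct.map (g : Y →ₗ[k] I) L.toSubmodule.subtype).rTensor L.toSubmodule =
        TensorProduct.map (g : Y →ₗ[k] I) (L.toSubmodule.subtype.rTensor L.toSubmodule) ∘ₗ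
        (TensorProduct.assoc k Y L.toSubmodule L.toSubmodule).toLinearMap := by
      ext; rfl
    have e3 : L.leftCoaction.toLin.lTensor I ∘ₗ (g : Y →ₗ[k] I).rTensor L.toSubmodule =
        TensorProduct.map (g : Y →ₗ[k] I) (L.toSubmodule.subtype.rTensor L.toSubmodule) ∘ₗ
          (Coalgebra.comul (R := k) (A := L.toSubmodule)).lTensor Y := by
      rw [LinearMap.lTensor_comp_rTensor, LinearMap.map_comp_lTensor]; rfl
    have a1 := LinearMap.congr_fun e1 (σ.toLin y)
    have a2 := LinearMap.congr_fun e2 (σ.toLin.rTensor L.toSubmodule (σ.toLin y))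
    have a3 := LinearMap.congr_fun e3 (σ.toLin y)
    have a4 := LinearMap.congr_fun hc y
    simp only [LinearMap.comp_apply, LinearEquiv.coe_coe] at *
    rw [a1, a2, a3, a4])

theorem RightCoaction.toBox_mem {I Y : Type u} [AddCommGroup I] [Module k I]
    [AddCommGroup Y] [Module k Y] {ρ : RightCoaction k C I} {L : FDSubcoalgebra k C}
    {σ : RightCoaction k L.toSubmodule Y} (g : σ.push.Hom ρ) :
    toBox g ∈ σ.Hom (ρ.boxCoaction L) := by
  change LinearMap.rTensor _ _ ∘ₗ _ = _ ∘ₗ _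
  apply LinearMap.ext
  intro y
  apply rTensor_inj (ρ.box L) L.toSubmodule
  have e0 : (ρ.box L).subtype ∘ₗ toBox g =
      (g : Y →ₗ[k] I).rTensor L.toSubmodule ∘ₗ σ.toLin := by
    ext; rfl
  have e1 : (ρ.box L).subtype.rTensor L.toSubmodule ∘ₗ (toBox g).rTensor L.toSubmodule =
      ((g : Y →ₗ[k] I).rTensor L.toSubmodule).rTensor L.toSubmodule ∘ₗ
        σ.toLin.rTensor L.toSubmodule := by
    rw [← LinearMap.rTensor_comp, e0, LinearMap.rTensor_comp]
  have e2 : (TensorProduct.assoc k I L.toSubmodule L.toSubmodule).toLinearMap ∘ₗ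
      ((g : Y →ₗ[k] I).rTensor L.toSubmodule).rTensor L.toSubmodule =
      (g : Y →ₗ[k] I).rTensor _ ∘ₗ
        (TensorProduct.assoc k Y L.toSubmodule L.toSubmodule).toLinearMap := by
    ext; rfl
  have e3 : (Coalgebra.comul (R := k) (A := L.toSubmodule)).lTensor I ∘ₗ
      (g : Y →ₗ[k] I).rTensor L.toSubmodule = (g : Y →ₗ[k] I).rTensor _ ∘ₗ
        (Coalgebra.comul (R := k) (A := L.toSubmodule)).lTensor Y := by
    rw [LinearMap.lTensor_comp_rTensor, LinearMap.rTensor_comp_lTensor]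
  have s2 := RightCoaction.sub_spec ((RightCoaction.regular k L.toSubmodule).tensor I) _
    (cotensor_isSub_right ρ L.leftCoaction _ L.bicomodule_right)
  have a0 := LinearMap.congr_fun e0 y
  have a1 := LinearMap.congr_fun e1 (σ.toLin y)
  have a2 := LinearMap.congr_fun e2 (σ.toLin.rTensor L.toSubmodule (σ.toLin y))
  have a3 := LinearMap.congr_fun e3 (σ.toLin y)
  have a4 := LinearMap.congr_fun s2 (toBox g y)
  have a5 := LinearMap.congr_fun σ.coassoc y
  simp only [LinearMap.comp_apply, LinearEquiv.coe_coe] at *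
  refine a1.trans (Eq.trans ?_ a4.symm)
  rw [a0]
  change _ = (TensorProduct.assoc k I L.toSubmodule L.toSubmodule).symm
    ((Coalgebra.comul (R := k) (A := L.toSubmodule)).lTensor I _)
  rw [LinearEquiv.eq_symm_apply, a2, a3, a5]

/-- The coefficient space of `M`: the span of all `(φ ⊗ 1) ρ(m)`, the least subspace `W` of `C`
with `ρ(M) ⊆ M ⊗ W`. -/
noncomputable def RightCoaction.coeffSpace {M : Type u} [AddCommGroup M] [Module k M]
    (ρ : RightCoaction k C M) : Submodule k C :=
  Submodule.span k {c | ∃ (φ : Module.Dual k M) (m : M),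
    c = TensorProduct.lid k C (φ.rTensor C (ρ.toLin m))}

theorem RightCoaction.mem_range_of_coeffSpace_le {M : Type u} [AddCommGroup M] [Module k M]
    (ρ : RightCoaction k C M) (W : Submodule k C) (h : ρ.coeffSpace ≤ W) (m : M) :
    ρ.toLin m ∈ LinearMap.range (W.subtype.lTensor M) := by
  have hex : Function.Exact W.subtype W.mkQ := LinearMap.exact_subtype_mkQ W
  apply (Module.Flat.lTensor_exact M hex _).1
  classical
  let b := Module.Basis.ofVectorSpace k M
  have hmem : ∀ φ : Module.Dual k M, TensorProduct.lid k C (φ.rTensor C (ρ.toLin m)) ∈ W :=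
    fun φ => h (Submodule.subset_span ⟨φ, m, rfl⟩)
  have hz : ∀ φ : Module.Dual k M, TensorProduct.lid k (C ⧸ W)
      (φ.rTensor (C ⧸ W) (W.mkQ.lTensor M (ρ.toLin m))) = 0 := by
    intro φ
    have e : (TensorProduct.lid k (C ⧸ W)).toLinearMap ∘ₗ φ.rTensor (C ⧸ W) ∘ₗ W.mkQ.lTensor M =
        W.mkQ ∘ₗ (TensorProduct.lid k C).toLinearMap ∘ₗ φ.rTensor C := by
      ext; simp
    have := LinearMap.congr_fun e (ρ.toLin m)
    simp only [LinearMap.comp_apply, LinearEquiv.coe_coe] at this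
    rw [this]
    simpa using hmem φ
  generalize W.mkQ.lTensor M (ρ.toLin m) = t at hz
  apply (TensorProduct.equivFinsuppOfBasisLeft b (N := C ⧸ W)).injective
  rw [map_zero]
  ext i
  have := hz (b.coord i)
  rw [Finsupp.zero_apply, ← this]
  clear this hz
  induction t using TensorProduct.induction_on with
  | zero => simp
  | add x y hx hy => simp only [map_add, Finsupp.add_apply, hx, hy]
  | tmul x y => simp

/-- A right `C`-comodule with coefficients in the subcoalgebra `L`, viewed as an `L`-comodule. -/
noncomputable def RightCoaction.restrict {M : Type u} [AddCommGroup M] [Module k M]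
    (ρ : RightCoaction k C M) (L : FDSubcoalgebra k C) (h : ρ.coeffSpace ≤ L.toSubmodule) :
    RightCoaction k L.toSubmodule M where
  toLin := liftInj (L.toSubmodule.subtype.lTensor M) (lTensor_inj _ M) ρ.toLin
    (ρ.mem_range_of_coeffSpace_le _ h)
  coassoc := by
    set l := liftInj (L.toSubmodule.subtype.lTensor M) (lTensor_inj _ M) ρ.toLin
      (ρ.mem_range_of_coeffSpace_le _ h) with hl
    have hs : L.toSubmodule.subtype.lTensor M ∘ₗ l = ρ.toLin := liftInj_spec _ _ _ _
    set i := L.toSubmodule.subtype with hi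
    apply LinearMap.ext
    intro x
    have hinj : Function.Injective ((TensorProduct.map i i).lTensor M) :=
      Module.Flat.lTensor_preserves_injective_linearMap _ (FDSubcoalgebra.map_inj _)
    apply hinj
    have e1 : (TensorProduct.map i i).lTensor M ∘ₗ (TensorProduct.assoc k M _ _).toLinearMap ∘ₗ
          l.rTensor _ = (TensorProduct.assoc k M C C).toLinearMap ∘ₗ
        ρ.toLin.rTensor C ∘ₗ i.lTensor M := by
      have : (TensorProduct.assoc k M C C).toLinearMap ∘ₗ TensorProduct.map (i.lTensor M) i =
          (TensorProduct.map i i).lTensor M ∘ₗ (TensorProduct.assoc k M _ _).toLinearMap := by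
        ext; rfl
      rw [LinearMap.rTensor_comp_lTensor, ← hs, ← LinearMap.comp_assoc, ← this,
        LinearMap.comp_assoc, LinearMap.map_comp_rTensor]
    have e2 : (Coalgebra.comul (R := k) (A := C)).lTensor M ∘ₗ i.lTensor M =
        (TensorProduct.map i i).lTensor M ∘ₗ
          (Coalgebra.comul (R := k) (A := L.toSubmodule)).lTensor M := by
      rw [← LinearMap.lTensor_comp, ← LinearMap.lTensor_comp, L.incl_comul]
    have a1 := LinearMap.congr_fun e1 (l x)
    have a2 := LinearMap.congr_fun e2 (l x)
    have a3 := LinearMap.congr_fun hs x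
    have a4 := LinearMap.congr_fun ρ.coassoc x
    simp only [LinearMap.comp_apply, LinearEquiv.coe_coe] at *
    rw [a1, ← a2, a3, a4]
  counit := by
    have hs : L.toSubmodule.subtype.lTensor M ∘ₗ
      liftInj (L.toSubmodule.subtype.lTensor M) (lTensor_inj _ M) ρ.toLin
      (ρ.mem_range_of_coeffSpace_le _ h) = ρ.toLin := liftInj_spec _ _ _ _
    rw [L.counit_eq, LinearMap.lTensor_comp, LinearMap.comp_assoc, hs]
    exact ρ.counit

theorem RightCoaction.restrict_push {M : Type u} [AddCommGroup M] [Module k M]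
    (ρ : RightCoaction k C M) (L : FDSubcoalgebra k C) (h : ρ.coeffSpace ≤ L.toSubmodule) :
    (ρ.restrict L h).push = ρ := by
  have hs : L.toSubmodule.subtype.lTensor M ∘ₗ (ρ.restrict L h).toLin = ρ.toLin :=
    liftInj_spec _ _ _ _
  cases ρ
  simp only [RightCoaction.push, RightCoaction.mk.injEq]
  exact hs

end Restriction

section Cohom

variable {k C : Type u} [Field k] [AddCommGroup C] [Module k C] [Coalgebra k C]

/-- `E` is an injective object in the category of right `C`-comodules. -/
def RightCoaction.IsInjective {E : Type u} [AddCommGroup E] [Module k E]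
    (ρ : RightCoaction k C E) : Prop :=
  ∀ (X Y : Type u) [AddCommGroup X] [Module k X] [AddCommGroup Y] [Module k Y]
    (σ : RightCoaction k C X) (τ : RightCoaction k C Y) (i : σ.Hom τ) (f : σ.Hom ρ),
    Function.Injective (i : X →ₗ[k] Y) →
      ∃ g : τ.Hom ρ, (g : Y →ₗ[k] E) ∘ₗ (i : X →ₗ[k] Y) = (f : X →ₗ[k] E)

/-- `M` is quasifinite: `Hom(F, M)` is finite-dimensional for every finite-dimensional
comodule `F`. -/
def RightCoaction.IsQuasifinite {M : Type u} [AddCommGroup M] [Module k M]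
    (ρ : RightCoaction k C M) : Prop :=
  ∀ (F : Type u) [AddCommGroup F] [Module k F] [FiniteDimensional k F]
    (σ : RightCoaction k C F), FiniteDimensional k (σ.Hom ρ)

/-- `M` is indecomposable: nonzero, and not the direct sum of two nonzero subcomodules. -/
def RightCoaction.IsIndecomposable {M : Type u} [AddCommGroup M] [Module k M]
    (ρ : RightCoaction k C M) : Prop :=
  Nontrivial M ∧ ∀ N₁ N₂ : Submodule k M, ρ.IsSub N₁ → ρ.IsSub N₂ → IsCompl N₁ N₂ →
    N₁ = ⊥ ∨ N₂ = ⊥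

theorem RightCoaction.comp_mem {X Y Z : Type u} [AddCommGroup X] [Module k X] [AddCommGroup Y]
    [Module k Y] [AddCommGroup Z] [Module k Z] {ρ : RightCoaction k C X} {σ : RightCoaction k C Y}
    {τ : RightCoaction k C Z} {g : Y →ₗ[k] Z} {f : X →ₗ[k] Y} (hg : g ∈ σ.Hom τ)
    (hf : f ∈ ρ.Hom σ) : g ∘ₗ f ∈ ρ.Hom τ := by
  change g.rTensor C ∘ₗ σ.toLin = τ.toLin ∘ₗ g at hg
  change f.rTensor C ∘ₗ ρ.toLin = σ.toLin ∘ₗ f at hf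
  change (g ∘ₗ f).rTensor C ∘ₗ ρ.toLin = τ.toLin ∘ₗ g ∘ₗ f
  rw [LinearMap.rTensor_comp, LinearMap.comp_assoc, hf, ← LinearMap.comp_assoc, hg,
    LinearMap.comp_assoc]

/-- Precomposition with a fixed comodule map. -/
def RightCoaction.precomp {X Y Z : Type u} [AddCommGroup X] [Module k X] [AddCommGroup Y]
    [Module k Y] [AddCommGroup Z] [Module k Z] {ρ : RightCoaction k C X} {σ : RightCoaction k C Y}
    (f : ρ.Hom σ) (τ : RightCoaction k C Z) : σ.Hom τ →ₗ[k] ρ.Hom τ where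
  toFun g := ⟨(g : Y →ₗ[k] Z) ∘ₗ (f : X →ₗ[k] Y), comp_mem g.2 f.2⟩
  map_add' _ _ := rfl
  map_smul' _ _ := rfl

/-- Postcomposition with a fixed comodule map. -/
def RightCoaction.postcomp {X Y Z : Type u} [AddCommGroup X] [Module k X] [AddCommGroup Y]
    [Module k Y] [AddCommGroup Z] [Module k Z] (ρ : RightCoaction k C X) {σ : RightCoaction k C Y}
    {τ : RightCoaction k C Z} (g : σ.Hom τ) : ρ.Hom σ →ₗ[k] ρ.Hom τ where
  toFun f := ⟨(g : Y →ₗ[k] Z) ∘ₗ (f : X →ₗ[k] Y), comp_mem g.2 f.2⟩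
  map_add' f f' := by ext x; simp
  map_smul' c f := by ext x; simp

namespace FDSubcoalgebra

theorem rightCoaction_spec (L : FDSubcoalgebra k C) :
    L.toSubmodule.subtype.rTensor C ∘ₗ L.rightCoaction.toLin =
      Coalgebra.comul ∘ₗ L.toSubmodule.subtype := by
  rw [← L.incl_comul]
  change _ ∘ₗ L.toSubmodule.subtype.lTensor _ ∘ₗ Coalgebra.comul = _
  rw [← LinearMap.comp_assoc, LinearMap.rTensor_comp_lTensor]

/-- The inclusion of subcoalgebras, as a map of right comodules. -/
def incl {L L' : FDSubcoalgebra k C} (h : L ≤ L') : L.rightCoaction.Hom L'.rightCoaction :=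
  ⟨Submodule.inclusion (show L.toSubmodule ≤ L'.toSubmodule from h), by
    change LinearMap.rTensor _ _ ∘ₗ _ = _ ∘ₗ _
    have hinj := rTensor_inj L'.toSubmodule C
    have h0 : L'.toSubmodule.subtype ∘ₗ
        Submodule.inclusion (show L.toSubmodule ≤ L'.toSubmodule from h) =
        L.toSubmodule.subtype := by ext; rfl
    apply LinearMap.ext
    intro x
    apply hinj
    have e1 : L'.toSubmodule.subtype.rTensor C ∘ₗ
        (Submodule.inclusion (show L.toSubmodule ≤ L'.toSubmodule from h)).rTensor C =
        L.toSubmodule.subtype.rTensor C := by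
      rw [← LinearMap.rTensor_comp, h0]
    have a1 := LinearMap.congr_fun e1 (L.rightCoaction.toLin x)
    have a2 := LinearMap.congr_fun L.rightCoaction_spec x
    have a3 := LinearMap.congr_fun L'.rightCoaction_spec
      (Submodule.inclusion (show L.toSubmodule ≤ L'.toSubmodule from h) x)
    simp only [LinearMap.comp_apply] at *
    rw [a1, a2, a3]
    rfl⟩

/-- The right comodule endomorphism `x ↦ ∑ a(x₁) x₂` of a subcoalgebra `L`, for a linear form
`a` on `L`. -/
noncomputable def hit (L : FDSubcoalgebra k C) (a : Module.Dual k L.toSubmodule) :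
    L.toSubmodule →ₗ[k] L.toSubmodule :=
  (TensorProduct.lid k L.toSubmodule).toLinearMap ∘ₗ a.rTensor L.toSubmodule ∘ₗ Coalgebra.comul

theorem hit_mem (L : FDSubcoalgebra k C) (a : Module.Dual k L.toSubmodule) :
    L.hit a ∈ L.rightCoaction.Hom L.rightCoaction := by
  change (L.hit a).rTensor C ∘ₗ _ = _ ∘ₗ L.hit a
  set r := L.rightCoaction.toLin with hr
  have hb : (TensorProduct.assoc k L.toSubmodule L.toSubmodule C).toLinearMap ∘ₗ
      (Coalgebra.comul (R := k) (A := L.toSubmodule)).rTensor C ∘ₗ r =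
      r.lTensor L.toSubmodule ∘ₗ Coalgebra.comul := L.bicomodule_left
  have e1 : r ∘ₗ (TensorProduct.lid k L.toSubmodule).toLinearMap ∘ₗ a.rTensor L.toSubmodule =
      (TensorProduct.lid k _).toLinearMap ∘ₗ a.rTensor _ ∘ₗ r.lTensor L.toSubmodule := by
    ext; simp
  have e2 : (TensorProduct.lid k _).toLinearMap ∘ₗ a.rTensor _ ∘ₗ
      (TensorProduct.assoc k L.toSubmodule L.toSubmodule C).toLinearMap =
      ((TensorProduct.lid k L.toSubmodule).toLinearMap ∘ₗ a.rTensor L.toSubmodule).rTensor C := by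
    ext; simp [TensorProduct.smul_tmul']
  apply LinearMap.ext
  intro x
  have a0 := LinearMap.congr_fun hb x
  have a1 := LinearMap.congr_fun e1 (Coalgebra.comul x)
  have a2 := LinearMap.congr_fun e2
    ((Coalgebra.comul (R := k) (A := L.toSubmodule)).rTensor C (r x))
  have e3 : (L.hit a).rTensor C = ((TensorProduct.lid k L.toSubmodule).toLinearMap ∘ₗ
      a.rTensor L.toSubmodule).rTensor C ∘ₗ
        (Coalgebra.comul (R := k) (A := L.toSubmodule)).rTensor C := by
    rw [← LinearMap.rTensor_comp]; rfl
  simp only [LinearMap.comp_apply, LinearEquiv.coe_coe] at *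
  rw [e3, LinearMap.comp_apply, ← a2, a0, ← a1]
  rfl

/-- The convolution product `a * b` of linear forms. -/
noncomputable def conv (L : FDSubcoalgebra k C) (a b : Module.Dual k L.toSubmodule) :
    Module.Dual k L.toSubmodule :=
  (TensorProduct.lid k k).toLinearMap ∘ₗ TensorProduct.map a b ∘ₗ Coalgebra.comul

theorem hit_hit (L : FDSubcoalgebra k C) (a b : Module.Dual k L.toSubmodule) :
    L.hit b ∘ₗ L.hit a = L.hit (L.conv a b) := by
  have e1 : (TensorProduct.lid k _).toLinearMap ∘ₗ b.rTensor L.toSubmodule ∘ₗ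
      Coalgebra.comul ∘ₗ (TensorProduct.lid k L.toSubmodule).toLinearMap ∘ₗ
        a.rTensor L.toSubmodule =
      (TensorProduct.lid k _).toLinearMap ∘ₗ b.rTensor L.toSubmodule ∘ₗ
        (TensorProduct.lid k _).toLinearMap ∘ₗ a.rTensor _ ∘ₗ
          (Coalgebra.comul (R := k)).lTensor L.toSubmodule := by
    ext; simp
  have e2 : (TensorProduct.lid k _).toLinearMap ∘ₗ b.rTensor L.toSubmodule ∘ₗ
        (TensorProduct.lid k _).toLinearMap ∘ₗ a.rTensor _ ∘ₗ
        (TensorProduct.assoc k _ _ L.toSubmodule).toLinearMap =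
      (TensorProduct.lid k L.toSubmodule).toLinearMap ∘ₗ
        ((TensorProduct.lid k k).toLinearMap ∘ₗ TensorProduct.map a b).rTensor L.toSubmodule := by
    apply TensorProduct.ext
    apply TensorProduct.ext
    ext x y z
    simp [smul_smul]
  have e3 : (L.conv a b).rTensor L.toSubmodule = ((TensorProduct.lid k k).toLinearMap ∘ₗ
      TensorProduct.map a b).rTensor L.toSubmodule ∘ₗ Coalgebra.comul.rTensor L.toSubmodule := by
    rw [← LinearMap.rTensor_comp]; rfl
  apply LinearMap.ext
  intro x
  have a1 := LinearMap.congr_fun e1 (Coalgebra.comul x)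
  have a2 := LinearMap.congr_fun e2 (Coalgebra.comul.rTensor L.toSubmodule (Coalgebra.comul x))
  have a3 := Coalgebra.coassoc_apply (R := k) x
  simp only [hit, LinearMap.comp_apply, LinearEquiv.coe_coe] at *
  rw [e3, LinearMap.comp_apply, a1, ← a3, a2]

theorem hit_counit (L : FDSubcoalgebra k C) : L.hit Coalgebra.counit = LinearMap.id := by
  ext x
  simp [hit]

/-- The vector space `D Hom(L, M)` for a subcoalgebra `L`. -/
abbrev stage (L : FDSubcoalgebra k C) {M : Type u} [AddCommGroup M] [Module k M]
    (ρ : RightCoaction k C M) : Type u :=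
  Module.Dual k (L.rightCoaction.Hom ρ)

/-- The dual of the restriction map `Hom(L', M) → Hom(L, M)`. -/
noncomputable def trans {M : Type u} [AddCommGroup M] [Module k M] (ρ : RightCoaction k C M)
    (L L' : FDSubcoalgebra k C) (h : L ≤ L') : L.stage ρ →ₗ[k] L'.stage ρ :=
  (RightCoaction.precomp (incl h) ρ).dualMap

variable {M : Type u} [AddCommGroup M] [Module k M]

/-- The endomorphism `f ↦ f ∘ hit a` of `Hom(L, M)`, linear in `a`. -/
noncomputable def hitHom (L : FDSubcoalgebra k C) (ρ : RightCoaction k C M) :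
    Module.Dual k L.toSubmodule →ₗ[k] L.rightCoaction.Hom ρ →ₗ[k] L.rightCoaction.Hom ρ where
  toFun a := RightCoaction.precomp ⟨L.hit a, L.hit_mem a⟩ ρ
  map_add' a b := by
    ext f x
    simp [RightCoaction.precomp, hit, LinearMap.rTensor_add]
  map_smul' c a := by
    ext f x
    simp [RightCoaction.precomp, hit, LinearMap.rTensor_smul]

/-- The isomorphism `L ⊗ W ≃ Hom(L^*, W)`, `x ⊗ w ↦ (a ↦ a(x) w)`. -/
noncomputable def tensorEquiv (L : FDSubcoalgebra k C) (W : Type u) [AddCommGroup W]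
    [Module k W] : L.toSubmodule ⊗[k] W ≃ₗ[k] (Module.Dual k L.toSubmodule →ₗ[k] W) :=
  (LinearEquiv.rTensor W (Module.evalEquiv k L.toSubmodule)).trans
    (dualTensorHomEquiv (R := k) (M := Module.Dual k L.toSubmodule) (N := W))

theorem tensorEquiv_apply (L : FDSubcoalgebra k C) {W : Type u} [AddCommGroup W]
    [Module k W] (t : L.toSubmodule ⊗[k] W) (a : Module.Dual k L.toSubmodule) :
    L.tensorEquiv W t a = TensorProduct.lid k W (a.rTensor W t) := by
  induction t using TensorProduct.induction_on with
  | zero => simp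
  | add x y hx hy => simp only [map_add, LinearMap.add_apply, hx, hy]
  | tmul x y => simp [tensorEquiv, dualTensorHom_apply]

/-- The map `D Hom(L, M) → L ⊗ D Hom(L, M)`, `φ ↦ ∑ φ₋₁ ⊗ φ₀`, determined by
`∑ a(φ₋₁) φ₀(f) = φ(f ∘ hit a)` for all linear forms `a` on `L` and all `f`. -/
noncomputable def stageMap (L : FDSubcoalgebra k C) (ρ : RightCoaction k C M) :
    L.stage ρ →ₗ[k] L.toSubmodule ⊗[k] L.stage ρ :=
  (L.tensorEquiv (L.stage ρ)).symm.toLinearMap ∘ₗ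
    { toFun := fun φ =>
        { toFun := fun a => φ ∘ₗ L.hitHom ρ a
          map_add' := fun a b => by rw [map_add, LinearMap.comp_add]
          map_smul' := fun c a => by rw [map_smul, LinearMap.comp_smul]; rfl }
      map_add' := fun φ ψ => by ext a f; simp
      map_smul' := fun c φ => by ext a f; simp }

theorem stageMap_apply (L : FDSubcoalgebra k C) (ρ : RightCoaction k C M) (φ : L.stage ρ)
    (a : Module.Dual k L.toSubmodule) :
    TensorProduct.lid k _ (a.rTensor _ (L.stageMap ρ φ)) = φ ∘ₗ L.hitHom ρ a := by
  rw [← tensorEquiv_apply]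
  simp [stageMap]

theorem tensor_ext (L : FDSubcoalgebra k C) {W : Type u} [AddCommGroup W] [Module k W]
    {s t : L.toSubmodule ⊗[k] W}
    (h : ∀ a : Module.Dual k L.toSubmodule,
      TensorProduct.lid k W (a.rTensor W s) = TensorProduct.lid k W (a.rTensor W t)) : s = t := by
  apply (L.tensorEquiv W).injective
  ext a
  rw [tensorEquiv_apply, tensorEquiv_apply, h]

theorem ev_lTensor (L : FDSubcoalgebra k C) {V W : Type u} [AddCommGroup W] [Module k W]
    [AddCommGroup V] [Module k V] (f : V →ₗ[k] W) (a : Module.Dual k L.toSubmodule)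
    (t : L.toSubmodule ⊗[k] V) :
    TensorProduct.lid k W (a.rTensor W (f.lTensor _ t)) =
      f (TensorProduct.lid k V (a.rTensor V t)) := by
  have : (TensorProduct.lid k W).toLinearMap ∘ₗ a.rTensor W ∘ₗ f.lTensor _ =
      f ∘ₗ (TensorProduct.lid k V).toLinearMap ∘ₗ a.rTensor V := by
    ext; simp
  exact LinearMap.congr_fun this t

theorem ev_ev (L : FDSubcoalgebra k C) {W : Type u} [AddCommGroup W] [Module k W]
    (a b : Module.Dual k L.toSubmodule) (t : L.toSubmodule ⊗[k] W) :
    TensorProduct.lid k W (b.rTensor W (TensorProduct.lid k _ (a.rTensor _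
      (TensorProduct.assoc k _ _ W (Coalgebra.comul.rTensor W t))))) =
      TensorProduct.lid k W ((L.conv a b).rTensor W t) := by
  have e : (TensorProduct.lid k W).toLinearMap ∘ₗ b.rTensor W ∘ₗ
      (TensorProduct.lid k _).toLinearMap ∘ₗ a.rTensor _ ∘ₗ
        (TensorProduct.assoc k L.toSubmodule L.toSubmodule W).toLinearMap =
      (TensorProduct.lid k W).toLinearMap ∘ₗ
        ((TensorProduct.lid k k).toLinearMap ∘ₗ TensorProduct.map a b).rTensor W := by
    apply TensorProduct.ext
    apply TensorProduct.ext
    ext x y z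
    simp [smul_smul]
  have e3 : (L.conv a b).rTensor W = ((TensorProduct.lid k k).toLinearMap ∘ₗ
      TensorProduct.map a b).rTensor W ∘ₗ Coalgebra.comul.rTensor W := by
    rw [← LinearMap.rTensor_comp]; rfl
  rw [e3]
  exact LinearMap.congr_fun e _

/-- The left `L`-comodule `D Hom(L, M)`. -/
noncomputable def stageCoaction (L : FDSubcoalgebra k C) (ρ : RightCoaction k C M) :
    LeftCoaction k L.toSubmodule (L.stage ρ) where
  toLin := L.stageMap ρ
  coassoc := by
    apply LinearMap.ext
    intro φ
    apply L.tensor_ext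
    intro a
    apply L.tensor_ext
    intro b
    simp only [LinearMap.comp_apply, LinearEquiv.coe_coe]
    rw [ev_ev, ev_lTensor, stageMap_apply, stageMap_apply, stageMap_apply]
    ext f
    simp only [LinearMap.comp_apply]
    congr 1
    ext1
    simp only [hitHom, RightCoaction.precomp, LinearMap.coe_mk, AddHom.coe_mk]
    rw [LinearMap.comp_assoc, hit_hit]
  counit := by
    apply LinearMap.ext
    intro φ
    simp only [LinearMap.comp_apply, LinearEquiv.coe_coe]
    rw [stageMap_apply]
    ext f
    simp only [LinearMap.comp_apply, LinearMap.id_apply]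
    congr 1
    ext1
    simp only [hitHom, RightCoaction.precomp, LinearMap.coe_mk, AddHom.coe_mk]
    rw [hit_counit, LinearMap.comp_id]

theorem hit_incl {L L' : FDSubcoalgebra k C} (h : L ≤ L') (a : Module.Dual k L'.toSubmodule) :
    L'.hit a ∘ₗ (incl h : L.toSubmodule →ₗ[k] L'.toSubmodule) =
      (incl h : L.toSubmodule →ₗ[k] L'.toSubmodule) ∘ₗ
        L.hit (a ∘ₗ (incl h : L.toSubmodule →ₗ[k] L'.toSubmodule)) := by
  set j : L.toSubmodule →ₗ[k] L'.toSubmodule := (incl h).1 with hj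
  have h0 : L'.toSubmodule.subtype ∘ₗ j = L.toSubmodule.subtype := by ext; rfl
  have hc : Coalgebra.comul ∘ₗ j = TensorProduct.map j j ∘ₗ Coalgebra.comul := by
    apply LinearMap.ext
    intro x
    apply map_inj L'.toSubmodule
    have a1 := LinearMap.congr_fun L'.incl_comul (j x)
    have a2 := LinearMap.congr_fun L.incl_comul x
    have a3 := LinearMap.congr_fun h0 x
    have e : TensorProduct.map L'.toSubmodule.subtype L'.toSubmodule.subtype ∘ₗ
        TensorProduct.map j j =
        TensorProduct.map L.toSubmodule.subtype L.toSubmodule.subtype := by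
      rw [← TensorProduct.map_comp, h0]
    have a4 := LinearMap.congr_fun e (Coalgebra.comul x)
    simp only [LinearMap.comp_apply] at *
    rw [a1, a4, a2, a3]
  have e : (TensorProduct.lid k _).toLinearMap ∘ₗ a.rTensor _ ∘ₗ TensorProduct.map j j =
      j ∘ₗ (TensorProduct.lid k _).toLinearMap ∘ₗ (a ∘ₗ j).rTensor _ := by
    ext; simp
  apply LinearMap.ext
  intro x
  have a1 := LinearMap.congr_fun hc x
  have a2 := LinearMap.congr_fun e (Coalgebra.comul x)
  simp only [hit, LinearMap.comp_apply, LinearEquiv.coe_coe] at *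
  rw [a1, a2]

theorem trans_isHom (ρ : RightCoaction k C M) (L L' : FDSubcoalgebra k C) (h : L ≤ L') :
    (L.stageCoaction ρ).push.IsHom (L'.stageCoaction ρ).push (trans ρ L L' h) := by
  have h0 : L'.toSubmodule.subtype ∘ₗ (incl h : L.toSubmodule →ₗ[k] L'.toSubmodule) =
    L.toSubmodule.subtype := by ext; rfl
  have e : TensorProduct.map (incl h : L.toSubmodule →ₗ[k] L'.toSubmodule) (trans ρ L L' h) ∘ₗ
      L.stageMap ρ = L'.stageMap ρ ∘ₗ trans ρ L L' h := by
    apply LinearMap.ext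
    intro φ
    apply L'.tensor_ext
    intro a
    have e1 : (TensorProduct.lid k _).toLinearMap ∘ₗ a.rTensor _ ∘ₗ
        TensorProduct.map (incl h : L.toSubmodule →ₗ[k] L'.toSubmodule) (trans ρ L L' h) =
        trans ρ L L' h ∘ₗ (TensorProduct.lid k _).toLinearMap ∘ₗ
          (a ∘ₗ (incl h : L.toSubmodule →ₗ[k] L'.toSubmodule)).rTensor _ := by
      apply TensorProduct.ext'
      intro x y
      simp
    have a1 := LinearMap.congr_fun e1 (L.stageMap ρ φ)
    simp only [LinearMap.comp_apply, LinearEquiv.coe_coe] at *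
    rw [a1, stageMap_apply, stageMap_apply]
    ext f
    simp only [LinearMap.comp_apply, trans, LinearMap.dualMap_apply]
    congr 1
    ext1
    simp only [hitHom, RightCoaction.precomp, LinearMap.coe_mk, AddHom.coe_mk]
    rw [LinearMap.comp_assoc, LinearMap.comp_assoc, hit_incl]
  change LinearMap.lTensor _ _ ∘ₗ LinearMap.rTensor _ _ ∘ₗ L.stageMap ρ =
    (LinearMap.rTensor _ _ ∘ₗ L'.stageMap ρ) ∘ₗ _
  rw [LinearMap.comp_assoc, ← e, ← LinearMap.comp_assoc, ← LinearMap.comp_assoc,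
    LinearMap.rTensor_comp_map, h0, LinearMap.lTensor_comp_rTensor]

end FDSubcoalgebra

noncomputable instance : DecidableEq (FDSubcoalgebra k C) := Classical.decEq _

/-- The cohom space `h(M, C) = M^*`, the direct limit of the spaces `D Hom(L, M)` over the
finite-dimensional subcoalgebras `L` of `C`. -/
def Cohom {M : Type u} [AddCommGroup M] [Module k M] (ρ : RightCoaction k C M) : Type u :=
  Module.DirectLimit (fun L : FDSubcoalgebra k C => L.stage ρ) (FDSubcoalgebra.trans ρ)

noncomputable instance {M : Type u} [AddCommGroup M] [Module k M] (ρ : RightCoaction k C M) :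
    AddCommGroup (Cohom ρ) :=
  Module.DirectLimit.addCommGroup (fun L : FDSubcoalgebra k C => L.stage ρ)
    (FDSubcoalgebra.trans ρ)

noncomputable instance {M : Type u} [AddCommGroup M] [Module k M] (ρ : RightCoaction k C M) :
    Module k (Cohom ρ) :=
  Module.DirectLimit.module (fun L : FDSubcoalgebra k C => L.stage ρ) (FDSubcoalgebra.trans ρ)

namespace Cohom

variable {M N : Type u} [AddCommGroup M] [Module k M] [AddCommGroup N] [Module k N]

/-- The canonical map `D Hom(L, M) → h(M, C)`. -/
noncomputable def of (ρ : RightCoaction k C M) (L : FDSubcoalgebra k C) :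
    L.stage ρ →ₗ[k] Cohom ρ :=
  Module.DirectLimit.of k (FDSubcoalgebra k C) (fun L => L.stage ρ) (FDSubcoalgebra.trans ρ) L

theorem of_trans (ρ : RightCoaction k C M) (L L' : FDSubcoalgebra k C) (h : L ≤ L') :
    of ρ L' ∘ₗ FDSubcoalgebra.trans ρ L L' h = of ρ L := by
  apply LinearMap.ext
  intro x
  exact Module.DirectLimit.of_f

/-- The map out of `h(M, C)` given by a compatible family of maps. -/
noncomputable def desc (ρ : RightCoaction k C M) {V : Type u} [AddCommGroup V] [Module k V]
    (g : ∀ L : FDSubcoalgebra k C, L.stage ρ →ₗ[k] V)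
    (hg : ∀ L L' h, g L' ∘ₗ FDSubcoalgebra.trans ρ L L' h = g L) : Cohom ρ →ₗ[k] V :=
  Module.DirectLimit.lift k (FDSubcoalgebra k C) (fun L => L.stage ρ) (FDSubcoalgebra.trans ρ) g (fun L L' h x => LinearMap.congr_fun (hg L L' h) x)

theorem desc_of (ρ : RightCoaction k C M) {V : Type u} [AddCommGroup V] [Module k V]
    (g : ∀ L : FDSubcoalgebra k C, L.stage ρ →ₗ[k] V)
    (hg : ∀ L L' h, g L' ∘ₗ FDSubcoalgebra.trans ρ L L' h = g L) (L : FDSubcoalgebra k C) :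
    desc ρ g hg ∘ₗ of ρ L = g L := by
  apply LinearMap.ext
  intro x
  exact Module.DirectLimit.lift_of (f := FDSubcoalgebra.trans ρ) g
    (fun L L' h x => LinearMap.congr_fun (hg L L' h) x) x

theorem hom_ext {ρ : RightCoaction k C M} {V : Type u} [AddCommGroup V] [Module k V]
    {f g : Cohom ρ →ₗ[k] V} (h : ∀ L, f ∘ₗ of ρ L = g ∘ₗ of ρ L) : f = g :=
  Module.DirectLimit.hom_ext h

/-- The coaction map `h(M, C) → C ⊗ h(M, C)`. -/
noncomputable def coactionMap (ρ : RightCoaction k C M) : Cohom ρ →ₗ[k] C ⊗[k] Cohom ρ :=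
  desc ρ (fun L => (of ρ L).lTensor C ∘ₗ (L.stageCoaction ρ).push.toLin) (by
    intro L L' h
    have := FDSubcoalgebra.trans_isHom ρ L L' h
    change LinearMap.lTensor _ _ ∘ₗ _ = _ at this
    rw [LinearMap.comp_assoc, ← this, ← LinearMap.comp_assoc, ← LinearMap.lTensor_comp,
      of_trans])

theorem coactionMap_of (ρ : RightCoaction k C M) (L : FDSubcoalgebra k C) :
    coactionMap ρ ∘ₗ of ρ L = (of ρ L).lTensor C ∘ₗ (L.stageCoaction ρ).push.toLin :=
  desc_of _ _ _ _

/-- The left `C`-comodule `M^* = h(M, C)`. -/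
noncomputable def coaction (ρ : RightCoaction k C M) : LeftCoaction k C (Cohom ρ) where
  toLin := coactionMap ρ
  coassoc := by
    apply hom_ext
    intro L
    have e1 : (TensorProduct.assoc k C C (Cohom ρ)).toLinearMap ∘ₗ
        (Coalgebra.comul (R := k) (A := C)).rTensor (Cohom ρ) ∘ₗ (of ρ L).lTensor C =
        ((of ρ L).lTensor C).lTensor C ∘ₗ (TensorProduct.assoc k C C _).toLinearMap ∘ₗ
        (Coalgebra.comul (R := k) (A := C)).rTensor _ := by
      have : ((of ρ L).lTensor C).lTensor C ∘ₗ (TensorProduct.assoc k C C _).toLinearMap =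
          (TensorProduct.assoc k C C _).toLinearMap ∘ₗ (of ρ L).lTensor (C ⊗[k] C) := by
        apply TensorProduct.ext
        apply TensorProduct.ext
        apply LinearMap.ext; intro x
        apply LinearMap.ext; intro y
        apply LinearMap.ext; intro z
        rfl
      rw [← LinearMap.comp_assoc _ _ (LinearMap.lTensor _ _), this, LinearMap.comp_assoc,
        LinearMap.lTensor_comp_rTensor, LinearMap.rTensor_comp_lTensor]
    have e2 : (coactionMap ρ).lTensor C ∘ₗ (of ρ L).lTensor C =
        ((of ρ L).lTensor C).lTensor C ∘ₗ (L.stageCoaction ρ).push.toLin.lTensor C := by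
      rw [← LinearMap.lTensor_comp, coactionMap_of, LinearMap.lTensor_comp]
    apply LinearMap.ext
    intro x
    have a0 := LinearMap.congr_fun (coactionMap_of ρ L) x
    have a1 := LinearMap.congr_fun e1 ((L.stageCoaction ρ).push.toLin x)
    have a2 := LinearMap.congr_fun e2 ((L.stageCoaction ρ).push.toLin x)
    have a3 := LinearMap.congr_fun (L.stageCoaction ρ).push.coassoc x
    simp only [LinearMap.comp_apply, LinearEquiv.coe_coe] at *
    rw [a0, a1, a2, a3]
  counit := by
    apply hom_ext
    intro L
    have e1 : (TensorProduct.lid k (Cohom ρ)).toLinearMap ∘ₗ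
        (Coalgebra.counit (R := k) (A := C)).rTensor (Cohom ρ) ∘ₗ (of ρ L).lTensor C =
        of ρ L ∘ₗ (TensorProduct.lid k _).toLinearMap ∘ₗ
          (Coalgebra.counit (R := k) (A := C)).rTensor _ := by
      apply TensorProduct.ext'
      intro x y
      simp
    apply LinearMap.ext
    intro x
    have a0 := LinearMap.congr_fun (coactionMap_of ρ L) x
    have a1 := LinearMap.congr_fun e1 ((L.stageCoaction ρ).push.toLin x)
    have a3 := LinearMap.congr_fun (L.stageCoaction ρ).push.counit x
    simp only [LinearMap.comp_apply, LinearEquiv.coe_coe, LinearMap.id_apply] at *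
    rw [a0, a1, a3]

/-- The map `N^* → M^*` induced by a comodule map `g : M → N`. -/
noncomputable def map {ρ : RightCoaction k C M} {σ : RightCoaction k C N} (g : ρ.Hom σ) :
    Cohom σ →ₗ[k] Cohom ρ :=
  desc σ (fun L => of ρ L ∘ₗ (L.rightCoaction.postcomp g).dualMap) (by
    intro L L' h
    rw [← of_trans ρ L L' h, LinearMap.comp_assoc, LinearMap.comp_assoc]
    rfl)

theorem map_of {ρ : RightCoaction k C M} {σ : RightCoaction k C N} (g : ρ.Hom σ)
    (L : FDSubcoalgebra k C) :
    map g ∘ₗ of σ L = of ρ L ∘ₗ (L.rightCoaction.postcomp g).dualMap :=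
  desc_of _ _ _ _

theorem map_isHom {ρ : RightCoaction k C M} {σ : RightCoaction k C N} (g : ρ.Hom σ) :
    (coaction σ).IsHom (coaction ρ) (map g) := by
  apply hom_ext
  intro L
  set p := (L.rightCoaction.postcomp g).dualMap with hp
  have e0 : p.lTensor _ ∘ₗ L.stageMap σ = L.stageMap ρ ∘ₗ p := by
    apply LinearMap.ext
    intro φ
    apply L.tensor_ext
    intro a
    simp only [LinearMap.comp_apply]
    rw [FDSubcoalgebra.ev_lTensor, FDSubcoalgebra.stageMap_apply, FDSubcoalgebra.stageMap_apply]
    rfl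
  have e : p.lTensor C ∘ₗ (L.stageCoaction σ).push.toLin =
      (L.stageCoaction ρ).push.toLin ∘ₗ p := by
    change _ ∘ₗ LinearMap.rTensor _ _ ∘ₗ L.stageMap σ =
      (LinearMap.rTensor _ _ ∘ₗ L.stageMap ρ) ∘ₗ p
    rw [LinearMap.comp_assoc, ← e0, ← LinearMap.comp_assoc, ← LinearMap.comp_assoc,
      LinearMap.lTensor_comp_rTensor, LinearMap.rTensor_comp_lTensor]
  have e1 : (map g).lTensor C ∘ₗ (of σ L).lTensor C = (of ρ L).lTensor C ∘ₗ p.lTensor C := by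
    rw [← LinearMap.lTensor_comp, map_of, LinearMap.lTensor_comp]
  have f1 : (coaction σ).toLin ∘ₗ of σ L = _ := coactionMap_of σ L
  have f2 : (coaction ρ).toLin ∘ₗ of ρ L = _ := coactionMap_of ρ L
  rw [LinearMap.comp_assoc, f1, ← LinearMap.comp_assoc, e1, LinearMap.comp_assoc,
    LinearMap.comp_assoc, map_of, ← LinearMap.comp_assoc _ (of ρ L), f2, LinearMap.comp_assoc, e]

end Cohom

end Cohom

section Comparison

variable {k C : Type u} [Field k] [AddCommGroup C] [Module k C] [Coalgebra k C]

/-- A subcoalgebra `K` of a subcoalgebra `L` of `C`, viewed as a subcoalgebra of `C`. -/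
def FDSubcoalgebra.image (L : FDSubcoalgebra k C) (K : FDSubcoalgebra k L.toSubmodule) :
    FDSubcoalgebra k C where
  toSubmodule := K.toSubmodule.map L.toSubmodule.subtype
  finite := inferInstance
  comul_mem := by
    rintro _ ⟨x, hx, rfl⟩
    obtain ⟨t, ht⟩ := K.comul_mem x hx
    have a1 := LinearMap.congr_fun L.incl_comul x
    let j : K.toSubmodule →ₗ[k] K.toSubmodule.map L.toSubmodule.subtype :=
      L.toSubmodule.subtype.restrict (fun y hy => Submodule.mem_map_of_mem hy)
    have e : TensorProduct.map (K.toSubmodule.map L.toSubmodule.subtype).subtype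
        (K.toSubmodule.map L.toSubmodule.subtype).subtype ∘ₗ TensorProduct.map j j =
        TensorProduct.map L.toSubmodule.subtype L.toSubmodule.subtype ∘ₗ
          TensorProduct.map K.toSubmodule.subtype K.toSubmodule.subtype := by
      rw [← TensorProduct.map_comp, ← TensorProduct.map_comp]
      rfl
    refine ⟨TensorProduct.map j j t, ?_⟩
    have a2 := LinearMap.congr_fun e t
    simp only [LinearMap.comp_apply] at *
    rw [a2, ht, a1]

theorem FDSubcoalgebra.image_mono (L : FDSubcoalgebra k C)
    {K K' : FDSubcoalgebra k L.toSubmodule} (h : K ≤ K') : (L.image K) ≤ (L.image K') :=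
  Submodule.map_mono (show K.toSubmodule ≤ K'.toSubmodule from h)

/-- The tautological map from `K` to its image in `C`, as a map of right `C`-comodules. -/
noncomputable def FDSubcoalgebra.toImage (L : FDSubcoalgebra k C)
    (K : FDSubcoalgebra k L.toSubmodule) :
    K.rightCoaction.push.Hom (L.image K).rightCoaction :=
  ⟨L.toSubmodule.subtype.restrict (fun _ hy => Submodule.mem_map_of_mem hy), by
    change LinearMap.rTensor _ _ ∘ₗ _ = _ ∘ₗ _
    set j : K.toSubmodule →ₗ[k] (L.image K).toSubmodule :=
      L.toSubmodule.subtype.restrict (fun _ hy => Submodule.mem_map_of_mem hy) with hj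
    have h0 : (L.image K).toSubmodule.subtype ∘ₗ j =
        L.toSubmodule.subtype ∘ₗ K.toSubmodule.subtype := by ext; rfl
    apply LinearMap.ext
    intro x
    apply rTensor_inj (L.image K).toSubmodule C
    have e1 : (L.image K).toSubmodule.subtype.rTensor C ∘ₗ j.rTensor C ∘ₗ
        L.toSubmodule.subtype.lTensor _ =
        TensorProduct.map L.toSubmodule.subtype L.toSubmodule.subtype ∘ₗ
          K.toSubmodule.subtype.rTensor _ := by
      rw [← LinearMap.comp_assoc, ← LinearMap.rTensor_comp, h0, LinearMap.rTensor_comp_lTensor,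
        LinearMap.map_comp_rTensor]
    have a1 := LinearMap.congr_fun e1 (K.rightCoaction.toLin x)
    have a2 := LinearMap.congr_fun K.rightCoaction_spec x
    have a3 := LinearMap.congr_fun (L.image K).rightCoaction_spec (j x)
    have a4 := LinearMap.congr_fun L.incl_comul (K.toSubmodule.subtype x)
    have a5 := LinearMap.congr_fun h0 x
    simp only [LinearMap.comp_apply] at *
    rw [a3, a5, ← a4, ← a2, ← a1]
    rfl⟩

/-- The map `Hom_C(K, I) → Hom_L(K, I □ L)`, `g ↦ (y ↦ ∑ g(y₁) ⊗ y₂)`, for a subcoalgebra `K`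
of `L`. -/
noncomputable def RightCoaction.homToBox {I : Type u} [AddCommGroup I] [Module k I]
    (ρ : RightCoaction k C I) (L : FDSubcoalgebra k C) (K : FDSubcoalgebra k L.toSubmodule) :
    (L.image K).rightCoaction.Hom ρ →ₗ[k] K.rightCoaction.Hom (ρ.boxCoaction L) where
  toFun g := ⟨toBox (precomp (L.toImage K) ρ g), toBox_mem _⟩
  map_add' f g := by
    apply Subtype.ext
    apply LinearMap.ext
    intro y
    apply Subtype.ext
    simp [toBox, LinearMap.rTensor_add]
  map_smul' c g := by
    apply Subtype.ext
    apply LinearMap.ext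
    intro y
    apply Subtype.ext
    simp [toBox, LinearMap.rTensor_smul]

/-- The canonical map `h_L(I □ L, L) → h_C(I, C)`: on the stage of a subcoalgebra `K` of `L` it is
the dual `D Hom_L(K, I □ L) → D Hom_C(K, I)` of the map `homToBox`. -/
noncomputable def Cohom.compare {I : Type u} [AddCommGroup I] [Module k I]
    (ρ : RightCoaction k C I) (L : FDSubcoalgebra k C) :
    Cohom (ρ.boxCoaction L) →ₗ[k] Cohom ρ :=
  Cohom.desc _ (fun K => Cohom.of ρ (L.image K) ∘ₗ (ρ.homToBox L K).dualMap) (by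
    intro K K' h
    rw [← Cohom.of_trans ρ (L.image K) (L.image K') (FDSubcoalgebra.image_mono L h), LinearMap.comp_assoc,
      LinearMap.comp_assoc]
    congr 1
    apply LinearMap.ext
    intro φ
    apply LinearMap.ext
    intro g
    simp only [LinearMap.comp_apply, LinearMap.dualMap_apply, FDSubcoalgebra.trans]
    congr 1
    apply Subtype.ext
    apply LinearMap.ext
    intro y
    apply Subtype.ext
    have hi : LinearMap.rTensor _ _ ∘ₗ _ = _ ∘ₗ _ := (FDSubcoalgebra.incl h).2
    have a1 := LinearMap.congr_fun hi y
    simp only [LinearMap.comp_apply] at a1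
    simp only [RightCoaction.homToBox, RightCoaction.precomp, RightCoaction.toBox,
      LinearMap.coe_mk, AddHom.coe_mk, LinearMap.comp_apply, LinearMap.codRestrict_apply]
    rw [← a1, ← LinearMap.comp_apply, ← LinearMap.rTensor_comp]
    rfl)

end Comparison

section Transpose

variable {k C : Type u} [Field k] [AddCommGroup C] [Module k C] [Coalgebra k C]
  {M : Type u} [AddCommGroup M] [Module k M]

/-- The data of a sequence of right comodules `M → I₀ → I₁`. -/
structure Copresentation (ρ : RightCoaction k C M) where
  I₀ : Type u
  I₁ : Type u
  [grp₀ : AddCommGroup I₀]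
  [mod₀ : Module k I₀]
  [grp₁ : AddCommGroup I₁]
  [mod₁ : Module k I₁]
  ρ₀ : RightCoaction k C I₀
  ρ₁ : RightCoaction k C I₁
  d₀ : ρ.Hom ρ₀
  d₁ : ρ₀.Hom ρ₁

attribute [instance] Copresentation.grp₀ Copresentation.mod₀ Copresentation.grp₁
  Copresentation.mod₁

/-- A subspace `N` of a comodule is essential: it meets every nonzero subcomodule. -/
def RightCoaction.IsEssential (ρ : RightCoaction k C M) (N : Submodule k M) : Prop :=
  ∀ X : Submodule k M, ρ.IsSub X → X ≠ ⊥ → X ⊓ N ≠ ⊥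

/-- The finite-dimensional subcoalgebras containing the coefficient space of `M`, i.e. those over
which `M` is a comodule. They are ordered by inclusion. -/
abbrev RightCoaction.CoeffSubcoalgebra (ρ : RightCoaction k C M) : Type u :=
  {L : FDSubcoalgebra k C // ρ.coeffSpace ≤ L.toSubmodule}

namespace Copresentation

variable {ρ : RightCoaction k C M}

/-- `0 → M → I₀ → I₁` is exact, and `I₀`, `I₁` are quasifinite injective. -/
structure IsQuasifiniteInjective (P : Copresentation ρ) : Prop where
  inj : Function.Injective (P.d₀ : M →ₗ[k] P.I₀)
  exact : Function.Exact (P.d₀ : M →ₗ[k] P.I₀) (P.d₁ : P.I₀ →ₗ[k] P.I₁)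
  injective₀ : P.ρ₀.IsInjective
  injective₁ : P.ρ₁.IsInjective
  quasifinite₀ : P.ρ₀.IsQuasifinite
  quasifinite₁ : P.ρ₁.IsQuasifinite

/-- The images of `M → I₀` and of `I₀ → I₁` are essential. For an injective copresentation this
says that it is minimal. -/
def IsMinimal (P : Copresentation ρ) : Prop :=
  P.ρ₀.IsEssential (LinearMap.range (P.d₀ : M →ₗ[k] P.I₀)) ∧
    P.ρ₁.IsEssential (LinearMap.range (P.d₁ : P.I₀ →ₗ[k] P.I₁))

/-- The transpose computed from `0 → M → I₀ → I₁`: the kernel of `I₁^* → I₀^*`. -/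
noncomputable def transpose (P : Copresentation ρ) : Submodule k (Cohom P.ρ₁) :=
  LinearMap.ker (Cohom.map P.d₁)

/-- The left comodule structure on the transpose. -/
noncomputable def transposeCoaction (P : Copresentation ρ) : LeftCoaction k C P.transpose :=
  (Cohom.coaction P.ρ₁).sub _ (LeftCoaction.ker_isSub _ _ _ (Cohom.map_isHom P.d₁))

/-- The sequence `M → I₀ □ L → I₁ □ L` of right `L`-comodules. -/
noncomputable def restrict (P : Copresentation ρ) (L : FDSubcoalgebra k C)
    (h : ρ.coeffSpace ≤ L.toSubmodule) : Copresentation (ρ.restrict L h) where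
  I₀ := P.ρ₀.box L
  I₁ := P.ρ₁.box L
  ρ₀ := P.ρ₀.boxCoaction L
  ρ₁ := P.ρ₁.boxCoaction L
  d₀ := ⟨RightCoaction.toBox (σ := ρ.restrict L h)
    ⟨P.d₀, by rw [RightCoaction.restrict_push]; exact P.d₀.2⟩, RightCoaction.toBox_mem _⟩
  d₁ := ⟨RightCoaction.boxMap P.d₁ L, RightCoaction.boxMap_mem P.d₁ L⟩

end Copresentation

/-- `Y` with the maps `c i : X i → Y` is the direct limit of the direct system `(X, τ)` of left
`C`-comodules over a directed set `ι`, in the category of left `C`-comodules. -/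
structure IsComoduleDirectLimit {ι : Type u} [PartialOrder ι] (X : ι → Type u)
    [∀ i, AddCommGroup (X i)] [∀ i, Module k (X i)] (lam : ∀ i, LeftCoaction k C (X i))
    (τ : ∀ i j, i ≤ j → X i →ₗ[k] X j) {Y : Type u} [AddCommGroup Y] [Module k Y]
    (mu : LeftCoaction k C Y) (c : ∀ i, X i →ₗ[k] Y) : Prop where
  nonempty : Nonempty ι
  directed : ∀ i j : ι, ∃ l, i ≤ l ∧ j ≤ l
  trans_isHom : ∀ i j h, (lam i).IsHom (lam j) (τ i j h)
  trans_refl : ∀ i, τ i i le_rfl = LinearMap.id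
  trans_trans : ∀ i j l (h : i ≤ j) (h' : j ≤ l), τ j l h' ∘ₗ τ i j h = τ i l (h.trans h')
  cocone_isHom : ∀ i, (lam i).IsHom mu (c i)
  cocone_comp : ∀ i j h, c j ∘ₗ τ i j h = c i
  universal : ∀ (Z : Type u) [AddCommGroup Z] [Module k Z] (nu : LeftCoaction k C Z)
    (g : ∀ i, X i →ₗ[k] Z), (∀ i, (lam i).IsHom nu (g i)) →
    (∀ i j h, g j ∘ₗ τ i j h = g i) →
    ∃! u : Y →ₗ[k] Z, mu.IsHom nu u ∧ ∀ i, u ∘ₗ c i = g i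

end Transpose

/-!
For a subcoalgebra `L` of `C`, the map `I □ L → I`, `∑ x ⊗ l ↦ ∑ ε(l) x`, is injective, and its
image consists of the elements of `I` with coefficients in `L`. It is the counit of an adjunction
`Hom_L(Y, I □ L) ≃ Hom_C(Y, I)` (`RightCoaction.boxAdjunction`), so `- □ L` preserves injective and
quasifinite comodules, and the restricted copresentation is exact because `M` has coefficients in
`L`. Over the finite-dimensional coalgebra `L` the cohom space is a quotient of its last stage
`D Hom(L, -)`, hence finite-dimensional, and so is the transpose.

The comparison of transposes rests on the fact that, for `I` injective, the canonical map
`h_L(I □ L, L) → h_C(I, C)` is injective with image the elements with coefficients in `L`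
(`Cohom.compare_injective`, `Cohom.mem_range_compare_iff`). The adjunction identifies the source
with `D Hom_C(L, I)`, the stage `L` of the direct limit `h_C(I, C)`. The stages embed since maps
into `I` extend. If `φ ∈ D Hom(L', I)` has coefficients in `L`, then `φ` kills every `g ∘ hit a` with
a linear form `a` on `L'` vanishing on `L`. A retraction of the coaction `I → I ⊗ C` writes every
`f : L' → I` vanishing on `L` as a sum of such maps (`RightCoaction.IsInjective.mem_span_hitHom`),
so `φ` comes from `D Hom(L, I)`. Since these maps are natural in `I`, the transpose over `L` embeds
in the transpose with image the elements with coefficients in `L`, which is also the image of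
`L □ Tr M`. The transpose is the directed union of these images, and a directed union of injective
comodule maps is a direct limit.

For minimality, let `E ⊆ I₀` be the preimage of the elements of `I₁` with coefficients in `L`. It is
finite-dimensional, as an extension of a finite-dimensional space by `M`. The subcoalgebra
`L' = L + cf(E)` lies in the wedge `L ∧ L`, so a nonzero subcomodule `X` of `I₁` with coefficients in
`L'` contains nonzero elements with coefficients in `L`
(`RightCoaction.IsSub.inf_range_boxIncl_ne_bot`). These form a subcomodule, which meets the image of
`I₀`, that is, of `E`, and `E` has coefficients in `L'`.
-/

/-! ### Subspaces of tensor products -/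

section TensorSubspaces

variable {k V W : Type u} [Field k] [AddCommGroup V] [Module k V] [AddCommGroup W] [Module k W]

theorem mem_range_lTensor_subtype_iff_mkQ (N : Submodule k W) (t : V ⊗[k] W) :
    t ∈ LinearMap.range (N.subtype.lTensor V) ↔ N.mkQ.lTensor V t = 0 :=
  (Module.Flat.lTensor_exact V (LinearMap.exact_subtype_mkQ N) t).symm

theorem mem_range_rTensor_subtype_iff_mkQ (N : Submodule k V) (t : V ⊗[k] W) :
    t ∈ LinearMap.range (N.subtype.rTensor W) ↔ N.mkQ.rTensor W t = 0 :=
  (Module.Flat.rTensor_exact W (LinearMap.exact_subtype_mkQ N) t).symm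

theorem eq_zero_of_forall_lTensor_dual {t : V ⊗[k] W}
    (h : ∀ ψ : Module.Dual k W, TensorProduct.rid k V (ψ.lTensor V t) = 0) : t = 0 := by
  classical
  let b := Module.Basis.ofVectorSpace k W
  apply (TensorProduct.equivFinsuppOfBasisRight b (M := V)).injective
  rw [map_zero]
  ext i
  rw [Finsupp.zero_apply, ← h (b.coord i)]
  clear h
  induction t using TensorProduct.induction_on with
  | zero => simp
  | add x y hx hy => simp only [map_add, Finsupp.add_apply, hx, hy]
  | tmul x y => simp

/-- Membership in `N ⊗ W` is tested by the linear forms on `W`. -/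
theorem mem_range_rTensor_subtype_iff_dual (N : Submodule k V) (t : V ⊗[k] W) :
    t ∈ LinearMap.range (N.subtype.rTensor W) ↔
      ∀ ψ : Module.Dual k W, TensorProduct.rid k V (ψ.lTensor V t) ∈ N := by
  have e (ψ : Module.Dual k W) : (TensorProduct.rid k (V ⧸ N)).toLinearMap ∘ₗ ψ.lTensor (V ⧸ N) ∘ₗ
      N.mkQ.rTensor W = N.mkQ ∘ₗ (TensorProduct.rid k V).toLinearMap ∘ₗ ψ.lTensor V := by
    ext; simp
  have h (ψ : Module.Dual k W) : TensorProduct.rid k (V ⧸ N) (ψ.lTensor (V ⧸ N)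
      (N.mkQ.rTensor W t)) = N.mkQ (TensorProduct.rid k V (ψ.lTensor V t)) :=
    LinearMap.congr_fun (e ψ) t
  rw [mem_range_rTensor_subtype_iff_mkQ]
  constructor
  · intro h0 ψ
    rw [← Submodule.ker_mkQ N, LinearMap.mem_ker, ← h ψ, h0, map_zero, map_zero]
  · intro h0
    apply eq_zero_of_forall_lTensor_dual
    intro ψ
    rw [h ψ, Submodule.mkQ_apply, Submodule.Quotient.mk_eq_zero]
    exact h0 ψ

/-- A tensor in `W ⊗ V` whose image in `W ⊗ V'`, for `V` embedded in `V'`, lies in `N ⊗ V'`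
already lies in `N ⊗ V`. -/
theorem mem_range_rTensor_of_lTensor {V' : Type u} [AddCommGroup V'] [Module k V']
    {j : V →ₗ[k] V'} (hj : Function.Injective j) (N : Submodule k W) {t : W ⊗[k] V}
    (h : j.lTensor W t ∈ LinearMap.range (N.subtype.rTensor V')) :
    t ∈ LinearMap.range (N.subtype.rTensor V) := by
  rw [mem_range_rTensor_subtype_iff_mkQ] at h ⊢
  apply Module.Flat.lTensor_preserves_injective_linearMap (M := W ⧸ N) j hj
  rw [map_zero, ← h, ← LinearMap.comp_apply, ← LinearMap.comp_apply,
    LinearMap.lTensor_comp_rTensor, LinearMap.rTensor_comp_lTensor]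

end TensorSubspaces

/-! ### The cotensor product with a subcoalgebra -/

section Box

variable {k C : Type u} [Field k] [AddCommGroup C] [Module k C] [Coalgebra k C]

namespace RightCoaction

variable {I : Type u} [AddCommGroup I] [Module k I]

/-- The canonical map `I □ L → I`, `∑ x ⊗ l ↦ ∑ ε(l) x`. -/
noncomputable def boxIncl (ρ : RightCoaction k C I) (L : FDSubcoalgebra k C) : ρ.box L →ₗ[k] I :=
  (TensorProduct.rid k I).toLinearMap ∘ₗ
    (Coalgebra.counit (R := k) (A := L.toSubmodule)).lTensor I ∘ₗ (ρ.box L).subtype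

variable (ρ : RightCoaction k C I) (L : FDSubcoalgebra k C)

/-- The coaction inverts `I □ L → I` on its image. -/
theorem toLin_boxIncl (t : ρ.box L) :
    ρ.toLin (ρ.boxIncl L t) = L.toSubmodule.subtype.lTensor I (t : I ⊗[k] L.toSubmodule) := by
  obtain ⟨t, ht⟩ := t
  rw [mem_cotensor] at ht
  set ε : L.toSubmodule →ₗ[k] k := Coalgebra.counit with hε
  let q : C ⊗[k] L.toSubmodule →ₗ[k] C := (TensorProduct.rid k C).toLinearMap ∘ₗ ε.lTensor C
  have e1 : q.lTensor I ∘ₗ (TensorProduct.assoc k I C L.toSubmodule).toLinearMap ∘ₗ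
      ρ.toLin.rTensor L.toSubmodule =
      ρ.toLin ∘ₗ (TensorProduct.rid k I).toLinearMap ∘ₗ ε.lTensor I := by
    have : q.lTensor I ∘ₗ (TensorProduct.assoc k I C L.toSubmodule).toLinearMap =
        (TensorProduct.rid k (I ⊗[k] C)).toLinearMap ∘ₗ ε.lTensor (I ⊗[k] C) := by
      ext; simp [q]
    rw [← LinearMap.comp_assoc, this]
    ext; simp
  have e2 : q.lTensor I ∘ₗ L.leftCoaction.toLin.lTensor I = L.toSubmodule.subtype.lTensor I := by
    rw [← LinearMap.lTensor_comp]
    congr 1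
    have : q ∘ₗ L.toSubmodule.subtype.rTensor L.toSubmodule =
        L.toSubmodule.subtype ∘ₗ (TensorProduct.rid k _).toLinearMap ∘ₗ ε.lTensor _ := by
      ext; simp [q]
    change q ∘ₗ L.toSubmodule.subtype.rTensor L.toSubmodule ∘ₗ Coalgebra.comul = _
    rw [← LinearMap.comp_assoc, this]
    ext x
    simp [hε]
  have a1 := LinearMap.congr_fun e1 t
  have a2 := LinearMap.congr_fun e2 t
  simp only [LinearMap.comp_apply, LinearEquiv.coe_coe] at a1 a2
  rw [ht, a2] at a1
  exact a1.symm

theorem exists_boxIncl_eq {x : I} {t : I ⊗[k] L.toSubmodule}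
    (h : L.toSubmodule.subtype.lTensor I t = ρ.toLin x) :
    ∃ y, ρ.boxIncl L y = x := by
  have ht : t ∈ ρ.box L := by
    rw [mem_cotensor]
    apply Module.Flat.lTensor_preserves_injective_linearMap (M := I) _ (lTensor_inj L.toSubmodule C)
    set i := L.toSubmodule.subtype with hi
    have e1 : (i.lTensor C).lTensor I ∘ₗ (TensorProduct.assoc k I C _).toLinearMap ∘ₗ
        ρ.toLin.rTensor _ =
        (TensorProduct.assoc k I C C).toLinearMap ∘ₗ ρ.toLin.rTensor C ∘ₗ i.lTensor I := by
      have : (i.lTensor C).lTensor I ∘ₗ (TensorProduct.assoc k I C _).toLinearMap =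
          (TensorProduct.assoc k I C C).toLinearMap ∘ₗ i.lTensor (I ⊗[k] C) := by
        ext; rfl
      rw [← LinearMap.comp_assoc, this, LinearMap.comp_assoc, LinearMap.lTensor_comp_rTensor,
        LinearMap.rTensor_comp_lTensor]
    have e2 : (i.lTensor C).lTensor I ∘ₗ L.leftCoaction.toLin.lTensor I =
        (Coalgebra.comul (R := k) (A := C)).lTensor I ∘ₗ i.lTensor I := by
      rw [← LinearMap.lTensor_comp, ← LinearMap.lTensor_comp, ← L.incl_comul,
        ← LinearMap.lTensor_comp_rTensor]
      rfl
    have a1 := LinearMap.congr_fun e1 t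
    have a2 := LinearMap.congr_fun e2 t
    have a3 := LinearMap.congr_fun ρ.coassoc x
    simp only [LinearMap.comp_apply, LinearEquiv.coe_coe] at a1 a2 a3
    rw [a1, a2, h, a3]
  refine ⟨⟨t, ht⟩, ?_⟩
  have h1 := LinearMap.congr_fun ρ.counit x
  simp only [LinearMap.comp_apply, LinearEquiv.coe_coe, LinearMap.id_apply, ← h] at h1
  rw [← h1, ← LinearMap.comp_apply (LinearMap.lTensor _ _), ← LinearMap.lTensor_comp,
    ← L.counit_eq]
  rfl

theorem boxIncl_injective : Function.Injective (ρ.boxIncl L) := by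
  intro s t h
  apply Subtype.ext
  apply lTensor_inj L.toSubmodule I
  rw [← toLin_boxIncl, ← toLin_boxIncl, h]

theorem mem_range_boxIncl {x : I} : x ∈ LinearMap.range (ρ.boxIncl L) ↔
    ρ.toLin x ∈ LinearMap.range (L.toSubmodule.subtype.lTensor I) := by
  constructor
  · rintro ⟨t, rfl⟩
    exact ⟨t, (ρ.toLin_boxIncl L t).symm⟩
  · rintro ⟨t, ht⟩
    exact ρ.exists_boxIncl_eq L ht

variable {L}

theorem push_mem {X Y : Type u} [AddCommGroup X] [Module k X] [AddCommGroup Y] [Module k Y]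
    {σ : RightCoaction k L.toSubmodule X} {τ : RightCoaction k L.toSubmodule Y} {f : X →ₗ[k] Y}
    (hf : f ∈ σ.Hom τ) : f ∈ σ.push.Hom τ.push := by
  change f.rTensor _ ∘ₗ σ.toLin = τ.toLin ∘ₗ f at hf
  change f.rTensor C ∘ₗ L.toSubmodule.subtype.lTensor X ∘ₗ σ.toLin =
    (L.toSubmodule.subtype.lTensor Y ∘ₗ τ.toLin) ∘ₗ f
  rw [LinearMap.comp_assoc, ← hf, ← LinearMap.comp_assoc, ← LinearMap.comp_assoc,
    LinearMap.rTensor_comp_lTensor, LinearMap.lTensor_comp_rTensor]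

variable (L)

theorem boxIncl_mem : ρ.boxIncl L ∈ (ρ.boxCoaction L).push.Hom ρ := by
  change LinearMap.rTensor C _ ∘ₗ (L.toSubmodule.subtype.lTensor _ ∘ₗ _) = _
  set i := L.toSubmodule.subtype with hi
  set ε : L.toSubmodule →ₗ[k] k := Coalgebra.counit with hε
  have s := RightCoaction.sub_spec ((RightCoaction.regular k L.toSubmodule).tensor I) _
    (cotensor_isSub_right ρ L.leftCoaction _ L.bicomodule_right)
  have e1 : (ρ.boxIncl L).rTensor C ∘ₗ i.lTensor _ =
      TensorProduct.map ((TensorProduct.rid k I).toLinearMap ∘ₗ ε.lTensor I) i ∘ₗ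
        (ρ.box L).subtype.rTensor L.toSubmodule := by
    rw [LinearMap.rTensor_comp_lTensor, LinearMap.map_comp_rTensor]
    rfl
  have e2 : TensorProduct.map ((TensorProduct.rid k I).toLinearMap ∘ₗ ε.lTensor I) i ∘ₗ
      ((RightCoaction.regular k L.toSubmodule).tensor I).toLin = i.lTensor I := by
    have : TensorProduct.map ((TensorProduct.rid k I).toLinearMap ∘ₗ ε.lTensor I) i ∘ₗ
        (TensorProduct.assoc k I L.toSubmodule L.toSubmodule).symm.toLinearMap =
        (i ∘ₗ (TensorProduct.lid k _).toLinearMap ∘ₗ ε.rTensor _).lTensor I := by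
      apply TensorProduct.ext
      ext
      simp [TensorProduct.smul_tmul]
    change _ ∘ₗ _ ∘ₗ LinearMap.lTensor I Coalgebra.comul = _
    rw [← LinearMap.comp_assoc, this, ← LinearMap.lTensor_comp]
    congr 1
    ext x
    simp [hε]
  apply LinearMap.ext
  intro t
  have a0 := LinearMap.congr_fun s t
  have a1 := LinearMap.congr_fun e1 ((ρ.boxCoaction L).toLin t)
  have a2 := LinearMap.congr_fun e2 (t : I ⊗[k] L.toSubmodule)
  simp only [LinearMap.comp_apply] at *
  rw [toLin_boxIncl, a1, ← a2]
  exact congrArg _ a0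

variable {ρ L}

theorem boxIncl_comp_mem {Y : Type u} [AddCommGroup Y] [Module k Y]
    {σ : RightCoaction k L.toSubmodule Y} {f : Y →ₗ[k] ρ.box L} (hf : f ∈ σ.Hom (ρ.boxCoaction L)) :
    ρ.boxIncl L ∘ₗ f ∈ σ.push.Hom ρ :=
  comp_mem (ρ.boxIncl_mem L) (push_mem hf)

theorem boxIncl_comp_toBox {Y : Type u} [AddCommGroup Y] [Module k Y]
    {σ : RightCoaction k L.toSubmodule Y} (g : σ.push.Hom ρ) :
    ρ.boxIncl L ∘ₗ toBox g = g := by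
  have e : (TensorProduct.rid k I).toLinearMap ∘ₗ
      (Coalgebra.counit (R := k) (A := L.toSubmodule)).lTensor I ∘ₗ
      (g : Y →ₗ[k] I).rTensor L.toSubmodule = (g : Y →ₗ[k] I) ∘ₗ (TensorProduct.rid k Y).toLinearMap ∘ₗ
      (Coalgebra.counit (R := k) (A := L.toSubmodule)).lTensor Y := by
    ext; simp
  ext y
  have a1 := LinearMap.congr_fun e (σ.toLin y)
  have a2 := LinearMap.congr_fun σ.counit y
  simp only [LinearMap.comp_apply, LinearMap.id_apply] at a1 a2
  rw [a2] at a1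
  exact a1

theorem boxIncl_comp_boxMap {J : Type u} [AddCommGroup J] [Module k J] {σ : RightCoaction k C J}
    (f : ρ.Hom σ) : σ.boxIncl L ∘ₗ boxMap f L = (f : I →ₗ[k] J) ∘ₗ ρ.boxIncl L := by
  have e : (TensorProduct.rid k J).toLinearMap ∘ₗ
      (Coalgebra.counit (R := k) (A := L.toSubmodule)).lTensor J ∘ₗ
      (f : I →ₗ[k] J).rTensor L.toSubmodule = (f : I →ₗ[k] J) ∘ₗ (TensorProduct.rid k I).toLinearMap ∘ₗ
      (Coalgebra.counit (R := k) (A := L.toSubmodule)).lTensor I := by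
    ext; simp
  ext t
  exact LinearMap.congr_fun e (t : I ⊗[k] L.toSubmodule)

/-- The adjunction `Hom_L(Y, I □ L) ≃ Hom_C(Y, I)` between corestriction and `- □ L`. -/
noncomputable def boxAdjunction {Y : Type u} [AddCommGroup Y] [Module k Y]
    (σ : RightCoaction k L.toSubmodule Y) (ρ : RightCoaction k C I) :
    σ.Hom (ρ.boxCoaction L) ≃ₗ[k] σ.push.Hom ρ where
  toFun f := ⟨ρ.boxIncl L ∘ₗ f, boxIncl_comp_mem f.2⟩
  map_add' f g := by ext; simp
  map_smul' c f := by ext; simp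
  invFun g := ⟨toBox g, toBox_mem g⟩
  left_inv f := by
    apply Subtype.ext
    rw [← LinearMap.cancel_left (ρ.boxIncl_injective L), boxIncl_comp_toBox]
  right_inv g := Subtype.ext (boxIncl_comp_toBox g)

theorem IsInjective.boxCoaction (h : ρ.IsInjective) : (ρ.boxCoaction L).IsInjective := by
  intro X Y _ _ _ _ σ τ i f hi
  obtain ⟨g, hg⟩ := h X Y σ.push τ.push ⟨i, push_mem i.2⟩ (boxAdjunction σ ρ f) hi
  refine ⟨⟨toBox g, toBox_mem g⟩, ?_⟩
  rw [← LinearMap.cancel_left (ρ.boxIncl_injective L), ← LinearMap.comp_assoc, boxIncl_comp_toBox]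
  exact hg

theorem IsQuasifinite.boxCoaction (h : ρ.IsQuasifinite) : (ρ.boxCoaction L).IsQuasifinite := by
  intro F _ _ _ σ
  have := h F σ.push
  exact Module.Finite.equiv (boxAdjunction σ ρ).symm

end RightCoaction

namespace LeftCoaction

variable {N : Type u} [AddCommGroup N] [Module k N] (lam : LeftCoaction k C N)
  (L : FDSubcoalgebra k C)

/-- The coaction inverts `L □ N → N` on its image. -/
theorem toLin_boxIncl (t : lam.box L) :
    lam.toLin (lam.boxIncl L t) = L.toSubmodule.subtype.rTensor N (t : L.toSubmodule ⊗[k] N) := by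
  obtain ⟨t, ht⟩ := t
  rw [mem_cotensor] at ht
  set ε : L.toSubmodule →ₗ[k] k := Coalgebra.counit with hε
  let q : L.toSubmodule ⊗[k] (C ⊗[k] N) →ₗ[k] C ⊗[k] N :=
    (TensorProduct.lid k _).toLinearMap ∘ₗ ε.rTensor _
  have e1 : q ∘ₗ lam.toLin.lTensor L.toSubmodule =
      lam.toLin ∘ₗ (TensorProduct.lid k N).toLinearMap ∘ₗ ε.rTensor N := by
    ext; simp [q]
  have e2 : q ∘ₗ (TensorProduct.assoc k L.toSubmodule C N).toLinearMap ∘ₗ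
      L.rightCoaction.toLin.rTensor N = L.toSubmodule.subtype.rTensor N := by
    have h1 : q ∘ₗ (TensorProduct.assoc k L.toSubmodule C N).toLinearMap =
        ((TensorProduct.lid k C).toLinearMap ∘ₗ ε.rTensor C).rTensor N := by
      ext; simp [q, TensorProduct.smul_tmul']
    rw [← LinearMap.comp_assoc, h1, ← LinearMap.rTensor_comp]
    congr 1
    have h2 : ((TensorProduct.lid k C).toLinearMap ∘ₗ ε.rTensor C) ∘ₗ
        L.toSubmodule.subtype.lTensor L.toSubmodule =
        L.toSubmodule.subtype ∘ₗ (TensorProduct.lid k _).toLinearMap ∘ₗ ε.rTensor _ := by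
      ext; simp
    change _ ∘ₗ L.toSubmodule.subtype.lTensor L.toSubmodule ∘ₗ Coalgebra.comul = _
    rw [← LinearMap.comp_assoc, h2]
    ext x
    simp [hε]
  have a1 := LinearMap.congr_fun e1 t
  have a2 := LinearMap.congr_fun e2 t
  simp only [LinearMap.comp_apply, LinearEquiv.coe_coe] at a1 a2
  rw [← ht, a2] at a1
  exact a1.symm

theorem exists_boxIncl_eq {x : N} {t : L.toSubmodule ⊗[k] N}
    (h : L.toSubmodule.subtype.rTensor N t = lam.toLin x) :
    ∃ y, lam.boxIncl L y = x := by
  have ht : t ∈ lam.box L := by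
    rw [mem_cotensor]
    apply rTensor_inj L.toSubmodule (C ⊗[k] N)
    set i := L.toSubmodule.subtype with hi
    have e1 : i.rTensor (C ⊗[k] N) ∘ₗ (TensorProduct.assoc k _ C N).toLinearMap ∘ₗ
        L.rightCoaction.toLin.rTensor N =
        (TensorProduct.assoc k C C N).toLinearMap ∘ₗ
          (Coalgebra.comul (R := k) (A := C)).rTensor N ∘ₗ i.rTensor N := by
      have : i.rTensor (C ⊗[k] N) ∘ₗ (TensorProduct.assoc k _ C N).toLinearMap =
          (TensorProduct.assoc k C C N).toLinearMap ∘ₗ (i.rTensor C).rTensor N := by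
        ext; rfl
      rw [← LinearMap.comp_assoc, this, LinearMap.comp_assoc, ← LinearMap.rTensor_comp,
        ← LinearMap.rTensor_comp, L.rightCoaction_spec]
    have e2 : i.rTensor (C ⊗[k] N) ∘ₗ lam.toLin.lTensor L.toSubmodule =
        lam.toLin.lTensor C ∘ₗ i.rTensor N := by
      rw [LinearMap.lTensor_comp_rTensor, LinearMap.rTensor_comp_lTensor]
    have a1 := LinearMap.congr_fun e1 t
    have a2 := LinearMap.congr_fun e2 t
    have a3 := LinearMap.congr_fun lam.coassoc x
    simp only [LinearMap.comp_apply, LinearEquiv.coe_coe] at a1 a2 a3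
    rw [a1, a2, h, a3]
  refine ⟨⟨t, ht⟩, ?_⟩
  have h1 := LinearMap.congr_fun lam.counit x
  simp only [LinearMap.comp_apply, LinearEquiv.coe_coe, LinearMap.id_apply, ← h] at h1
  rw [← h1, ← LinearMap.comp_apply (LinearMap.rTensor _ _), ← LinearMap.rTensor_comp,
    ← L.counit_eq]
  rfl

theorem boxIncl_injective : Function.Injective (lam.boxIncl L) := by
  intro s t h
  apply Subtype.ext
  apply rTensor_inj L.toSubmodule N
  rw [← toLin_boxIncl, ← toLin_boxIncl, h]

theorem mem_range_boxIncl {x : N} : x ∈ LinearMap.range (lam.boxIncl L) ↔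
    lam.toLin x ∈ LinearMap.range (L.toSubmodule.subtype.rTensor N) := by
  constructor
  · rintro ⟨t, rfl⟩
    exact ⟨t, (lam.toLin_boxIncl L t).symm⟩
  · rintro ⟨t, ht⟩
    exact lam.exists_boxIncl_eq L ht

theorem boxIncl_isHom : (lam.boxCoaction L).push.IsHom lam (lam.boxIncl L) := by
  change LinearMap.lTensor C _ ∘ₗ (L.toSubmodule.subtype.rTensor _ ∘ₗ _) = _
  set i := L.toSubmodule.subtype with hi
  set ε : L.toSubmodule →ₗ[k] k := Coalgebra.counit with hε
  have s := LeftCoaction.sub_spec ((LeftCoaction.regular k L.toSubmodule).tensor N) _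
    (cotensor_isSub_left L.rightCoaction lam _ L.bicomodule_left)
  have e1 : (lam.boxIncl L).lTensor C ∘ₗ i.rTensor _ =
      TensorProduct.map i ((TensorProduct.lid k N).toLinearMap ∘ₗ ε.rTensor N) ∘ₗ
        (lam.box L).subtype.lTensor L.toSubmodule := by
    rw [LinearMap.lTensor_comp_rTensor, LinearMap.map_comp_lTensor]
    rfl
  have e2 : TensorProduct.map i ((TensorProduct.lid k N).toLinearMap ∘ₗ ε.rTensor N) ∘ₗ
      ((LeftCoaction.regular k L.toSubmodule).tensor N).toLin = i.rTensor N := by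
    have : TensorProduct.map i ((TensorProduct.lid k N).toLinearMap ∘ₗ ε.rTensor N) ∘ₗ
        (TensorProduct.assoc k L.toSubmodule L.toSubmodule N).toLinearMap =
        (i ∘ₗ (TensorProduct.rid k _).toLinearMap ∘ₗ ε.lTensor _).rTensor N := by
      ext
      simp [TensorProduct.smul_tmul]
    change _ ∘ₗ _ ∘ₗ LinearMap.rTensor N Coalgebra.comul = _
    rw [← LinearMap.comp_assoc, this, ← LinearMap.rTensor_comp]
    congr 1
    ext x
    simp [hε]
  apply LinearMap.ext
  intro t
  have a0 := LinearMap.congr_fun s t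
  have a1 := LinearMap.congr_fun e1 ((lam.boxCoaction L).toLin t)
  have a2 := LinearMap.congr_fun e2 (t : L.toSubmodule ⊗[k] N)
  simp only [LinearMap.comp_apply] at *
  rw [toLin_boxIncl, a1, ← a2]
  exact congrArg _ a0

variable {L}

/-- A linear map of comodules over a subcoalgebra `L` is a map of `L`-comodules if it is one of
`C`-comodules. -/
theorem isHom_of_push {X Y : Type u} [AddCommGroup X] [Module k X] [AddCommGroup Y] [Module k Y]
    {σ : LeftCoaction k L.toSubmodule X} {τ : LeftCoaction k L.toSubmodule Y} {f : X →ₗ[k] Y}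
    (hf : σ.push.IsHom τ.push f) : σ.IsHom τ f := by
  change f.lTensor C ∘ₗ L.toSubmodule.subtype.rTensor X ∘ₗ σ.toLin =
    (L.toSubmodule.subtype.rTensor Y ∘ₗ τ.toLin) ∘ₗ f at hf
  change f.lTensor _ ∘ₗ σ.toLin = τ.toLin ∘ₗ f
  rw [← LinearMap.cancel_left (rTensor_inj L.toSubmodule Y), ← LinearMap.comp_assoc,
    ← LinearMap.comp_assoc, ← hf, ← LinearMap.comp_assoc, LinearMap.rTensor_comp_lTensor,
    LinearMap.lTensor_comp_rTensor]

theorem IsHom.comp {X Y Z : Type u} [AddCommGroup X] [Module k X] [AddCommGroup Y] [Module k Y]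
    [AddCommGroup Z] [Module k Z] {σ : LeftCoaction k C X} {τ : LeftCoaction k C Y}
    {ω : LeftCoaction k C Z} {f : X →ₗ[k] Y} {g : Y →ₗ[k] Z} (hg : τ.IsHom ω g)
    (hf : σ.IsHom τ f) : σ.IsHom ω (g ∘ₗ f) := by
  change g.lTensor C ∘ₗ τ.toLin = ω.toLin ∘ₗ g at hg
  change f.lTensor C ∘ₗ σ.toLin = τ.toLin ∘ₗ f at hf
  change (g ∘ₗ f).lTensor C ∘ₗ σ.toLin = ω.toLin ∘ₗ g ∘ₗ f
  rw [LinearMap.lTensor_comp, LinearMap.comp_assoc, hf, ← LinearMap.comp_assoc, hg,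
    LinearMap.comp_assoc]

theorem IsHom.of_comp {X Y Z : Type u} [AddCommGroup X] [Module k X] [AddCommGroup Y] [Module k Y]
    [AddCommGroup Z] [Module k Z] {σ : LeftCoaction k C X} {τ : LeftCoaction k C Y}
    {ω : LeftCoaction k C Z} {f : X →ₗ[k] Y} {g : Y →ₗ[k] Z} (hg : τ.IsHom ω g)
    (hinj : Function.Injective g) (hgf : σ.IsHom ω (g ∘ₗ f)) : σ.IsHom τ f := by
  change g.lTensor C ∘ₗ τ.toLin = ω.toLin ∘ₗ g at hg
  change f.lTensor C ∘ₗ σ.toLin = τ.toLin ∘ₗ f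
  change (g ∘ₗ f).lTensor C ∘ₗ σ.toLin = ω.toLin ∘ₗ g ∘ₗ f at hgf
  rw [← LinearMap.cancel_left (Module.Flat.lTensor_preserves_injective_linearMap (M := C) g hinj),
    ← LinearMap.comp_assoc, ← LinearMap.comp_assoc, ← LinearMap.lTensor_comp, hgf, hg,
    LinearMap.comp_assoc]

end LeftCoaction

end Box

/-! ### Cohomomorphism spaces of injective comodules -/

section CohomInjective

variable {k C : Type u} [Field k] [AddCommGroup C] [Module k C] [Coalgebra k C]

namespace FDSubcoalgebra

/-- The sum of two finite-dimensional subcoalgebras. -/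
noncomputable def sup (L L' : FDSubcoalgebra k C) : FDSubcoalgebra k C where
  toSubmodule := L.toSubmodule ⊔ L'.toSubmodule
  finite := inferInstance
  comul_mem := by
    intro x hx
    have mono (N N' : Submodule k C) (h : N ≤ N') :
        LinearMap.range (TensorProduct.map N.subtype N.subtype) ≤
          LinearMap.range (TensorProduct.map N'.subtype N'.subtype) := by
      rintro _ ⟨t, rfl⟩
      refine ⟨TensorProduct.map (Submodule.inclusion h) (Submodule.inclusion h) t, ?_⟩
      rw [← LinearMap.comp_apply, ← TensorProduct.map_comp]
      rfl
    obtain ⟨y, hy, z, hz, rfl⟩ := Submodule.mem_sup.1 hx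
    rw [map_add]
    exact add_mem (mono _ _ le_sup_left (L.comul_mem y hy))
      (mono _ _ le_sup_right (L'.comul_mem z hz))

instance : IsDirectedOrder (FDSubcoalgebra k C) where
  directed L L' := ⟨L.sup L', (le_sup_left : L.toSubmodule ≤ _), (le_sup_right : L'.toSubmodule ≤ _)⟩

instance : Nonempty (FDSubcoalgebra k C) :=
  ⟨⟨⊥, inferInstance, by
    intro x hx
    rw [(Submodule.mem_bot k).1 hx, map_zero]
    exact zero_mem _⟩⟩

instance {M : Type u} [AddCommGroup M] [Module k M] (ρ : RightCoaction k C M) :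
    DirectedSystem (fun L : FDSubcoalgebra k C => L.stage ρ) (fun L L' h => trans ρ L L' h) where
  map_self _ _ := rfl
  map_map _ _ _ _ _ _ := rfl

end FDSubcoalgebra

namespace RightCoaction

variable {I : Type u} [AddCommGroup I] [Module k I] {ρ : RightCoaction k C I}

/-- An injective comodule is a retract of the cofree comodule `I ⊗ C` through its coaction. -/
theorem IsInjective.exists_retraction (h : ρ.IsInjective) :
    ∃ r : ((regular k C).tensor I).Hom ρ, (r : I ⊗[k] C →ₗ[k] I) ∘ₗ ρ.toLin = LinearMap.id := by
  refine h I (I ⊗[k] C) ρ ((regular k C).tensor I) ⟨ρ.toLin, ?_⟩ ⟨LinearMap.id, ?_⟩ ?_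
  · change ρ.toLin.rTensor C ∘ₗ ρ.toLin =
      ((TensorProduct.assoc k I C C).symm.toLinearMap ∘ₗ Coalgebra.comul.lTensor I) ∘ₗ ρ.toLin
    rw [LinearMap.comp_assoc, ← ρ.coassoc]
    ext x
    simp
  · change LinearMap.rTensor C _ ∘ₗ _ = _
    rw [LinearMap.rTensor_id]
    rfl
  · intro x y hxy
    have hx := LinearMap.congr_fun ρ.counit x
    have hy := LinearMap.congr_fun ρ.counit y
    simp only [LinearMap.comp_apply, LinearMap.id_apply] at hx hy
    change ρ.toLin x = ρ.toLin y at hxy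
    rw [← hx, hxy, hy]

/-- For a comodule map `r : I ⊗ C → I` and `e ∈ I`, the comodule map `L → I`, `y ↦ r(e ⊗ y)`. -/
noncomputable def sliceHom (r : ((regular k C).tensor I).Hom ρ) (L : FDSubcoalgebra k C) (e : I) :
    L.rightCoaction.Hom ρ :=
  ⟨(r : I ⊗[k] C →ₗ[k] I) ∘ₗ TensorProduct.mk k I C e ∘ₗ L.toSubmodule.subtype, by
    refine comp_mem r.2 (comp_mem (σ := regular k C) ?_ ?_)
    · change (TensorProduct.mk k I C e).rTensor C ∘ₗ Coalgebra.comul =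
        ((TensorProduct.assoc k I C C).symm.toLinearMap ∘ₗ Coalgebra.comul.lTensor I) ∘ₗ _
      have : (TensorProduct.mk k I C e).rTensor C =
          (TensorProduct.assoc k I C C).symm.toLinearMap ∘ₗ TensorProduct.mk k I (C ⊗[k] C) e := by
        ext; simp
      rw [this]
      ext x
      simp
    · exact L.rightCoaction_spec⟩

@[simp]
theorem sliceHom_apply (r : ((regular k C).tensor I).Hom ρ) (L : FDSubcoalgebra k C) (e : I)
    (y : L.toSubmodule) :
    (sliceHom r L e : L.toSubmodule →ₗ[k] I) y = (r : I ⊗[k] C →ₗ[k] I) (e ⊗ₜ (y : C)) := rfl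

/-- A comodule map `f : L' → I` into an injective comodule that vanishes on `L` is a sum of maps
`g ∘ hit a` with linear forms `a` vanishing on `L`: with a retraction `r : I ⊗ C → I`, write
`f x = r (∑ f(x₁) ⊗ x₂)` and expand `f` in a basis of `L' / L`. -/
theorem IsInjective.mem_span_hitHom (h : ρ.IsInjective) {L L' : FDSubcoalgebra k C} (hL : L ≤ L')
    (f : L'.rightCoaction.Hom ρ) (hf : precomp (FDSubcoalgebra.incl hL) ρ f = 0) :
    f ∈ Submodule.span k {f' | ∃ (a : Module.Dual k L'.toSubmodule) (g : L'.rightCoaction.Hom ρ),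
      a ∘ₗ (FDSubcoalgebra.incl hL : L.toSubmodule →ₗ[k] L'.toSubmodule) = 0 ∧
        f' = L'.hitHom ρ a g} := by
  obtain ⟨r, hr⟩ := h.exists_retraction
  let N : Submodule k L'.toSubmodule :=
    LinearMap.range (FDSubcoalgebra.incl hL : L.toSubmodule →ₗ[k] L'.toSubmodule)
  have hN : N ≤ LinearMap.ker (f : L'.toSubmodule →ₗ[k] I) := by
    rintro _ ⟨x, rfl⟩
    exact LinearMap.congr_fun (congrArg Subtype.val hf) x
  let fbar : (L'.toSubmodule ⧸ N) →ₗ[k] I := N.liftQ f hN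
  let b := Module.finBasis k (L'.toSubmodule ⧸ N)
  let a i : Module.Dual k L'.toSubmodule := b.coord i ∘ₗ N.mkQ
  have hexp (x : L'.toSubmodule) : (f : L'.toSubmodule →ₗ[k] I) x = ∑ i, a i x • fbar (b i) := by
    have : (f : L'.toSubmodule →ₗ[k] I) x = fbar (N.mkQ x) := rfl
    rw [this, ← b.sum_repr (N.mkQ x), map_sum]
    simp [a]
  have htens (t : L'.toSubmodule ⊗[k] L'.toSubmodule) :
      TensorProduct.map (f : L'.toSubmodule →ₗ[k] I) L'.toSubmodule.subtype t =
        ∑ i, fbar (b i) ⊗ₜ[k] ((TensorProduct.lid k _ ((a i).rTensor _ t) : L'.toSubmodule) : C) := by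
    induction t using TensorProduct.induction_on with
    | zero => simp
    | add x y hx hy =>
      simp only [map_add, hx, hy, Submodule.coe_add, TensorProduct.tmul_add,
        Finset.sum_add_distrib]
    | tmul x y =>
      simp only [TensorProduct.map_tmul, hexp, TensorProduct.sum_tmul, LinearMap.rTensor_tmul,
        TensorProduct.lid_tmul, Submodule.coe_smul, TensorProduct.smul_tmul, Submodule.subtype_apply]
  have hsum : f = ∑ i, L'.hitHom ρ (a i) (sliceHom r L' (fbar (b i))) := by
    apply Subtype.ext
    apply LinearMap.ext
    intro x
    have h1 := LinearMap.congr_fun hr ((f : L'.toSubmodule →ₗ[k] I) x)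
    have h2 : (f : L'.toSubmodule →ₗ[k] I).rTensor C ∘ₗ
      (L'.toSubmodule.subtype.lTensor _ ∘ₗ Coalgebra.comul) = ρ.toLin ∘ₗ f := f.2
    have h3 := LinearMap.congr_fun h2 x
    rw [← LinearMap.comp_assoc, LinearMap.rTensor_comp_lTensor] at h3
    simp only [LinearMap.comp_apply, LinearMap.id_apply] at h1 h3
    rw [← h1, ← h3, htens, map_sum]
    simp only [AddSubmonoidClass.coe_finsetSum, LinearMap.coe_sum, Finset.sum_apply]
    rfl
  rw [hsum]
  refine Submodule.sum_mem _ fun i _ => Submodule.subset_span ⟨a i, _, ?_, rfl⟩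
  ext x
  have : N.mkQ ((FDSubcoalgebra.incl hL : L.toSubmodule →ₗ[k] L'.toSubmodule) x) = 0 :=
    (Submodule.Quotient.mk_eq_zero N).2 ⟨x, rfl⟩
  change b.coord i (N.mkQ _) = 0
  rw [this, map_zero]

/-- The elements of a quasifinite injective comodule with coefficients in `L` form a
finite-dimensional space: with a retraction `r : I ⊗ C → I`, such an `x` equals
`r(∑ x₀ ⊗ x₁)`, a value of the finite-dimensional space of comodule maps `L → I`. -/
theorem IsQuasifinite.finite_range_boxIncl (hq : ρ.IsQuasifinite) (h : ρ.IsInjective)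
    (L : FDSubcoalgebra k C) : FiniteDimensional k (LinearMap.range (ρ.boxIncl L)) := by
  obtain ⟨r, hr⟩ := h.exists_retraction
  have := hq L.toSubmodule L.rightCoaction
  let ev : (L.rightCoaction.Hom ρ) ⊗[k] L.toSubmodule →ₗ[k] I :=
    TensorProduct.lift (L.rightCoaction.Hom ρ).subtype
  refine Submodule.finiteDimensional_of_le (S₂ := LinearMap.range ev) ?_
  intro x hx
  obtain ⟨t, ht⟩ := (ρ.mem_range_boxIncl L).1 hx
  have h1 := LinearMap.congr_fun hr x
  simp only [LinearMap.comp_apply, LinearMap.id_apply] at h1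
  rw [← h1, ← ht]
  clear h1 ht
  induction t using TensorProduct.induction_on with
  | zero => simp
  | add x y hx hy => rw [map_add, map_add]; exact add_mem hx hy
  | tmul e y => exact ⟨sliceHom r L e ⊗ₜ y, by simp [ev]⟩

end RightCoaction

namespace Cohom

variable {I : Type u} [AddCommGroup I] [Module k I] {ρ : RightCoaction k C I}

theorem exists_of (c : Cohom ρ) : ∃ L φ, of ρ L φ = c :=
  Module.DirectLimit.exists_of c

/-- The stages of `I^*` embed for an injective comodule `I`: maps `L → I` extend to `L'`, so the
restriction maps `Hom(L', I) → Hom(L, I)` are surjective. -/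
theorem of_injective (h : ρ.IsInjective) (L : FDSubcoalgebra k C) :
    Function.Injective (of ρ L) := by
  rw [injective_iff_map_eq_zero]
  intro φ hφ
  obtain ⟨L', hL, h0⟩ := Module.DirectLimit.of.zero_exact hφ
  have hinj : Function.Injective (FDSubcoalgebra.trans ρ L L' hL) := by
    apply LinearMap.dualMap_injective_of_surjective
    intro f
    obtain ⟨g, hg⟩ := h _ _ L.rightCoaction L'.rightCoaction (FDSubcoalgebra.incl hL) f
      (Submodule.inclusion_injective (show L.toSubmodule ≤ L'.toSubmodule from hL))
    exact ⟨g, Subtype.ext hg⟩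
  exact hinj (h0.trans (map_zero _).symm)

theorem of_isHom (L : FDSubcoalgebra k C) :
    (L.stageCoaction ρ).push.IsHom (coaction ρ) (of ρ L) :=
  (coactionMap_of ρ L).symm

/-- For an injective comodule `I`, the stage `D Hom(L, I)` of `I^*` consists of the elements with
coefficients in `L`. -/
theorem mem_range_of_iff (h : ρ.IsInjective) (L : FDSubcoalgebra k C) (c : Cohom ρ) :
    c ∈ LinearMap.range (of ρ L) ↔
      (coaction ρ).toLin c ∈ LinearMap.range (L.toSubmodule.subtype.rTensor (Cohom ρ)) := by
  constructor
  · rintro ⟨φ, rfl⟩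
    refine ⟨(of ρ L).lTensor _ (L.stageMap ρ φ), ?_⟩
    have := LinearMap.congr_fun (of_isHom (ρ := ρ) L) φ
    simp only [LinearMap.comp_apply] at this
    rw [← this, ← LinearMap.comp_apply, LinearMap.rTensor_comp_lTensor,
      ← LinearMap.lTensor_comp_rTensor]
    rfl
  · rintro ⟨s, hs⟩
    obtain ⟨L₀, φ₀, rfl⟩ := exists_of c
    obtain ⟨L', hL₀, hL⟩ := exists_ge_ge L₀ L
    set φ := FDSubcoalgebra.trans ρ L₀ L' hL₀ φ₀ with hφ
    have hof : of ρ L₀ φ₀ = of ρ L' φ := (LinearMap.congr_fun (of_trans ρ L₀ L' hL₀) φ₀).symm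
    rw [hof] at hs ⊢
    -- a linear form on `L'` vanishing on `L` extends to `C`, so it kills the `L'`-coaction of `φ`
    have key (a : Module.Dual k L'.toSubmodule)
        (ha : a ∘ₗ (FDSubcoalgebra.incl hL : L.toSubmodule →ₗ[k] L'.toSubmodule) = 0) :
        φ ∘ₗ L'.hitHom ρ a = 0 := by
      obtain ⟨A, hA⟩ := LinearMap.exists_extend (p := L'.toSubmodule) a
      have hAL : A ∘ₗ L.toSubmodule.subtype = 0 := by
        rw [← ha, ← hA]; rfl
      apply of_injective h L'
      rw [map_zero, ← FDSubcoalgebra.stageMap_apply, ← FDSubcoalgebra.ev_lTensor, ← hA]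
      have h1 := LinearMap.congr_fun (of_isHom (ρ := ρ) L') φ
      have h2 : A.rTensor (Cohom ρ) ((coaction ρ).toLin (of ρ L' φ)) = 0 := by
        rw [← hs, ← LinearMap.comp_apply, ← LinearMap.rTensor_comp, hAL]
        simp
      have h3 : A.rTensor (Cohom ρ) ((of ρ L').lTensor C
          (L'.toSubmodule.subtype.rTensor _ (L'.stageMap ρ φ))) = 0 := by
        rw [← h2]; exact congrArg _ h1
      have h4 : (of ρ L').lTensor C (L'.toSubmodule.subtype.rTensor _ (L'.stageMap ρ φ)) =
          L'.toSubmodule.subtype.rTensor _ ((of ρ L').lTensor _ (L'.stageMap ρ φ)) := by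
        rw [← LinearMap.comp_apply, LinearMap.lTensor_comp_rTensor,
          ← LinearMap.rTensor_comp_lTensor]
        rfl
      rw [h4] at h3
      rw [LinearMap.rTensor_comp, LinearMap.comp_apply, h3, map_zero]
    have hker : φ ∈ LinearMap.range (FDSubcoalgebra.trans ρ L L' hL) := by
      unfold FDSubcoalgebra.trans
      rw [LinearMap.range_dualMap_eq_dualAnnihilator_ker, Submodule.mem_dualAnnihilator]
      intro f hf
      have hspan := h.mem_span_hitHom hL f hf
      refine (Submodule.span_le (p := LinearMap.ker φ)).2 ?_ hspan
      rintro _ ⟨a, g, ha, rfl⟩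
      exact LinearMap.congr_fun (key a ha) g
    obtain ⟨ψ, hψ⟩ := hker
    exact ⟨ψ, by rw [← hψ]; exact (LinearMap.congr_fun (of_trans ρ L L' hL) ψ).symm⟩

end Cohom

end CohomInjective

/-! ### The comparison map of cohomomorphism spaces -/

section CompareInjective

variable {k C : Type u} [Field k] [AddCommGroup C] [Module k C] [Coalgebra k C]

namespace FDSubcoalgebra

/-- `L` as a subcoalgebra of itself. -/
def top (L : FDSubcoalgebra k C) : FDSubcoalgebra k L.toSubmodule where
  toSubmodule := ⊤
  finite := inferInstance
  comul_mem := by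
    intro x _
    have hs : Function.Surjective (⊤ : Submodule k L.toSubmodule).subtype :=
      fun y => ⟨⟨y, trivial⟩, rfl⟩
    exact TensorProduct.map_surjective hs hs _

theorem le_top (L : FDSubcoalgebra k C) (K : FDSubcoalgebra k L.toSubmodule) : K ≤ L.top :=
  (_root_.le_top : K.toSubmodule ≤ ⊤)

theorem image_top (L : FDSubcoalgebra k C) : L.image L.top = L := by
  ext1
  change Submodule.map _ ⊤ = _
  rw [Submodule.map_top, Submodule.range_subtype]

variable (L : FDSubcoalgebra k C) (K : FDSubcoalgebra k L.toSubmodule)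

theorem subtype_comp_toImage :
    (L.image K).toSubmodule.subtype ∘ₗ (L.toImage K : K.toSubmodule →ₗ[k] (L.image K).toSubmodule) =
      L.toSubmodule.subtype ∘ₗ K.toSubmodule.subtype := rfl

theorem toImage_bijective :
    Function.Bijective (L.toImage K : K.toSubmodule →ₗ[k] (L.image K).toSubmodule) := by
  constructor
  · intro x y h
    exact Subtype.ext (Subtype.ext (congrArg (fun z : (L.image K).toSubmodule => (z : C)) h))
  · rintro ⟨_, x, hx, rfl⟩
    exact ⟨⟨x, hx⟩, rfl⟩

theorem comul_comp_toImage :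
    Coalgebra.comul ∘ₗ (L.toImage K : K.toSubmodule →ₗ[k] (L.image K).toSubmodule) =
      TensorProduct.map (L.toImage K).1 (L.toImage K).1 ∘ₗ Coalgebra.comul := by
  rw [← LinearMap.cancel_left (map_inj (L.image K).toSubmodule), ← LinearMap.comp_assoc,
    ← LinearMap.comp_assoc, ← TensorProduct.map_comp, incl_comul, LinearMap.comp_assoc,
    subtype_comp_toImage, TensorProduct.map_comp, LinearMap.comp_assoc, incl_comul,
    ← LinearMap.comp_assoc, ← LinearMap.comp_assoc, incl_comul]

theorem hit_toImage (a : Module.Dual k (L.image K).toSubmodule) :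
    (L.image K).hit a ∘ₗ (L.toImage K).1 =
      (L.toImage K).1 ∘ₗ K.hit (a ∘ₗ (L.toImage K).1) := by
  set j : K.toSubmodule →ₗ[k] (L.image K).toSubmodule := (L.toImage K).1 with hj
  have e : (TensorProduct.lid k _).toLinearMap ∘ₗ a.rTensor _ ∘ₗ TensorProduct.map j j =
      j ∘ₗ (TensorProduct.lid k _).toLinearMap ∘ₗ (a ∘ₗ j).rTensor _ := by
    ext; simp
  unfold hit
  rw [LinearMap.comp_assoc, LinearMap.comp_assoc, comul_comp_toImage, ← hj,
    ← LinearMap.comp_assoc (f := Coalgebra.comul), ← LinearMap.comp_assoc, e]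
  rfl

end FDSubcoalgebra

namespace RightCoaction

variable {I : Type u} [AddCommGroup I] [Module k I] (ρ : RightCoaction k C I)
  (L : FDSubcoalgebra k C) (K : FDSubcoalgebra k L.toSubmodule)

theorem boxIncl_comp_homToBox (g : (L.image K).rightCoaction.Hom ρ) :
    ρ.boxIncl L ∘ₗ (ρ.homToBox L K g).1 = g.1 ∘ₗ (L.toImage K).1 :=
  boxIncl_comp_toBox _

theorem homToBox_bijective : Function.Bijective (ρ.homToBox L K) := by
  constructor
  · intro f g h
    have h1 := boxIncl_comp_homToBox ρ L K f
    rw [h, boxIncl_comp_homToBox] at h1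
    apply Subtype.ext
    exact ((LinearMap.cancel_right (L.toImage_bijective K).2).1 h1).symm
  · intro f
    let j := LinearEquiv.ofBijective _ (L.toImage_bijective K)
    let F := boxAdjunction K.rightCoaction ρ f
    have hF : F.1.rTensor C ∘ₗ K.rightCoaction.push.toLin = ρ.toLin ∘ₗ F.1 := F.2
    have hj : j.toLinearMap.rTensor C ∘ₗ K.rightCoaction.push.toLin =
      (L.image K).rightCoaction.toLin ∘ₗ j.toLinearMap := (L.toImage K).2
    have hjj : j.symm.toLinearMap ∘ₗ j.toLinearMap = LinearMap.id := by ext; simp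
    refine ⟨⟨F.1 ∘ₗ j.symm.toLinearMap, ?_⟩, ?_⟩
    · change LinearMap.rTensor C _ ∘ₗ _ = _
      have hjs : Function.Surjective j.toLinearMap := j.surjective
      apply (LinearMap.cancel_right hjs).1
      rw [LinearMap.comp_assoc, ← hj,
        ← LinearMap.comp_assoc, ← LinearMap.rTensor_comp, LinearMap.comp_assoc,
        LinearMap.comp_assoc, LinearMap.comp_assoc, hjj, LinearMap.comp_id]
      exact hF
    · apply Subtype.ext
      rw [← LinearMap.cancel_left (ρ.boxIncl_injective L), boxIncl_comp_homToBox]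
      change (F.1 ∘ₗ j.symm.toLinearMap) ∘ₗ j.toLinearMap = F.1
      rw [LinearMap.comp_assoc, hjj, LinearMap.comp_id]

end RightCoaction

namespace Cohom

variable {I : Type u} [AddCommGroup I] [Module k I] (ρ : RightCoaction k C I)
  (L : FDSubcoalgebra k C)

/-- Over a finite-dimensional coalgebra `L`, the cohom space is its last stage. -/
theorem of_top_surjective (σ : RightCoaction k L.toSubmodule I) :
    Function.Surjective (of σ L.top) := by
  intro c
  obtain ⟨K, φ, rfl⟩ := exists_of c
  exact ⟨_, LinearMap.congr_fun (of_trans σ K L.top (L.le_top K)) φ⟩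

theorem finite_of_isQuasifinite {σ : RightCoaction k L.toSubmodule I} (h : σ.IsQuasifinite) :
    FiniteDimensional k (Cohom σ) := by
  have := h L.top.toSubmodule L.top.rightCoaction
  exact Module.Finite.of_surjective _ (of_top_surjective L σ)

theorem compare_of (K : FDSubcoalgebra k L.toSubmodule) :
    compare ρ L ∘ₗ of (ρ.boxCoaction L) K = of ρ (L.image K) ∘ₗ (ρ.homToBox L K).dualMap :=
  desc_of _ _ _ _

variable {ρ}

theorem compare_injective (h : ρ.IsInjective) : Function.Injective (compare ρ L) := by
  rw [injective_iff_map_eq_zero]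
  intro c hc
  obtain ⟨φ, rfl⟩ := of_top_surjective L _ c
  have h1 := LinearMap.congr_fun (compare_of ρ L L.top) φ
  rw [LinearMap.comp_apply, hc] at h1
  have h2 := of_injective h _ ((map_zero _).trans h1)
  have h3 : φ = 0 := LinearMap.dualMap_injective_of_surjective (ρ.homToBox_bijective L L.top).2
    (h2.symm.trans (map_zero _).symm)
  rw [h3, map_zero]

/-- For an injective comodule `I`, the subspace `h_L(I □ L, L)` of `I^*` consists of the elements
with coefficients in `L`. -/
theorem mem_range_compare_iff (h : ρ.IsInjective) (c : Cohom ρ) :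
    c ∈ LinearMap.range (compare ρ L) ↔
      (coaction ρ).toLin c ∈ LinearMap.range (L.toSubmodule.subtype.rTensor (Cohom ρ)) := by
  have h1 : LinearMap.range (compare ρ L) = LinearMap.range (of ρ (L.image L.top)) := by
    rw [← LinearMap.range_comp_of_range_eq_top (compare ρ L)
      (LinearMap.range_eq_top.2 (of_top_surjective L _)), compare_of]
    have hs : Function.Surjective (ρ.homToBox L L.top).dualMap :=
      fun φ => ⟨φ ∘ₗ (LinearEquiv.ofBijective _ (ρ.homToBox_bijective L L.top)).symm.toLinearMap,
        LinearMap.ext fun x => congrArg φ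
          ((LinearEquiv.ofBijective _ (ρ.homToBox_bijective L L.top)).symm_apply_apply x)⟩
    exact LinearMap.range_comp_of_range_eq_top _ (LinearMap.range_eq_top.2 hs)
  rw [h1, L.image_top, mem_range_of_iff h]

variable (ρ)

theorem compare_isHom :
    (coaction (ρ.boxCoaction L)).push.IsHom (coaction ρ) (compare ρ L) := by
  apply hom_ext
  intro K
  set j : K.toSubmodule →ₗ[k] (L.image K).toSubmodule := (L.toImage K).1 with hj
  set p := (ρ.homToBox L K).dualMap with hp
  have hstage : TensorProduct.map j p ∘ₗ K.stageMap (ρ.boxCoaction L) =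
      (L.image K).stageMap ρ ∘ₗ p := by
    apply LinearMap.ext
    intro φ
    apply (L.image K).tensor_ext
    intro a
    have e1 : (TensorProduct.lid k _).toLinearMap ∘ₗ a.rTensor _ ∘ₗ TensorProduct.map j p =
        p ∘ₗ (TensorProduct.lid k _).toLinearMap ∘ₗ (a ∘ₗ j).rTensor _ := by
      apply TensorProduct.ext'
      intro x y
      simp
    have a1 := LinearMap.congr_fun e1 (K.stageMap (ρ.boxCoaction L) φ)
    simp only [LinearMap.comp_apply, LinearEquiv.coe_coe] at a1 ⊢
    rw [a1, FDSubcoalgebra.stageMap_apply, FDSubcoalgebra.stageMap_apply]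
    ext f
    simp only [hp, LinearMap.comp_apply, LinearMap.dualMap_apply]
    congr 1
    apply Subtype.ext
    rw [← LinearMap.cancel_left (ρ.boxIncl_injective L), RightCoaction.boxIncl_comp_homToBox]
    change _ ∘ₗ _ ∘ₗ K.hit (a ∘ₗ j) = (f.1 ∘ₗ (L.image K).hit a) ∘ₗ j
    rw [← LinearMap.comp_assoc, RightCoaction.boxIncl_comp_homToBox, LinearMap.comp_assoc,
      LinearMap.comp_assoc, FDSubcoalgebra.hit_toImage]
  have c1 : compare ρ L ∘ₗ of (ρ.boxCoaction L) K = of ρ (L.image K) ∘ₗ p := compare_of ρ L K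
  have c2 : (of (ρ.boxCoaction L) K).lTensor _ ∘ₗ
      K.toSubmodule.subtype.rTensor _ ∘ₗ K.stageMap (ρ.boxCoaction L) =
        (coaction (ρ.boxCoaction L)).toLin ∘ₗ of (ρ.boxCoaction L) K := of_isHom K
  have c3 : (of ρ (L.image K)).lTensor _ ∘ₗ
      (L.image K).toSubmodule.subtype.rTensor _ ∘ₗ (L.image K).stageMap ρ =
        (coaction ρ).toLin ∘ₗ of ρ (L.image K) := of_isHom (L.image K)
  change ((compare ρ L).lTensor C ∘ₗ L.toSubmodule.subtype.rTensor (Cohom (ρ.boxCoaction L)) ∘ₗ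
    (coaction (ρ.boxCoaction L)).toLin) ∘ₗ of (ρ.boxCoaction L) K =
      (coaction ρ).toLin ∘ₗ compare ρ L ∘ₗ of (ρ.boxCoaction L) K
  have lhs : ((compare ρ L).lTensor C ∘ₗ
      L.toSubmodule.subtype.rTensor (Cohom (ρ.boxCoaction L))) ∘ₗ
      (of (ρ.boxCoaction L) K).lTensor L.toSubmodule ∘ₗ
        K.toSubmodule.subtype.rTensor (K.stage (ρ.boxCoaction L)) =
      ((of ρ (L.image K)).lTensor C ∘ₗ
        (L.image K).toSubmodule.subtype.rTensor ((L.image K).stage ρ)) ∘ₗ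
        TensorProduct.map j p := by
    simp only [LinearMap.lTensor_comp_rTensor,
      ← TensorProduct.map_comp]
    rw [c1]
    rfl
  apply LinearMap.ext
  intro φ
  have a1 := LinearMap.congr_fun c1 φ
  have a2 := LinearMap.congr_fun c2 φ
  have a3 := LinearMap.congr_fun c3 (p φ)
  have a4 := LinearMap.congr_fun lhs (K.stageMap (ρ.boxCoaction L) φ)
  have a5 := LinearMap.congr_fun hstage φ
  simp only [LinearMap.comp_apply] at a1 a2 a3 a4 a5 ⊢
  rw [a1, ← a3, ← a5, ← a4, a2]

variable {ρ}

theorem compare_comp_map {J : Type u} [AddCommGroup J] [Module k J] {σ : RightCoaction k C J}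
    (f : ρ.Hom σ) :
    compare ρ L ∘ₗ map ⟨RightCoaction.boxMap f L, RightCoaction.boxMap_mem f L⟩ =
      map f ∘ₗ compare σ L := by
  apply hom_ext
  intro K
  rw [LinearMap.comp_assoc, LinearMap.comp_assoc, map_of, compare_of, ← LinearMap.comp_assoc,
    ← LinearMap.comp_assoc, compare_of, map_of, LinearMap.comp_assoc, LinearMap.comp_assoc,
    LinearMap.dualMap_comp_dualMap, LinearMap.dualMap_comp_dualMap]
  congr 2
  ext1 g
  apply Subtype.ext
  rw [← LinearMap.cancel_left (σ.boxIncl_injective L)]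
  change σ.boxIncl L ∘ₗ RightCoaction.boxMap f L ∘ₗ (ρ.homToBox L K g).1 =
    σ.boxIncl L ∘ₗ (σ.homToBox L K _).1
  rw [← LinearMap.comp_assoc, RightCoaction.boxIncl_comp_boxMap, LinearMap.comp_assoc,
    RightCoaction.boxIncl_comp_homToBox, RightCoaction.boxIncl_comp_homToBox]
  rfl

end Cohom

end CompareInjective

/-! ### Coefficients and subcomodules -/

section Coefficients

variable {k C : Type u} [Field k] [AddCommGroup C] [Module k C] [Coalgebra k C]

namespace RightCoaction

variable {M N : Type u} [AddCommGroup M] [Module k M] [AddCommGroup N] [Module k N]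

theorem coeffSpace_le (ρ : RightCoaction k C M) {W : Submodule k C}
    (h : ∀ m, ρ.toLin m ∈ LinearMap.range (W.subtype.lTensor M)) : ρ.coeffSpace ≤ W := by
  refine Submodule.span_le.2 ?_
  rintro _ ⟨φ, m, rfl⟩
  obtain ⟨s, hs⟩ := h m
  have e : (TensorProduct.lid k C).toLinearMap ∘ₗ φ.rTensor C ∘ₗ W.subtype.lTensor M =
      W.subtype ∘ₗ (TensorProduct.lid k W).toLinearMap ∘ₗ φ.rTensor W := by
    ext; simp
  have := LinearMap.congr_fun e s
  simp only [LinearMap.comp_apply, LinearEquiv.coe_coe, hs] at this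
  rw [this]
  exact Subtype.property _

/-- The coefficient space of a finite-dimensional comodule is a finite-dimensional subcoalgebra:
`Δ (φ ⊗ 1) ρ m = (φ ⊗ 1 ⊗ 1) (ρ ⊗ 1) ρ m`. -/
noncomputable def coeffSubcoalgebra [FiniteDimensional k M] (ρ : RightCoaction k C M) :
    FDSubcoalgebra k C where
  toSubmodule := ρ.coeffSpace
  finite := by
    let f : Module.Dual k M ⊗[k] M →ₗ[k] C := TensorProduct.lift
      (LinearMap.mk₂ k (fun (φ : Module.Dual k M) m => TensorProduct.lid k C
        (φ.rTensor C (ρ.toLin m)))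
        (by intros; simp [LinearMap.rTensor_add]) (by intros; simp [LinearMap.rTensor_smul])
        (by intros; simp) (by intros; simp))
    refine Submodule.finiteDimensional_of_le (S₂ := LinearMap.range f) (Submodule.span_le.2 ?_)
    rintro _ ⟨φ, m, rfl⟩
    exact ⟨φ ⊗ₜ m, rfl⟩
  comul_mem := by
    set i := ρ.coeffSpace.subtype with hi
    set l := liftInj (i.lTensor M) (lTensor_inj _ M) ρ.toLin
      (ρ.mem_range_of_coeffSpace_le _ le_rfl) with hl
    have hs : i.lTensor M ∘ₗ l = ρ.toLin := liftInj_spec _ _ _ _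
    have e1 : (TensorProduct.map i i).lTensor M ∘ₗ (TensorProduct.assoc k M _ _).toLinearMap ∘ₗ
          l.rTensor _ = (TensorProduct.assoc k M C C).toLinearMap ∘ₗ
        ρ.toLin.rTensor C ∘ₗ i.lTensor M := by
      have : (TensorProduct.assoc k M C C).toLinearMap ∘ₗ TensorProduct.map (i.lTensor M) i =
          (TensorProduct.map i i).lTensor M ∘ₗ (TensorProduct.assoc k M _ _).toLinearMap := by
        ext; rfl
      rw [LinearMap.rTensor_comp_lTensor, ← hs, ← LinearMap.comp_assoc, ← this,
        LinearMap.comp_assoc, LinearMap.map_comp_rTensor]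
    intro x hx
    induction hx using Submodule.span_induction with
    | zero => rw [map_zero]; exact zero_mem _
    | add x y _ _ hx hy => rw [map_add]; exact add_mem hx hy
    | smul c x _ hx => rw [map_smul]; exact Submodule.smul_mem _ _ hx
    | mem x hx =>
      obtain ⟨φ, m, rfl⟩ := hx
      have e2 : Coalgebra.comul ∘ₗ (TensorProduct.lid k C).toLinearMap ∘ₗ φ.rTensor C =
          (TensorProduct.lid k _).toLinearMap ∘ₗ φ.rTensor _ ∘ₗ Coalgebra.comul.lTensor M := by
        ext; simp
      have e3 : (TensorProduct.lid k _).toLinearMap ∘ₗ φ.rTensor _ ∘ₗ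
          (TensorProduct.map i i).lTensor M =
          TensorProduct.map i i ∘ₗ (TensorProduct.lid k _).toLinearMap ∘ₗ φ.rTensor _ := by
        ext; simp
      have a1 := LinearMap.congr_fun e1 (l m)
      have a2 := LinearMap.congr_fun e2 (ρ.toLin m)
      have a3 := LinearMap.congr_fun e3 (TensorProduct.assoc k M _ _ (l.rTensor _ (l m)))
      have a4 := LinearMap.congr_fun hs m
      have a5 := LinearMap.congr_fun ρ.coassoc m
      simp only [LinearMap.comp_apply, LinearEquiv.coe_coe] at a1 a2 a3 a4 a5
      rw [a2, ← a5, ← a4, ← a1, a3]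
      exact ⟨_, rfl⟩

/-- Subcomodules are the subspaces stable under `x ↦ ∑ ψ(x₁) x₀` for all linear forms `ψ`. -/
theorem isSub_iff (ρ : RightCoaction k C M) (X : Submodule k M) :
    ρ.IsSub X ↔ ∀ x ∈ X, ∀ ψ : Module.Dual k C,
      TensorProduct.rid k M (ψ.lTensor M (ρ.toLin x)) ∈ X :=
  forall₂_congr fun _ _ => mem_range_rTensor_subtype_iff_dual _ _

theorem Hom.map_rid {ρ : RightCoaction k C M} {σ : RightCoaction k C N} {f : M →ₗ[k] N}
    (hf : f ∈ ρ.Hom σ) (ψ : Module.Dual k C) (x : M) :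
    f (TensorProduct.rid k M (ψ.lTensor M (ρ.toLin x))) =
      TensorProduct.rid k N (ψ.lTensor N (σ.toLin (f x))) := by
  have e : f ∘ₗ (TensorProduct.rid k M).toLinearMap ∘ₗ ψ.lTensor M =
      (TensorProduct.rid k N).toLinearMap ∘ₗ ψ.lTensor N ∘ₗ f.rTensor C := by
    ext; simp
  have a1 := LinearMap.congr_fun e (ρ.toLin x)
  have a2 : f.rTensor C (ρ.toLin x) = σ.toLin (f x) := LinearMap.congr_fun hf x
  rw [← a2]
  exact a1

theorem IsSub.inf {ρ : RightCoaction k C M} {X Y : Submodule k M} (hX : ρ.IsSub X)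
    (hY : ρ.IsSub Y) : ρ.IsSub (X ⊓ Y) := by
  rw [isSub_iff] at *
  exact fun x hx ψ => ⟨hX x hx.1 ψ, hY x hx.2 ψ⟩

theorem IsSub.map {ρ : RightCoaction k C M} {σ : RightCoaction k C N} {f : M →ₗ[k] N}
    (hf : f ∈ ρ.Hom σ) {X : Submodule k M} (hX : ρ.IsSub X) : σ.IsSub (X.map f) := by
  rw [isSub_iff] at *
  rintro _ ⟨x, hx, rfl⟩ ψ
  exact ⟨_, hX x hx ψ, Hom.map_rid hf ψ x⟩

theorem IsSub.comap {ρ : RightCoaction k C M} {σ : RightCoaction k C N} {f : M →ₗ[k] N}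
    (hf : f ∈ ρ.Hom σ) {X : Submodule k N} (hX : σ.IsSub X) : ρ.IsSub (X.comap f) := by
  rw [isSub_iff] at *
  intro x hx ψ
  rw [Submodule.mem_comap, Hom.map_rid hf]
  exact hX _ hx ψ

theorem isSub_top (ρ : RightCoaction k C M) : ρ.IsSub ⊤ :=
  (isSub_iff _ _).2 fun _ _ _ => trivial

theorem IsSub.push {L : FDSubcoalgebra k C} {σ : RightCoaction k L.toSubmodule M}
    {X : Submodule k M} (hX : σ.IsSub X) : σ.push.IsSub X := by
  intro x hx
  obtain ⟨s, hs⟩ := hX x hx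
  refine ⟨L.toSubmodule.subtype.lTensor X s, ?_⟩
  change _ = L.toSubmodule.subtype.lTensor M (σ.toLin x)
  rw [← hs, ← LinearMap.comp_apply, ← LinearMap.comp_apply, LinearMap.rTensor_comp_lTensor,
    LinearMap.lTensor_comp_rTensor]

theorem isSub_range_boxIncl (ρ : RightCoaction k C M) (L : FDSubcoalgebra k C) :
    ρ.IsSub (LinearMap.range (ρ.boxIncl L)) := by
  rw [← Submodule.map_top]
  exact (isSub_top _).map (ρ.boxIncl_mem L)

/-- The coaction modulo a subcoalgebra, `M → M ⊗ C/L`. -/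
noncomputable def coactionMod (ρ : RightCoaction k C M) (L : FDSubcoalgebra k C) :
    M →ₗ[k] M ⊗[k] (C ⧸ L.toSubmodule) :=
  L.toSubmodule.mkQ.lTensor M ∘ₗ ρ.toLin

theorem ker_coactionMod (ρ : RightCoaction k C M) (L : FDSubcoalgebra k C) :
    LinearMap.ker (ρ.coactionMod L) = LinearMap.range (ρ.boxIncl L) := by
  ext x
  rw [mem_range_boxIncl, mem_range_lTensor_subtype_iff_mkQ]
  rfl

theorem Hom.coactionMod {ρ : RightCoaction k C M} {σ : RightCoaction k C N} {f : M →ₗ[k] N}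
    (hf : f ∈ ρ.Hom σ) (L : FDSubcoalgebra k C) (x : M) :
    f.rTensor _ (ρ.coactionMod L x) = σ.coactionMod L (f x) := by
  have a : f.rTensor C (ρ.toLin x) = σ.toLin (f x) := LinearMap.congr_fun hf x
  change (f.rTensor _ ∘ₗ L.toSubmodule.mkQ.lTensor M) (ρ.toLin x) =
    L.toSubmodule.mkQ.lTensor N (σ.toLin (f x))
  have e : f.rTensor _ ∘ₗ L.toSubmodule.mkQ.lTensor M = L.toSubmodule.mkQ.lTensor N ∘ₗ f.rTensor C := by
    rw [LinearMap.rTensor_comp_lTensor, LinearMap.lTensor_comp_rTensor]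
  rw [← a, e]
  rfl

end RightCoaction

namespace FDSubcoalgebra

/-- The map `C → C/L ⊗ C/L` induced by the comultiplication; its kernel is the wedge `L ∧ L`. -/
noncomputable def wedgeMap (L : FDSubcoalgebra k C) :
    C →ₗ[k] (C ⧸ L.toSubmodule) ⊗[k] (C ⧸ L.toSubmodule) :=
  TensorProduct.map L.toSubmodule.mkQ L.toSubmodule.mkQ ∘ₗ Coalgebra.comul

theorem le_ker_wedgeMap (L : FDSubcoalgebra k C) : L.toSubmodule ≤ LinearMap.ker L.wedgeMap := by
  intro x hx
  obtain ⟨t, ht⟩ := L.comul_mem x hx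
  rw [LinearMap.mem_ker, wedgeMap, LinearMap.comp_apply, ← ht, ← LinearMap.comp_apply,
    ← TensorProduct.map_comp]
  have : L.toSubmodule.mkQ ∘ₗ L.toSubmodule.subtype = 0 := by ext; simp
  rw [this, TensorProduct.map_zero_left, LinearMap.zero_apply]

end FDSubcoalgebra

namespace RightCoaction

variable {M : Type u} [AddCommGroup M] [Module k M]

/-- Applying the coaction modulo `L` twice is the coaction followed by the map with kernel
`L ∧ L`. -/
theorem coactionMod_coactionMod (ρ : RightCoaction k C M) (L : FDSubcoalgebra k C) (x : M) :
    TensorProduct.assoc k M _ _ ((ρ.coactionMod L).rTensor _ (ρ.coactionMod L x)) =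
      L.wedgeMap.lTensor M (ρ.toLin x) := by
  set π := L.toSubmodule.mkQ with hπ
  have e1 : (TensorProduct.assoc k M _ _).toLinearMap ∘ₗ (ρ.coactionMod L).rTensor _ ∘ₗ
      π.lTensor M = (TensorProduct.map π π).lTensor M ∘ₗ
        (TensorProduct.assoc k M C C).toLinearMap ∘ₗ ρ.toLin.rTensor C := by
    have : (TensorProduct.map π π).lTensor M ∘ₗ (TensorProduct.assoc k M C C).toLinearMap =
        (TensorProduct.assoc k M _ _).toLinearMap ∘ₗ TensorProduct.map (π.lTensor M) π := by
      ext; rfl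
    rw [← LinearMap.comp_assoc _ _ (LinearMap.lTensor _ _), this, LinearMap.comp_assoc,
      LinearMap.map_comp_rTensor, LinearMap.rTensor_comp_lTensor]
    rfl
  have a1 := LinearMap.congr_fun e1 (ρ.toLin x)
  have a2 := LinearMap.congr_fun ρ.coassoc x
  simp only [LinearMap.comp_apply, LinearEquiv.coe_coe] at a1 a2
  rw [a2] at a1
  rw [FDSubcoalgebra.wedgeMap, LinearMap.lTensor_comp]
  exact a1

/-- An extension of comodules with coefficients in `L` has coefficients in `L ∧ L`. -/
theorem coeffSpace_le_ker_wedgeMap (ρ : RightCoaction k C M) (L : FDSubcoalgebra k C)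
    (N : Submodule k M) (hN : ∀ x ∈ N, ρ.coactionMod L x = 0)
    (hM : ∀ x, ρ.coactionMod L x ∈ LinearMap.range (N.subtype.rTensor (C ⧸ L.toSubmodule))) :
    ρ.coeffSpace ≤ LinearMap.ker L.wedgeMap := by
  apply coeffSpace_le
  intro x
  apply (Module.Flat.lTensor_exact M (LinearMap.exact_subtype_ker_map L.wedgeMap) _).1
  obtain ⟨s, hs⟩ := hM x
  have h0 : ρ.coactionMod L ∘ₗ N.subtype = 0 := LinearMap.ext fun x => hN x x.2
  rw [← coactionMod_coactionMod, ← hs, ← LinearMap.comp_apply (LinearMap.rTensor _ _),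
    ← LinearMap.rTensor_comp, h0]
  simp

/-- A nonzero comodule with coefficients in `L ∧ L` contains a nonzero element with coefficients
in `L`: otherwise the coaction modulo `L` would be an injective map with square zero. -/
theorem IsSub.inf_range_boxIncl_ne_bot {ρ : RightCoaction k C M} (L : FDSubcoalgebra k C)
    {X : Submodule k M} (hX : ρ.IsSub X) (hne : X ≠ ⊥)
    (hw : ∀ x ∈ X, L.wedgeMap.lTensor M (ρ.toLin x) = 0) :
    X ⊓ LinearMap.range (ρ.boxIncl L) ≠ ⊥ := by
  rw [← ker_coactionMod]
  intro hbot
  apply hne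
  rw [eq_bot_iff, ← hbot]
  refine fun x hx => ⟨hx, ?_⟩
  change ρ.coactionMod L x = 0
  have hker : ρ.coactionMod L x ∈ LinearMap.range
      ((LinearMap.ker (ρ.coactionMod L)).subtype.rTensor (C ⧸ L.toSubmodule)) := by
    apply (Module.Flat.rTensor_exact _ (LinearMap.exact_subtype_ker_map (ρ.coactionMod L)) _).1
    apply (TensorProduct.assoc k M _ _).injective
    rw [coactionMod_coactionMod, hw x hx, map_zero]
  rw [mem_range_rTensor_subtype_iff_dual] at hker
  apply eq_zero_of_forall_lTensor_dual
  intro ψ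
  have hmem : TensorProduct.rid k M (ψ.lTensor M (ρ.coactionMod L x)) ∈ X := by
    have := (isSub_iff ρ X).1 hX x hx (ψ ∘ₗ L.toSubmodule.mkQ)
    rw [LinearMap.lTensor_comp] at this
    exact this
  exact (Submodule.eq_bot_iff _).1 hbot _ ⟨hmem, hker ψ⟩

end RightCoaction

end Coefficients

/-! ### Restriction of a copresentation to a subcoalgebra -/

section RestrictCopresentation

variable {k C : Type u} [Field k] [AddCommGroup C] [Module k C] [Coalgebra k C]
  {M : Type u} [AddCommGroup M] [Module k M] {ρ : RightCoaction k C M}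

namespace Copresentation

variable (P : Copresentation ρ) (L : FDSubcoalgebra k C) (h : ρ.coeffSpace ≤ L.toSubmodule)

theorem boxIncl_restrict_d₀ (m : M) : P.ρ₀.boxIncl L ((P.restrict L h).d₀.1 m) = P.d₀.1 m :=
  LinearMap.congr_fun (RightCoaction.boxIncl_comp_toBox (σ := ρ.restrict L h) _) m

theorem boxIncl_restrict_d₁ (t : P.ρ₀.box L) :
    P.ρ₁.boxIncl L ((P.restrict L h).d₁.1 t) = P.d₁.1 (P.ρ₀.boxIncl L t) :=
  LinearMap.congr_fun (RightCoaction.boxIncl_comp_boxMap P.d₁) t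

variable {P}

theorem IsQuasifiniteInjective.restrict (hP : P.IsQuasifiniteInjective) :
    (P.restrict L h).IsQuasifiniteInjective where
  inj x y hxy := by
    apply hP.inj
    rw [← boxIncl_restrict_d₀ P L h, ← boxIncl_restrict_d₀ P L h]
    exact congrArg _ hxy
  exact t := by
    have h0 := hP.exact (P.ρ₀.boxIncl L t)
    have e := boxIncl_restrict_d₁ P L h t
    have h1 : P.ρ₁.boxIncl L ((P.restrict L h).d₁.1 t) = 0 ↔ P.ρ₀.boxIncl L t ∈ Set.range P.d₀.1 :=
      ⟨fun ht => h0.1 (e.symm.trans ht), fun ht => e.trans (h0.2 ht)⟩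
    constructor
    · intro ht
      obtain ⟨m, hm⟩ := h1.1 ((congrArg _ ht).trans (map_zero _))
      exact ⟨m, P.ρ₀.boxIncl_injective L ((boxIncl_restrict_d₀ P L h m).trans hm)⟩
    · rintro ⟨m, rfl⟩
      exact P.ρ₁.boxIncl_injective L ((h1.2 ⟨m, (boxIncl_restrict_d₀ P L h m).symm⟩).trans
        (map_zero _).symm)
  injective₀ := hP.injective₀.boxCoaction
  injective₁ := hP.injective₁.boxCoaction
  quasifinite₀ := hP.quasifinite₀.boxCoaction
  quasifinite₁ := hP.quasifinite₁.boxCoaction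

theorem IsQuasifiniteInjective.finite_transpose (hP : P.IsQuasifiniteInjective) :
    FiniteDimensional k (P.restrict L h).transpose := by
  have : FiniteDimensional k (Cohom (P.restrict L h).ρ₁) :=
    Cohom.finite_of_isQuasifinite L (hP.restrict L h).quasifinite₁
  infer_instance

/-- With `E` the preimage in `I₀` of the part of `I₁` with coefficients in `L`, the subcoalgebra
`L + cf(E)` lies in `L ∧ L`. So a nonzero subcomodule of `I₁` with coefficients in it has a nonzero
part with coefficients in `L`, which meets the image of `E`. -/
theorem IsQuasifiniteInjective.exists_isMinimal_restrict [FiniteDimensional k M]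
    (hL : ρ.coeffSpace ≤ L.toSubmodule) (hP : P.IsQuasifiniteInjective) (hmin : P.IsMinimal) :
    ∃ (L' : FDSubcoalgebra k C) (h' : ρ.coeffSpace ≤ L'.toSubmodule), L ≤ L' ∧
      (P.restrict L' h').IsMinimal := by
  let E : Submodule k P.I₀ := (LinearMap.range (P.ρ₁.boxIncl L)).comap P.d₁.1
  have hE : P.ρ₀.IsSub E := (P.ρ₁.isSub_range_boxIncl L).comap P.d₁.2
  let σ := P.ρ₀.sub E hE
  have hσ : E.subtype ∈ σ.Hom P.ρ₀ := P.ρ₀.sub_spec E hE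
  let d : E →ₗ[k] P.I₁ := P.d₁.1 ∘ₗ E.subtype
  have hd : d ∈ σ.Hom P.ρ₁ := RightCoaction.comp_mem P.d₁.2 hσ
  have hkerd (e : E) (he : d e = 0) : ∃ m, P.d₀.1 m = e := (hP.exact e).1 he
  have hfin : FiniteDimensional k E := by
    have := hP.quasifinite₁.finite_range_boxIncl hP.injective₁ L
    have h1 : FiniteDimensional k (LinearMap.range d) := by
      refine Submodule.finiteDimensional_of_le (S₂ := LinearMap.range (P.ρ₁.boxIncl L)) ?_
      rintro _ ⟨e, rfl⟩
      exact e.2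
    have h2 : FiniteDimensional k (LinearMap.ker d) := by
      have h3 : FiniteDimensional k ((LinearMap.ker d).map E.subtype) := by
        refine Submodule.finiteDimensional_of_le (S₂ := LinearMap.range P.d₀.1) ?_
        rintro _ ⟨e, he, rfl⟩
        exact hkerd e he
      exact Module.Finite.equiv
        (Submodule.equivMapOfInjective _ E.injective_subtype (LinearMap.ker d)).symm
    have h4 := Module.Finite.equiv d.quotKerEquivRange.symm
    exact Module.Finite.of_submodule_quotient (LinearMap.ker d)
  have hdmod (e : E) : P.ρ₁.coactionMod L (d e) = 0 := by
    rw [← LinearMap.mem_ker, RightCoaction.ker_coactionMod]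
    exact e.2
  have hkermod (e : E) (he : d e = 0) : σ.coactionMod L e = 0 := by
    obtain ⟨m, hm⟩ := hkerd e he
    apply rTensor_inj E
    rw [RightCoaction.Hom.coactionMod hσ, map_zero, Submodule.subtype_apply, ← hm,
      ← RightCoaction.Hom.coactionMod P.d₀.2]
    have : ρ.coactionMod L m = 0 :=
      (mem_range_lTensor_subtype_iff_mkQ _ _).1 (ρ.mem_range_of_coeffSpace_le _ hL m)
    rw [this, map_zero]
  let L' : FDSubcoalgebra k C := L.sup σ.coeffSubcoalgebra
  have hLL' : L ≤ L' := (le_sup_left : L.toSubmodule ≤ _)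
  have hwedge : L'.toSubmodule ≤ LinearMap.ker L.wedgeMap := by
    refine sup_le L.le_ker_wedgeMap
      (σ.coeffSpace_le_ker_wedgeMap L (LinearMap.ker d) (fun e he => hkermod e he) fun e => ?_)
    apply (Module.Flat.rTensor_exact _ (LinearMap.exact_subtype_ker_map d) _).1
    rw [RightCoaction.Hom.coactionMod hd, hdmod]
  have hEL' (e : P.I₀) (he : e ∈ E) : e ∈ LinearMap.range (P.ρ₀.boxIncl L') := by
    rw [RightCoaction.mem_range_boxIncl]
    obtain ⟨s, hs⟩ := σ.mem_range_of_coeffSpace_le L'.toSubmodule le_sup_right ⟨e, he⟩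
    refine ⟨E.subtype.rTensor _ s, ?_⟩
    have := LinearMap.congr_fun hσ ⟨e, he⟩
    simp only [LinearMap.comp_apply] at this
    rw [Submodule.subtype_apply] at this
    rw [← this, ← hs, ← LinearMap.comp_apply, ← LinearMap.comp_apply,
      LinearMap.rTensor_comp_lTensor, LinearMap.lTensor_comp_rTensor]
  have h' : ρ.coeffSpace ≤ L'.toSubmodule := hL.trans hLL'
  refine ⟨L', h', hLL', ?_, ?_⟩
  · intro X hX hne
    have h1 := hmin.1 (X.map (P.ρ₀.boxIncl L')) (hX.push.map (P.ρ₀.boxIncl_mem L'))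
      (by
        rw [Ne, ← Submodule.map_bot (P.ρ₀.boxIncl L')]
        exact (Submodule.map_injective_of_injective (P.ρ₀.boxIncl_injective L')).ne hne)
    obtain ⟨_, ⟨⟨t, ht, rfl⟩, m, hm⟩, h0⟩ := (Submodule.ne_bot_iff _).1 h1
    refine (Submodule.ne_bot_iff _).2 ⟨t, ⟨ht, m, ?_⟩, ?_⟩
    · exact P.ρ₀.boxIncl_injective L' ((boxIncl_restrict_d₀ P L' h' m).trans hm)
    · rintro rfl
      exact h0 (map_zero _)
  · intro X hX hne
    have hX' := hX.push.map (P.ρ₁.boxIncl_mem L')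
    have hY := hX'.inf_range_boxIncl_ne_bot L
      (by
        rw [Ne, ← Submodule.map_bot (P.ρ₁.boxIncl L')]
        exact (Submodule.map_injective_of_injective (P.ρ₁.boxIncl_injective L')).ne hne) (by
        rintro _ ⟨t, _, rfl⟩
        have : L.wedgeMap ∘ₗ L'.toSubmodule.subtype = 0 :=
          LinearMap.ext fun x => hwedge x.2
        rw [RightCoaction.toLin_boxIncl, ← LinearMap.comp_apply, ← LinearMap.lTensor_comp, this]
        simp)
    have h1 := hmin.2 _ (hX'.inf (P.ρ₁.isSub_range_boxIncl L)) hY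
    obtain ⟨_, ⟨⟨⟨t, ht, rfl⟩, hL⟩, e, he⟩, h0⟩ := (Submodule.ne_bot_iff _).1 h1
    obtain ⟨e', he'⟩ := hEL' e (show P.d₁.1 e ∈ _ from he ▸ hL)
    refine (Submodule.ne_bot_iff _).2 ⟨t, ⟨ht, e', ?_⟩, ?_⟩
    · apply P.ρ₁.boxIncl_injective L'
      rw [← he, ← he']
      exact boxIncl_restrict_d₁ P L' h' e'
    · rintro rfl
      exact h0 (map_zero _)

end Copresentation

end RestrictCopresentation

/-! ### The transpose over a subcoalgebra -/

section TransposeRestrict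

variable {k C : Type u} [Field k] [AddCommGroup C] [Module k C] [Coalgebra k C]

theorem LeftCoaction.IsHom.push {X Y : Type u} [AddCommGroup X] [Module k X] [AddCommGroup Y]
    [Module k Y] {L : FDSubcoalgebra k C} {σ : LeftCoaction k L.toSubmodule X}
    {τ : LeftCoaction k L.toSubmodule Y} {f : X →ₗ[k] Y} (hf : σ.IsHom τ f) :
    σ.push.IsHom τ.push f := by
  change f.lTensor _ ∘ₗ σ.toLin = τ.toLin ∘ₗ f at hf
  change f.lTensor C ∘ₗ L.toSubmodule.subtype.rTensor X ∘ₗ σ.toLin =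
    (L.toSubmodule.subtype.rTensor Y ∘ₗ τ.toLin) ∘ₗ f
  rw [LinearMap.comp_assoc, ← hf, ← LinearMap.comp_assoc, ← LinearMap.comp_assoc,
    LinearMap.lTensor_comp_rTensor, LinearMap.rTensor_comp_lTensor]

/-- Injective linear maps with the same image have isomorphic sources over that image. -/
theorem exists_equiv_of_range_eq {V W U : Type u} [AddCommMonoid V] [Module k V] [AddCommMonoid W]
    [Module k W] [AddCommMonoid U] [Module k U] {f : V →ₗ[k] U} {g : W →ₗ[k] U}
    (hf : Function.Injective f) (hg : Function.Injective g)
    (h : LinearMap.range f = LinearMap.range g) :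
    ∃ e : V ≃ₗ[k] W, g ∘ₗ e.toLinearMap = f := by
  refine ⟨(LinearEquiv.ofInjective f hf).trans ((LinearEquiv.ofEq _ _ h).trans
    (LinearEquiv.ofInjective g hg).symm), ?_⟩
  ext v
  have := LinearEquiv.ofInjective_apply g (h := hg) ((LinearEquiv.ofInjective g hg).symm
    (LinearEquiv.ofEq _ _ h (LinearEquiv.ofInjective f hf v)))
  rw [LinearEquiv.apply_symm_apply] at this
  exact this.symm

namespace Copresentation

variable {M : Type u} [AddCommGroup M] [Module k M] {ρ : RightCoaction k C M}
  {P : Copresentation ρ} (L : FDSubcoalgebra k C) (h : ρ.coeffSpace ≤ L.toSubmodule)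

variable (P) in
/-- The canonical map `h_L(I₁ □ L, L) → h_C(I₁, C)`, with its source written as the cohom space of
the last term of the restricted copresentation. -/
noncomputable def cohomCompare : Cohom (P.restrict L h).ρ₁ →ₗ[k] Cohom P.ρ₁ :=
  Cohom.compare P.ρ₁ L

theorem map_cohomCompare (c : Cohom (P.restrict L h).ρ₁) :
    Cohom.map P.d₁ (P.cohomCompare L h c) =
      Cohom.compare P.ρ₀ L (Cohom.map (P.restrict L h).d₁ c) :=
  (LinearMap.congr_fun (Cohom.compare_comp_map L P.d₁) c).symm

variable (P) in
/-- The restriction `Tr_L M → Tr M` of the canonical map `h_L(I₁ □ L, L) → h_C(I₁, C)`. -/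
noncomputable def transposeCompare : (P.restrict L h).transpose →ₗ[k] P.transpose :=
  (P.cohomCompare L h).restrict fun c hc => by
    rw [transpose, LinearMap.mem_ker] at hc ⊢
    rw [map_cohomCompare, hc]
    exact map_zero _

theorem subtype_comp_transposeCompare :
    P.transpose.subtype ∘ₗ P.transposeCompare L h =
      P.cohomCompare L h ∘ₗ (P.restrict L h).transpose.subtype := rfl

variable (P) in
theorem subtype_isHom :
    P.transposeCoaction.IsHom (Cohom.coaction P.ρ₁) P.transpose.subtype :=
  LeftCoaction.sub_spec _ _ _

variable (P) in
theorem transposeCompare_isHom :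
    (P.restrict L h).transposeCoaction.push.IsHom P.transposeCoaction (P.transposeCompare L h) := by
  refine LeftCoaction.IsHom.of_comp P.subtype_isHom P.transpose.injective_subtype ?_
  rw [subtype_comp_transposeCompare]
  exact (Cohom.compare_isHom P.ρ₁ L).comp (P.restrict L h).subtype_isHom.push

theorem transposeCompare_injective (h₁ : P.ρ₁.IsInjective) :
    Function.Injective (P.transposeCompare L h) := by
  intro x y hxy
  exact Subtype.ext (Cohom.compare_injective L h₁ (congrArg Subtype.val hxy))

/-- The image of `Tr_L M` in `Tr M` consists of the elements with coefficients in `L`. -/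
theorem mem_range_transposeCompare_iff (h₀ : P.ρ₀.IsInjective) (h₁ : P.ρ₁.IsInjective)
    (c : P.transpose) : c ∈ LinearMap.range (P.transposeCompare L h) ↔
      (Cohom.coaction P.ρ₁).toLin (c : Cohom P.ρ₁) ∈
        LinearMap.range (L.toSubmodule.subtype.rTensor (Cohom P.ρ₁)) := by
  rw [← Cohom.mem_range_compare_iff L h₁]
  constructor
  · rintro ⟨t, rfl⟩
    exact ⟨(t : Cohom (P.restrict L h).ρ₁), rfl⟩
  · intro hc
    obtain ⟨t, ht⟩ : ∃ t : Cohom (P.restrict L h).ρ₁, P.cohomCompare L h t = c := hc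
    have h2 : Cohom.map P.d₁ (P.cohomCompare L h t) = 0 := (congrArg _ ht).trans c.2
    have h4 := (map_cohomCompare L h t).symm.trans h2
    have h3 : t ∈ (P.restrict L h).transpose :=
      LinearMap.mem_ker.2 (Cohom.compare_injective L h₀ (h4.trans (map_zero _).symm))
    exact ⟨⟨t, h3⟩, Subtype.ext ht⟩

theorem range_transposeCompare (h₀ : P.ρ₀.IsInjective) (h₁ : P.ρ₁.IsInjective) :
    LinearMap.range (P.transposeCompare L h) =
      LinearMap.range (P.transposeCoaction.boxIncl L) := by
  ext c
  rw [mem_range_transposeCompare_iff L h h₀ h₁, LeftCoaction.mem_range_boxIncl]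
  have hc : P.transpose.subtype.lTensor C (P.transposeCoaction.toLin c) =
    (Cohom.coaction P.ρ₁).toLin c := LinearMap.congr_fun P.subtype_isHom c
  rw [← hc]
  constructor
  · exact mem_range_rTensor_of_lTensor P.transpose.injective_subtype _
  · rintro ⟨s, hs⟩
    refine ⟨P.transpose.subtype.lTensor _ s, ?_⟩
    rw [← hs, ← LinearMap.comp_apply, ← LinearMap.comp_apply, LinearMap.rTensor_comp_lTensor,
      LinearMap.lTensor_comp_rTensor]

theorem range_transposeCompare_mono (h₀ : P.ρ₀.IsInjective) (h₁ : P.ρ₁.IsInjective)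
    {L L' : FDSubcoalgebra k C} (hL : L ≤ L') (h : ρ.coeffSpace ≤ L.toSubmodule)
    (h' : ρ.coeffSpace ≤ L'.toSubmodule) :
    LinearMap.range (P.transposeCompare L h) ≤ LinearMap.range (P.transposeCompare L' h') := by
  intro c hc
  rw [mem_range_transposeCompare_iff _ _ h₀ h₁, ← Cohom.mem_range_of_iff h₁] at hc ⊢
  obtain ⟨φ, hφ⟩ := hc
  exact ⟨_, (LinearMap.congr_fun (Cohom.of_trans P.ρ₁ L L' hL) φ).trans hφ⟩

theorem exists_mem_range_transposeCompare (h₀ : P.ρ₀.IsInjective) (h₁ : P.ρ₁.IsInjective)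
    (c : P.transpose) : ∃ L₀ : FDSubcoalgebra k C, ∀ L (h : ρ.coeffSpace ≤ L.toSubmodule),
      L₀ ≤ L → c ∈ LinearMap.range (P.transposeCompare L h) := by
  obtain ⟨L₀, φ, hφ⟩ := Cohom.exists_of (c : Cohom P.ρ₁)
  refine ⟨L₀, fun L h hL => ?_⟩
  rw [mem_range_transposeCompare_iff L h h₀ h₁, ← Cohom.mem_range_of_iff h₁]
  exact ⟨_, (LinearMap.congr_fun (Cohom.of_trans P.ρ₁ L₀ L hL) φ).trans hφ⟩

end Copresentation

end TransposeRestrict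

/-! ### Directed unions of subcomodules -/

section DirectedUnion

variable {k C : Type u} [Field k] [AddCommGroup C] [Module k C] [Coalgebra k C]

/-- A comodule that is the directed union of the images of injective comodule maps is the direct
limit of their sources. -/
theorem isComoduleDirectLimit_of_injective {ι : Type u} [PartialOrder ι] [Nonempty ι]
    [IsDirectedOrder ι] {X : ι → Type u} [∀ i, AddCommGroup (X i)] [∀ i, Module k (X i)]
    {lam : ∀ i, LeftCoaction k C (X i)} {Y : Type u} [AddCommGroup Y] [Module k Y]
    {mu : LeftCoaction k C Y} {c : ∀ i, X i →ₗ[k] Y} (hc : ∀ i, (lam i).IsHom mu (c i))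
    (hinj : ∀ i, Function.Injective (c i))
    (hle : ∀ i j, i ≤ j → LinearMap.range (c i) ≤ LinearMap.range (c j))
    (hcover : ∀ y, ∃ i, y ∈ LinearMap.range (c i)) :
    IsComoduleDirectLimit X lam
      (fun i j hij => liftInj (c j) (hinj j) (c i) fun v => hle i j hij ⟨v, rfl⟩) mu c := by
  classical
  set τ : ∀ i j, i ≤ j → X i →ₗ[k] X j := fun i j hij =>
    liftInj (c j) (hinj j) (c i) fun v => hle i j hij ⟨v, rfl⟩ with hτ
  have hcτ (i j h) : c j ∘ₗ τ i j h = c i := liftInj_spec _ _ _ _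
  refine ⟨inferInstance, exists_ge_ge, fun i j hij => ?_, fun i => ?_, fun i j l h h' => ?_, hc, hcτ,
    fun Z _ _ nu g hg hgτ => ?_⟩
  · refine (hc j).of_comp (hinj j) ?_
    rw [hcτ i j hij]
    exact hc i
  · rw [← LinearMap.cancel_left (hinj i), hcτ i i le_rfl, LinearMap.comp_id]
  · rw [← LinearMap.cancel_left (hinj l), ← LinearMap.comp_assoc, hcτ j l h', hcτ i j h,
      hcτ i l (h.trans h')]
  · let cl : Module.DirectLimit X τ →ₗ[k] Y :=
      Module.DirectLimit.lift k ι X τ c fun i j h x => LinearMap.congr_fun (hcτ i j h) x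
    have hcl : Function.Bijective cl := by
      refine ⟨Module.DirectLimit.lift_injective _ _ hinj, fun y => ?_⟩
      obtain ⟨i, x, hx⟩ := hcover y
      exact ⟨Module.DirectLimit.of k ι X τ i x, (Module.DirectLimit.lift_of _ _ _).trans hx⟩
    let E := LinearEquiv.ofBijective cl hcl
    let gl : Module.DirectLimit X τ →ₗ[k] Z :=
      Module.DirectLimit.lift k ι X τ g fun i j h x => LinearMap.congr_fun (hgτ i j h) x
    let u : Y →ₗ[k] Z := gl ∘ₗ E.symm.toLinearMap
    have huc (i) : u ∘ₗ c i = g i := by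
      ext x
      have h1 : E.symm (c i x) = Module.DirectLimit.of k ι X τ i x := by
        rw [LinearEquiv.symm_apply_eq]
        exact (Module.DirectLimit.lift_of (f := τ) c
          (fun i j h x => LinearMap.congr_fun (hcτ i j h) x) x).symm
      change gl (E.symm (c i x)) = _
      rw [h1]
      exact Module.DirectLimit.lift_of _ _ _
    refine ⟨u, ⟨?_, huc⟩, fun v hv => ?_⟩
    · change u.lTensor C ∘ₗ mu.toLin = nu.toLin ∘ₗ u
      ext y
      obtain ⟨i, x, rfl⟩ := hcover y
      have h1 : (c i).lTensor C ((lam i).toLin x) = mu.toLin (c i x) :=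
        LinearMap.congr_fun (hc i) x
      have h2 : (g i).lTensor C ((lam i).toLin x) = nu.toLin (g i x) :=
        LinearMap.congr_fun (hg i) x
      rw [LinearMap.comp_apply, LinearMap.comp_apply, ← h1, ← LinearMap.comp_apply,
        ← LinearMap.lTensor_comp, huc, h2, ← huc i]
      rfl
    · ext y
      obtain ⟨i, x, rfl⟩ := hcover y
      exact (LinearMap.congr_fun (hv.2 i) x).trans (LinearMap.congr_fun (huc i) x).symm

end DirectedUnion

/-! ### The transpose as a direct limit -/

theorem proposition1 {k Γ M : Type u} [Field k] [AddCommGroup Γ] [Module k Γ] [Coalgebra k Γ]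
    [AddCommGroup M] [Module k M] [FiniteDimensional k M] (ρ : RightCoaction k Γ M)
    (hind : ρ.IsIndecomposable) (hninj : ¬ ρ.IsInjective)
    (P : Copresentation ρ) (hP : P.IsQuasifiniteInjective) :
    (∀ Λ : ρ.CoeffSubcoalgebra, (P.restrict Λ.1 Λ.2).IsQuasifiniteInjective ∧
      FiniteDimensional k (P.restrict Λ.1 Λ.2).transpose) ∧
    (P.IsMinimal → ∀ Λ : ρ.CoeffSubcoalgebra, ∃ Λ' : ρ.CoeffSubcoalgebra,
      Λ ≤ Λ' ∧ (P.restrict Λ'.1 Λ'.2).IsMinimal) ∧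
    ∃ e : ∀ Λ : ρ.CoeffSubcoalgebra,
        (P.restrict Λ.1 Λ.2).transpose ≃ₗ[k] P.transposeCoaction.box Λ.1,
      (∀ Λ : ρ.CoeffSubcoalgebra, (P.restrict Λ.1 Λ.2).transposeCoaction.IsHom
        (P.transposeCoaction.boxCoaction Λ.1) (e Λ).toLinearMap) ∧
      (∀ (Λ : ρ.CoeffSubcoalgebra) (t : (P.restrict Λ.1 Λ.2).transpose),
        (P.transposeCoaction.boxIncl Λ.1 (e Λ t) : Cohom P.ρ₁) =
          Cohom.compare P.ρ₁ Λ.1 (t : Cohom (P.restrict Λ.1 Λ.2).ρ₁)) ∧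
      ∃ τ : ∀ Λ Λ' : ρ.CoeffSubcoalgebra, Λ ≤ Λ' →
          (P.restrict Λ.1 Λ.2).transpose →ₗ[k] (P.restrict Λ'.1 Λ'.2).transpose,
        IsComoduleDirectLimit
          (fun Λ : ρ.CoeffSubcoalgebra => (P.restrict Λ.1 Λ.2).transpose)
          (fun Λ => (P.restrict Λ.1 Λ.2).transposeCoaction.push) τ
          P.transposeCoaction
          (fun Λ => P.transposeCoaction.boxIncl Λ.1 ∘ₗ (e Λ).toLinearMap) := by
  refine ⟨fun Λ => ⟨hP.restrict Λ.1 Λ.2, hP.finite_transpose Λ.1 Λ.2⟩, fun hmin Λ => ?_, ?_⟩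
  · obtain ⟨L', h', hle, hmin'⟩ := hP.exists_isMinimal_restrict Λ.1 Λ.2 hmin
    exact ⟨⟨L', h'⟩, hle, hmin'⟩
  have h₀ := hP.injective₀
  have h₁ := hP.injective₁
  have hequiv (Λ : ρ.CoeffSubcoalgebra) :
      ∃ e : (P.restrict Λ.1 Λ.2).transpose ≃ₗ[k] P.transposeCoaction.box Λ.1,
        P.transposeCoaction.boxIncl Λ.1 ∘ₗ e.toLinearMap = P.transposeCompare Λ.1 Λ.2 :=
    exists_equiv_of_range_eq (Copresentation.transposeCompare_injective Λ.1 Λ.2 h₁)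
      (P.transposeCoaction.boxIncl_injective Λ.1)
      (Copresentation.range_transposeCompare Λ.1 Λ.2 h₀ h₁)
  choose e he using hequiv
  have hdir : IsDirectedOrder ρ.CoeffSubcoalgebra := ⟨fun Λ Λ' =>
    ⟨⟨Λ.1.sup Λ'.1, Λ.2.trans le_sup_left⟩, (le_sup_left : Λ.1.toSubmodule ≤ _),
      (le_sup_right : Λ'.1.toSubmodule ≤ _)⟩⟩
  have hne : Nonempty ρ.CoeffSubcoalgebra := ⟨⟨ρ.coeffSubcoalgebra, le_rfl⟩⟩
  refine ⟨e, fun Λ => ?_, fun Λ t => ?_, ?_⟩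
  · refine LeftCoaction.isHom_of_push ((P.transposeCoaction.boxIncl_isHom Λ.1).of_comp
      (P.transposeCoaction.boxIncl_injective Λ.1) ?_)
    rw [he]
    exact P.transposeCompare_isHom Λ.1 Λ.2
  · exact congrArg Subtype.val (LinearMap.congr_fun (he Λ) t)
  · simp only [he]
    refine ⟨_, isComoduleDirectLimit_of_injective
      (X := fun Λ : ρ.CoeffSubcoalgebra => (P.restrict Λ.1 Λ.2).transpose)
      (lam := fun Λ => (P.restrict Λ.1 Λ.2).transposeCoaction.push) (mu := P.transposeCoaction)
      (c := fun Λ => P.transposeCompare Λ.1 Λ.2)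
      (fun Λ => P.transposeCompare_isHom Λ.1 Λ.2)
      (fun Λ => Copresentation.transposeCompare_injective Λ.1 Λ.2 h₁)
      (fun Λ Λ' hle => Copresentation.range_transposeCompare_mono h₀ h₁ hle Λ.2 Λ'.2) fun c => ?_⟩
    obtain ⟨L₀, hL₀⟩ := Copresentation.exists_mem_range_transposeCompare h₀ h₁ c
    let Λ : ρ.CoeffSubcoalgebra := ⟨ρ.coeffSubcoalgebra.sup L₀,
      (le_sup_left : ρ.coeffSubcoalgebra.toSubmodule ≤ _)⟩
    have hle : L₀ ≤ Λ.1 := (le_sup_right : L₀.toSubmodule ≤ _)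
    exact ⟨Λ, hL₀ Λ.1 Λ.2 hle⟩
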